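/- Let $n\ge 1$. A partition of degree $n$ is an equivalence relation $\alpha$ on $\{1,\dots,n\}\cup\{1',\dots,n'\}$; its classes are called blocks, a block is transverse if it contains both unprimed and primed points, and $\operatorname{rank}(\alpha)$ is the number of transverse blocks. The product $\alpha\beta$ is obtained by placing $\alpha$ on $\{1,\dots,n\}\cup\{1'',\dots,n''\}$ and $\beta$ on $\{1'',\dots,n''\}\cup\{1',\dots,n'\}$, taking the smallest equivalence relation on all $3n$ points that contains both, and restricting it to $\{1,\dots,n\}\cup\{1',\dots,n'\}$. With respect to the order $n'<\dots<1'<1<\dots<n$, a partition is planar if there are no distinct blocks $A,X$ and points $a,b\in A$, $x,y\in X$ with $a<x<b<y$. The Motzkin monoid $\mathcal M_n$ is the monoid of all planar partitions of degree $n$ whose blocks have size at most $2$; its identity $\mathrm{id}_n$ has blocks $\{i,i'\}$. Put $J_k=\{\alpha\in\mathcal M_n:\operatorname{rank}(\alpha)=k\}$. A maximal subsemigroup of a semigroup $S$ is a proper subsemigroup of $S$ that is contained in no other proper subsemigroup of $S$. For a maximal subsemigroup $T$ of a finite monoid $S$ such that $S\setminus T$ is contained in a regular $\mathscr J$-class $J$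 of $S$, we say that $T$ is of type (M1) if $T\cap J=\varnothing$; of type (M2) if $T\cap J$ is the union of a non-empty proper collection of $\mathscr L$-classes of $J$ and a non-empty proper collection of $\mathscr R$-classes of $J$; of type (M3) if $T\cap J$ is a non-empty union of $\mathscr L$-classes of $J$; and of type (M4) if $T\cap J$ is a non-empty union of $\mathscr R$-classes of $J$. **Theorem.** Let $n\ge 2$. The maximal subsemigroups of $\mathcal M_n$ are exactly the following sets: (a) $\mathcal M_n\setminus\{\mathrm{id}_n\}$, of type (M1); (b) for each non-empty proper subset $A$ of $\{1,\dots,n\}$, the union of $\mathcal M_n\setminus J_{n-1}$ and $$\bigcup_{i\in A}\{\alpha\in J_{n-1}: \{i\}\text{ is a block of }\alpha\}\ \cup\ \bigcup_{i\notin A}\{\alpha\in J_{n-1}: \{i'\}\text{ is a block of }\alpha\},$$ of type (M2); there are $2^n-2$ of these; (c) $\mathcal M_n\setminus\{\alpha\in J_{n-2}: \{i,i+1\}\text{ is a block of }\alpha\}$ for $i\in\{1,\dots,n-1\}$, of type (M4); (d) $\mathcal M_n\setminus\{\alpha\in J_{n-2}: \{i',(i+1)'\}\text{ is a block of }\alpha\}$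 for $i\in\{1,\dots,n-1\}$, of type (M3). In total there are $2^n+2n-3$ maximal subsemigroups of $\mathcal M_n$. The Motzkin monoid $\mathcal M_1$ consists of all partitions of degree $1$ and is a semilattice of order $2$; its maximal subsemigroups are exactly its singleton subsets. -/

import Mathlib

/-! ### Maximal subsemigroups and their types -/

/-- `T` is a maximal subsemigroup of `S`: a proper subsemigroup that is contained in no other
proper subsemigroup. -/
def IsMaximalSubsemigroup {S : Type*} [Mul S] (T : Set S) : Prop :=
  ∃ M : Subsemigroup S, (M : Set S) = T ∧ IsCoatom M

section Green

variable {S : Type*} [Semigroup S]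

/-- The principal left ideal `Sx ∪ {x}`. -/
def principalLeftIdeal (x : S) : Set S := {y | y = x ∨ ∃ s, y = s * x}

/-- The principal right ideal `xS ∪ {x}`. -/
def principalRightIdeal (x : S) : Set S := {y | y = x ∨ ∃ s, y = x * s}

/-- The principal two-sided ideal `SxS ∪ Sx ∪ xS ∪ {x}`. -/
def principalIdeal (x : S) : Set S :=
  {y | y = x ∨ (∃ s, y = s * x) ∨ (∃ s, y = x * s) ∨ ∃ s t, y = s * x * t}

/-- `L` is an equivalence class of Green's `ℒ`-relation. -/
def IsLClass (L : Set S) : Prop :=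
  ∃ x, L = {y | principalLeftIdeal y = principalLeftIdeal x}

/-- `R` is an equivalence class of Green's `ℛ`-relation. -/
def IsRClass (R : Set S) : Prop :=
  ∃ x, R = {y | principalRightIdeal y = principalRightIdeal x}

/-- `J` is an equivalence class of Green's `𝒥`-relation. -/
def IsJClass (J : Set S) : Prop :=
  ∃ x, J = {y | principalIdeal y = principalIdeal x}

/-- `T` arises from the regular `𝒥`-class `J`: `J` contains a regular element and the
complement of `T`. -/
def ArisesFrom (T J : Set S) : Prop :=
  IsJClass J ∧ (∃ x ∈ J, ∃ y, x * y * x = x) ∧ Tᶜ ⊆ J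

/-- Type in which a whole `𝒥`-class `J` is removed: `T ∩ J` is empty. -/
def IsRemoveJType (T : Set S) : Prop :=
  ∃ J, ArisesFrom T J ∧ T ∩ J = ∅

/-- Rectangle type: `T ∩ J` is a union of both `ℒ`-classes and `ℛ`-classes of `J`, namely of a
non-empty proper collection of `ℒ`-classes and a non-empty proper collection of
`ℛ`-classes of `J`. -/
def IsRectangleType (T : Set S) : Prop :=
  ∃ J, ArisesFrom T J ∧ ∃ 𝓐 𝓑 : Set (Set S),
    𝓐.Nonempty ∧ 𝓐 ⊂ {L | IsLClass L ∧ L ⊆ J} ∧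
    𝓑.Nonempty ∧ 𝓑 ⊂ {R | IsRClass R ∧ R ⊆ J} ∧
    T ∩ J = ⋃₀ 𝓐 ∪ ⋃₀ 𝓑

/-- Type in which `ℒ`-classes are removed: `T ∩ J` is a non-empty union of `ℒ`-classes of `J`. -/
def IsRemoveLType (T : Set S) : Prop :=
  ∃ J, ArisesFrom T J ∧ (T ∩ J).Nonempty ∧
    ∃ 𝓐 ⊆ {L | IsLClass L ∧ L ⊆ J}, T ∩ J = ⋃₀ 𝓐

/-- Type in which `ℛ`-classes are removed: `T ∩ J` is a non-empty union of `ℛ`-classes of `J`. -/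
def IsRemoveRType (T : Set S) : Prop :=
  ∃ J, ArisesFrom T J ∧ (T ∩ J).Nonempty ∧
    ∃ 𝓑 ⊆ {R | IsRClass R ∧ R ⊆ J}, T ∩ J = ⋃₀ 𝓑

end Green

/-! ### The partition monoid -/

/-- Partitions of degree `n`: equivalence relations on `{1, …, n} ∪ {1', …, n'}`.
`Sum.inl i` is the point `i + 1` and `Sum.inr i` is the point `(i + 1)'`, for `i : Fin n`. -/
def DiagramPartition (n : ℕ) : Type := Setoid (Fin n ⊕ Fin n)

/-- The set `{1, …, n} ∪ {1'', …, n''} ∪ {1', …, n'}`, in this order. -/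
abbrev ThreeRows (n : ℕ) : Type := Fin n ⊕ (Fin n ⊕ Fin n)

/-- `i ↦ i`, `i' ↦ i''`. -/
def upperRows {n : ℕ} : Fin n ⊕ Fin n → ThreeRows n := Sum.map id Sum.inl

/-- `i ↦ i''`, `i' ↦ i'`. -/
def lowerRows {n : ℕ} : Fin n ⊕ Fin n → ThreeRows n := Sum.inr

/-- `i ↦ i`, `i' ↦ i'`. -/
def outerRows {n : ℕ} : Fin n ⊕ Fin n → ThreeRows n := Sum.map id Sum.inr

namespace DiagramPartition

variable {n : ℕ}

/-- `α.Rel x y`: the points `x` and `y` lie in the same block of `α`. -/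
def Rel (α : DiagramPartition n) (x y : Fin n ⊕ Fin n) : Prop := Setoid.r (self := α) x y

/-- The set of blocks. -/
def blocks (α : DiagramPartition n) : Set (Set (Fin n ⊕ Fin n)) := Setoid.classes α

/-- A set of points is transverse if it contains both unprimed and primed points. -/
def IsTransverse (B : Set (Fin n ⊕ Fin n)) : Prop :=
  (∃ i, Sum.inl i ∈ B) ∧ ∃ i, Sum.inr i ∈ B

/-- The rank: the number of transverse blocks. -/
noncomputable def rank (α : DiagramPartition n) : ℕ :=
  {B | B ∈ α.blocks ∧ IsTransverse B}.ncard

theorem rel_equiv (α : DiagramPartition n) : Equivalence α.Rel := Setoid.iseqv (self := α)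

theorem rel_ext {α β : DiagramPartition n} (h : ∀ x y, α.Rel x y ↔ β.Rel x y) : α = β :=
  Setoid.ext h

/-- The relation `α' ∪ β'` on three rows. -/
def glueRel (α β : DiagramPartition n) (u v : ThreeRows n) : Prop :=
  (∃ a b, α.Rel a b ∧ upperRows a = u ∧ upperRows b = v) ∨
    ∃ a b, β.Rel a b ∧ lowerRows a = u ∧ lowerRows b = v

/-- The smallest equivalence on three rows containing `α' ∪ β'`. -/
def glue (α β : DiagramPartition n) : Setoid (ThreeRows n) :=
  Relation.EqvGen.setoid (glueRel α β)

/-- The product: glue `α` on top of `β`, and restrict to the outer rows. -/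
instance : Mul (DiagramPartition n) :=
  ⟨fun α β => Setoid.comap outerRows (glue α β)⟩

/-- The identity partition, with blocks `{i, i'}`. -/
instance : One (DiagramPartition n) :=
  ⟨Setoid.ker (Sum.elim id id : Fin n ⊕ Fin n → Fin n)⟩

theorem mul_rel (α β : DiagramPartition n) (x y) :
    (α * β).Rel x y ↔ Relation.EqvGen (glueRel α β) (outerRows x) (outerRows y) := Iff.rfl

theorem one_rel (x y : Fin n ⊕ Fin n) :
    (1 : DiagramPartition n).Rel x y ↔ (Sum.elim id id x : Fin n) = Sum.elim id id y := Iff.rfl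

end DiagramPartition

theorem eqvGen_le {V : Type*} {r s : V → V → Prop}
    (h : ∀ u v, r u v → Relation.EqvGen s u v) {u v : V} (huv : Relation.EqvGen r u v) :
    Relation.EqvGen s u v := by
  induction huv with
  | rel a b h' => exact h _ _ h'
  | refl a => exact Relation.EqvGen.refl _
  | symm a b _ ih => exact Relation.EqvGen.symm _ _ ih
  | trans a b c _ _ ih1 ih2 => exact Relation.EqvGen.trans _ _ _ ih1 ih2

theorem eqvGen_contract {V W : Type*} (f : W → V) (r : V → V → Prop) (s : W → W → Prop)
    (x y : W) :
    Relation.EqvGen (fun u v => r u v ∨ ∃ a b, s a b ∧ f a = u ∧ f b = v) (f x) (f y) ↔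
      Relation.EqvGen (fun a b => Relation.EqvGen r (f a) (f b) ∨ s a b) x y := by
  set N := Relation.EqvGen (fun a b => Relation.EqvGen r (f a) (f b) ∨ s a b) with hN
  have eN : Equivalence N := Relation.EqvGen.is_equivalence _
  have er : Equivalence (Relation.EqvGen r) := Relation.EqvGen.is_equivalence _
  constructor
  · intro h
    have key : ∀ u v,
        Relation.EqvGen (fun u v => r u v ∨ ∃ a b, s a b ∧ f a = u ∧ f b = v) u v →
        ∀ w, (∃ p, Relation.EqvGen r u (f p) ∧ N p w) ↔
          ∃ p, Relation.EqvGen r v (f p) ∧ N p w := by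
      intro u v huv
      induction huv with
      | rel u v h =>
        intro w
        rcases h with h | ⟨a, b, hab, rfl, rfl⟩
        · have h' := Relation.EqvGen.rel _ _ h
          exact ⟨fun ⟨p, h1, h2⟩ => ⟨p, er.trans (er.symm h') h1, h2⟩,
            fun ⟨p, h1, h2⟩ => ⟨p, er.trans h' h1, h2⟩⟩
        · have hN' : N a b := Relation.EqvGen.rel _ _ (Or.inr hab)
          have gen : ∀ a w, (∃ p, Relation.EqvGen r (f a) (f p) ∧ N p w) ↔ N a w := by
            intro a w
            exact ⟨fun ⟨p, h1, h2⟩ => eN.trans (Relation.EqvGen.rel _ _ (Or.inl h1)) h2,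
              fun h => ⟨a, er.refl _, h⟩⟩
          rw [gen, gen]
          exact ⟨eN.trans (eN.symm hN'), eN.trans hN'⟩
      | refl u => exact fun w => Iff.rfl
      | symm u v _ ih => exact fun w => (ih w).symm
      | trans u v t _ _ ih1 ih2 => exact fun w => (ih1 w).trans (ih2 w)
    obtain ⟨p, h1, h2⟩ := (key _ _ h y).2 ⟨y, er.refl _, eN.refl _⟩
    exact eN.trans (Relation.EqvGen.rel _ _ (Or.inl h1)) h2
  · intro h
    induction h with
    | rel a b h =>
      rcases h with h | h
      · exact eqvGen_le (fun _ _ h => Relation.EqvGen.rel _ _ (Or.inl h)) h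
      · exact Relation.EqvGen.rel _ _ (Or.inr ⟨a, b, h, rfl, rfl⟩)
    | refl a => exact Relation.EqvGen.refl _
    | symm a b _ ih => exact Relation.EqvGen.symm _ _ ih
    | trans a b c _ _ ih1 ih2 => exact Relation.EqvGen.trans _ _ _ ih1 ih2

theorem eqvGen_image {V W : Type*} {f : W → V} (hf : Function.Injective f)
    (s : W → W → Prop) (u v : V) :
    Relation.EqvGen (fun u v => ∃ a b, s a b ∧ f a = u ∧ f b = v) u v ↔
      u = v ∨ ∃ a b, Relation.EqvGen s a b ∧ f a = u ∧ f b = v := by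
  have es : Equivalence (Relation.EqvGen s) := Relation.EqvGen.is_equivalence _
  constructor
  · intro h
    induction h with
    | rel u v h =>
      obtain ⟨a, b, h, rfl, rfl⟩ := h
      exact Or.inr ⟨a, b, Relation.EqvGen.rel _ _ h, rfl, rfl⟩
    | refl u => exact Or.inl rfl
    | symm u v _ ih =>
      rcases ih with rfl | ⟨a, b, h, rfl, rfl⟩
      · exact Or.inl rfl
      · exact Or.inr ⟨b, a, es.symm h, rfl, rfl⟩
    | trans u v w _ _ ih1 ih2 =>
      rcases ih1 with rfl | ⟨a, b, h, rfl, rfl⟩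
      · exact ih2
      · rcases ih2 with rfl | ⟨c, d, h', h1, rfl⟩
        · exact Or.inr ⟨a, b, h, rfl, rfl⟩
        · obtain rfl := hf h1
          exact Or.inr ⟨a, d, es.trans h h', rfl, rfl⟩
  · rintro (rfl | ⟨a, b, h, rfl, rfl⟩)
    · exact Relation.EqvGen.refl _
    · induction h with
      | rel a b h => exact Relation.EqvGen.rel _ _ ⟨a, b, h, rfl, rfl⟩
      | refl a => exact Relation.EqvGen.refl _
      | symm a b _ ih => exact Relation.EqvGen.symm _ _ ih
      | trans a b c _ _ ih1 ih2 => exact Relation.EqvGen.trans _ _ _ ih1 ih2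

namespace DiagramPartition

variable {n : ℕ}

/-- A four-row description of a triple product, used only for associativity. -/
def glueRel4 (α β γ : DiagramPartition n) (u v : Fin n ⊕ ThreeRows n) : Prop :=
  (∃ a b, α.Rel a b ∧ Sum.map id Sum.inl a = u ∧ Sum.map id Sum.inl b = v) ∨
  (∃ a b, β.Rel a b ∧ Sum.inr (upperRows a) = u ∧ Sum.inr (upperRows b) = v) ∨
  (∃ a b, γ.Rel a b ∧ Sum.inr (lowerRows a) = u ∧ Sum.inr (lowerRows b) = v)

theorem mul_mul_rel_left (α β γ : DiagramPartition n) (x y) :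
    (α * β * γ).Rel x y ↔ Relation.EqvGen (glueRel4 α β γ)
      (Sum.map id (Sum.inr ∘ Sum.inr) x) (Sum.map id (Sum.inr ∘ Sum.inr) y) := by
  let ι : ThreeRows n → Fin n ⊕ ThreeRows n := Sum.map id (Sum.map id Sum.inl)
  have hι : Function.Injective ι :=
    Function.injective_id.sumMap (Function.injective_id.sumMap Sum.inl_injective)
  let f : ThreeRows n → Fin n ⊕ ThreeRows n := Sum.map id Sum.inr
  let r : Fin n ⊕ ThreeRows n → Fin n ⊕ ThreeRows n → Prop :=
    fun u v => ∃ a b, glueRel α β a b ∧ ι a = u ∧ ι b = v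
  let s : ThreeRows n → ThreeRows n → Prop :=
    fun u v => ∃ a b, γ.Rel a b ∧ lowerRows a = u ∧ lowerRows b = v
  have h4 : glueRel4 α β γ = fun u v => r u v ∨ ∃ a b, s a b ∧ f a = u ∧ f b = v := by
    funext u v
    apply propext
    constructor
    · rintro (⟨a, b, h, rfl, rfl⟩ | ⟨a, b, h, rfl, rfl⟩ | ⟨a, b, h, rfl, rfl⟩)
      · exact Or.inl ⟨upperRows a, upperRows b, Or.inl ⟨a, b, h, rfl, rfl⟩,
          by cases a <;> rfl, by cases b <;> rfl⟩
      · exact Or.inl ⟨lowerRows a, lowerRows b, Or.inr ⟨a, b, h, rfl, rfl⟩,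
          by cases a <;> rfl, by cases b <;> rfl⟩
      · exact Or.inr ⟨_, _, ⟨a, b, h, rfl, rfl⟩, rfl, rfl⟩
    · rintro (⟨_, _, ⟨a, b, h, rfl, rfl⟩ | ⟨a, b, h, rfl, rfl⟩, rfl, rfl⟩ |
        ⟨_, _, ⟨a, b, h, rfl, rfl⟩, rfl, rfl⟩)
      · exact Or.inl ⟨a, b, h, by cases a <;> rfl, by cases b <;> rfl⟩
      · exact Or.inr (Or.inl ⟨a, b, h, by cases a <;> rfl, by cases b <;> rfl⟩)
      · exact Or.inr (Or.inr ⟨a, b, h, rfl, rfl⟩)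
  have hx : ∀ x : Fin n ⊕ Fin n,
      (Sum.map id (Sum.inr ∘ Sum.inr) x : Fin n ⊕ ThreeRows n) = f (outerRows x) := by
    rintro (x | x) <;> rfl
  rw [hx, hx, h4, eqvGen_contract, mul_rel]
  constructor
  · refine eqvGen_le ?_
    rintro u v (⟨a, b, h, rfl, rfl⟩ | h)
    · refine Relation.EqvGen.rel _ _ (Or.inl ((eqvGen_image hι _ _ _).2 (Or.inr ?_)))
      exact ⟨_, _, h, by cases a <;> rfl, by cases b <;> rfl⟩
    · exact Relation.EqvGen.rel _ _ (Or.inr h)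
  · refine eqvGen_le ?_
    rintro u v (hr | h)
    · rcases (eqvGen_image hι _ _ _).1 hr with h | ⟨a, b, h, h1, h2⟩
      · have hf : Function.Injective f := Function.injective_id.sumMap Sum.inr_injective
        rw [hf h]
        exact Relation.EqvGen.refl _
      · have key : ∀ (a u : ThreeRows n), ι a = f u →
            ∃ c, a = outerRows c ∧ u = upperRows c := by
          rintro (a | a | a) (u | u | u) h <;> simp [ι, f] at h
          · exact ⟨Sum.inl a, rfl, by rw [h]; rfl⟩
          · exact ⟨Sum.inr a, rfl, by rw [h]; rfl⟩
        obtain ⟨c, rfl, rfl⟩ := key _ _ h1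
        obtain ⟨d, rfl, rfl⟩ := key _ _ h2
        exact Relation.EqvGen.rel _ _ (Or.inl ⟨c, d, h, rfl, rfl⟩)
    · exact Relation.EqvGen.rel _ _ (Or.inr h)

theorem mul_mul_rel_right (α β γ : DiagramPartition n) (x y) :
    (α * (β * γ)).Rel x y ↔ Relation.EqvGen (glueRel4 α β γ)
      (Sum.map id (Sum.inr ∘ Sum.inr) x) (Sum.map id (Sum.inr ∘ Sum.inr) y) := by
  let ι : ThreeRows n → Fin n ⊕ ThreeRows n := Sum.inr
  have hι : Function.Injective ι := Sum.inr_injective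
  let f : ThreeRows n → Fin n ⊕ ThreeRows n := Sum.map id outerRows
  have ho : Function.Injective (outerRows (n := n)) :=
    Function.injective_id.sumMap Sum.inr_injective
  have hf : Function.Injective f := Function.injective_id.sumMap ho
  let r : Fin n ⊕ ThreeRows n → Fin n ⊕ ThreeRows n → Prop :=
    fun u v => ∃ a b, glueRel β γ a b ∧ ι a = u ∧ ι b = v
  let s : ThreeRows n → ThreeRows n → Prop :=
    fun u v => ∃ a b, α.Rel a b ∧ upperRows a = u ∧ upperRows b = v
  have h4 : glueRel4 α β γ = fun u v => r u v ∨ ∃ a b, s a b ∧ f a = u ∧ f b = v := by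
    funext u v
    apply propext
    constructor
    · rintro (⟨a, b, h, rfl, rfl⟩ | ⟨a, b, h, rfl, rfl⟩ | ⟨a, b, h, rfl, rfl⟩)
      · exact Or.inr ⟨_, _, ⟨a, b, h, rfl, rfl⟩, by cases a <;> rfl, by cases b <;> rfl⟩
      · exact Or.inl ⟨upperRows a, upperRows b, Or.inl ⟨a, b, h, rfl, rfl⟩, rfl, rfl⟩
      · exact Or.inl ⟨lowerRows a, lowerRows b, Or.inr ⟨a, b, h, rfl, rfl⟩, rfl, rfl⟩
    · rintro (⟨_, _, ⟨a, b, h, rfl, rfl⟩ | ⟨a, b, h, rfl, rfl⟩, rfl, rfl⟩ |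
        ⟨_, _, ⟨a, b, h, rfl, rfl⟩, rfl, rfl⟩)
      · exact Or.inr (Or.inl ⟨a, b, h, rfl, rfl⟩)
      · exact Or.inr (Or.inr ⟨a, b, h, rfl, rfl⟩)
      · exact Or.inl ⟨a, b, h, by cases a <;> rfl, by cases b <;> rfl⟩
  have hx : ∀ x : Fin n ⊕ Fin n,
      (Sum.map id (Sum.inr ∘ Sum.inr) x : Fin n ⊕ ThreeRows n) = f (outerRows x) := by
    rintro (x | x) <;> rfl
  rw [hx, hx, h4, eqvGen_contract, mul_rel]
  constructor
  · refine eqvGen_le ?_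
    rintro u v (h | ⟨a, b, h, rfl, rfl⟩)
    · exact Relation.EqvGen.rel _ _ (Or.inr h)
    · refine Relation.EqvGen.rel _ _ (Or.inl ((eqvGen_image hι _ _ _).2 (Or.inr ?_)))
      exact ⟨_, _, h, by cases a <;> rfl, by cases b <;> rfl⟩
  · refine eqvGen_le ?_
    rintro u v (hr | h)
    · rcases (eqvGen_image hι _ _ _).1 hr with h | ⟨a, b, h, h1, h2⟩
      · rw [hf h]
        exact Relation.EqvGen.refl _
      · have key : ∀ (a u : ThreeRows n), ι a = f u →
            ∃ c, a = outerRows c ∧ u = lowerRows c := by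
          rintro a (u | u) h
          · simp [ι, f] at h
          · exact ⟨u, Sum.inr_injective h, rfl⟩
        obtain ⟨c, rfl, rfl⟩ := key _ _ h1
        obtain ⟨d, rfl, rfl⟩ := key _ _ h2
        exact Relation.EqvGen.rel _ _ (Or.inr ⟨c, d, h, rfl, rfl⟩)
    · exact Relation.EqvGen.rel _ _ (Or.inl h)

theorem one_mul_aux (α : DiagramPartition n) : 1 * α = α := by
  let g : ThreeRows n → Fin n ⊕ Fin n := Sum.elim Sum.inl id
  have hg : ∀ u v, Relation.EqvGen (glueRel 1 α) u v → α.Rel (g u) (g v) := by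
    intro u v h
    induction h with
    | rel u v h =>
      rcases h with ⟨a, b, h, rfl, rfl⟩ | ⟨a, b, h, rfl, rfl⟩
      · rw [one_rel] at h
        have : g (upperRows a) = g (upperRows b) := by
          rcases a with a | a <;> rcases b with b | b <;>
            · simp only [Sum.elim_inl, Sum.elim_inr, id] at h
              subst h
              rfl
        rw [this]
        exact α.rel_equiv.refl _
      · exact h
    | refl u => exact α.rel_equiv.refl _
    | symm u v _ ih => exact α.rel_equiv.symm ih
    | trans u v w _ _ ih1 ih2 => exact α.rel_equiv.trans ih1 ih2
  have ho : ∀ x : Fin n ⊕ Fin n, g (outerRows x) = x := by rintro (x | x) <;> rfl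
  have hl : ∀ x : Fin n ⊕ Fin n,
      Relation.EqvGen (glueRel 1 α) (outerRows x) (lowerRows x) := by
    rintro (x | x)
    · exact Relation.EqvGen.rel _ _ (Or.inl ⟨Sum.inl x, Sum.inr x, rfl, rfl, rfl⟩)
    · exact Relation.EqvGen.refl _
  refine rel_ext fun x y => ?_
  rw [mul_rel]
  constructor
  · intro h
    simpa only [ho] using hg _ _ h
  · intro h
    exact ((hl x).trans _ _ _ (Relation.EqvGen.rel _ _ (Or.inr ⟨x, y, h, rfl, rfl⟩))).trans
      _ _ _ ((hl y).symm _ _)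

theorem mul_one_aux (α : DiagramPartition n) : α * 1 = α := by
  let g : ThreeRows n → Fin n ⊕ Fin n := Sum.map id (Sum.elim id id)
  have hgu : ∀ x : Fin n ⊕ Fin n, g (upperRows x) = x := by rintro (x | x) <;> rfl
  have hg : ∀ u v, Relation.EqvGen (glueRel α 1) u v → α.Rel (g u) (g v) := by
    intro u v h
    induction h with
    | rel u v h =>
      rcases h with ⟨a, b, h, rfl, rfl⟩ | ⟨a, b, h, rfl, rfl⟩
      · rwa [hgu, hgu]
      · rw [one_rel] at h
        have : g (lowerRows a) = g (lowerRows b) := congrArg Sum.inr h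
        rw [this]
        exact α.rel_equiv.refl _
    | refl u => exact α.rel_equiv.refl _
    | symm u v _ ih => exact α.rel_equiv.symm ih
    | trans u v w _ _ ih1 ih2 => exact α.rel_equiv.trans ih1 ih2
  have ho : ∀ x : Fin n ⊕ Fin n, g (outerRows x) = x := by rintro (x | x) <;> rfl
  have hl : ∀ x : Fin n ⊕ Fin n,
      Relation.EqvGen (glueRel α 1) (outerRows x) (upperRows x) := by
    rintro (x | x)
    · exact Relation.EqvGen.refl _
    · exact Relation.EqvGen.rel _ _ (Or.inr ⟨Sum.inr x, Sum.inl x, rfl, rfl, rfl⟩)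
  refine rel_ext fun x y => ?_
  rw [mul_rel]
  constructor
  · intro h
    simpa only [ho] using hg _ _ h
  · intro h
    exact ((hl x).trans _ _ _ (Relation.EqvGen.rel _ _ (Or.inl ⟨x, y, h, rfl, rfl⟩))).trans
      _ _ _ ((hl y).symm _ _)

/-- The partition monoid of degree `n`. -/
instance : Monoid (DiagramPartition n) where
  mul_assoc α β γ := rel_ext fun x y =>
    (mul_mul_rel_left α β γ x y).trans (mul_mul_rel_right α β γ x y).symm
  one_mul := one_mul_aux
  mul_one := mul_one_aux

/-! ### The Motzkin monoid -/

/-- The position of a point in the order `n' < ⋯ < 1' < 1 < ⋯ < n`. -/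
def position : Fin n ⊕ Fin n → ℤ :=
  Sum.elim (fun i => (i : ℤ) + 1) (fun i => -((i : ℤ) + 1))

/-- No two distinct blocks cross. -/
def IsPlanar (α : DiagramPartition n) : Prop :=
  ¬ ∃ A ∈ α.blocks, ∃ X ∈ α.blocks, A ≠ X ∧ ∃ a ∈ A, ∃ b ∈ A, ∃ x ∈ X, ∃ y ∈ X,
    position a < position x ∧ position x < position b ∧ position b < position y

/-- Each block has size at most 2. -/
def IsPartialBrauer (α : DiagramPartition n) : Prop :=
  ∀ A ∈ α.blocks, A.ncard ≤ 2

theorem isPlanar_iff (α : DiagramPartition n) :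
    α.IsPlanar ↔ ∀ a b x y, α.Rel a b → α.Rel x y → position a < position x →
      position x < position b → position b < position y → α.Rel a x := by
  constructor
  · intro h a b x y hab hxy h1 h2 h3
    by_contra hax
    refine h ⟨{z | α.Rel z a}, ⟨a, rfl⟩, {z | α.Rel z x}, ⟨x, rfl⟩, ?_, a, α.rel_equiv.refl a, b,
      α.rel_equiv.symm hab, x, α.rel_equiv.refl x, y, α.rel_equiv.symm hxy, h1, h2, h3⟩
    intro he
    have : a ∈ {z | α.Rel z x} := he ▸ α.rel_equiv.refl a
    exact hax this
  · rintro h ⟨A, ⟨c, rfl⟩, X, ⟨d, rfl⟩, hne, a, ha, b, hb, x, hx, y, hy, h1, h2, h3⟩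
    have ha' : α.Rel a c := ha
    have hb' : α.Rel b c := hb
    have hx' : α.Rel x d := hx
    have hy' : α.Rel y d := hy
    have e := α.rel_equiv
    have := h a b x y (e.trans ha' (e.symm hb')) (e.trans hx' (e.symm hy')) h1 h2 h3
    apply hne
    ext z
    have hcd : α.Rel c d := e.trans (e.symm ha') (e.trans this hx')
    exact ⟨fun hz => e.trans (show α.Rel z c from hz) hcd,
      fun hz => e.trans (show α.Rel z d from hz) (e.symm hcd)⟩

theorem isPartialBrauer_iff (α : DiagramPartition n) :
    α.IsPartialBrauer ↔ ∀ a b c, α.Rel a b → α.Rel a c → a = b ∨ a = c ∨ b = c := by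
  constructor
  · intro h a b c hab hac
    by_contra! hne
    have h2 := h {z | α.Rel z a} ⟨a, rfl⟩
    have h3 : ({a, b, c} : Set (Fin n ⊕ Fin n)) ⊆ {z | α.Rel z a} := by
      rintro z (rfl | rfl | rfl)
      exacts [α.rel_equiv.refl _, α.rel_equiv.symm hab, α.rel_equiv.symm hac]
    have h4 := Set.ncard_le_ncard h3 (Set.toFinite _)
    have h5 : ({a, b, c} : Set (Fin n ⊕ Fin n)).ncard = 3 :=
      Set.ncard_eq_three.2 ⟨a, b, c, hne.1, hne.2.1, hne.2.2, rfl⟩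
    omega
  · rintro h A ⟨c, rfl⟩
    by_contra! hA
    obtain ⟨x, y, z, hx, hy, hz, h1, h2, h3⟩ := (Set.two_lt_ncard_iff (Set.toFinite _)).1 hA
    have hx' : α.Rel x c := hx
    have hy' : α.Rel y c := hy
    have hz' : α.Rel z c := hz
    have e := α.rel_equiv
    rcases h x y z (e.trans hx' (e.symm hy')) (e.trans hx' (e.symm hz')) with h | h | h
    exacts [h1 h, h2 h, h3 h]

theorem position_injective : Function.Injective (position (n := n)) := by
  rintro (a | a) (b | b) h <;> simp only [position, Sum.elim_inl, Sum.elim_inr] at h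
  · exact congrArg Sum.inl (Fin.ext (by omega))
  · omega
  · omega
  · exact congrArg Sum.inr (Fin.ext (by omega))

/-- Indicator, modulo 2, of `z` preceding `u` in the canonical order. -/
def precedes (z u : Fin n ⊕ Fin n) : ZMod 2 := if position z < position u then 1 else 0

theorem IsPlanar.precedes_add {α : DiagramPartition n} (h : α.IsPlanar) {a b c d}
    (hab : α.Rel a b) (hcd : α.Rel c d) (hac : ¬ α.Rel a c) :
    precedes c a + precedes c b = precedes d a + precedes d b := by
  rw [isPlanar_iff] at h
  have e := α.rel_equiv
  have nac := hac
  have nad : ¬ α.Rel a d := fun k => hac (e.trans k (e.symm hcd))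
  have nbc : ¬ α.Rel b c := fun k => hac (e.trans hab k)
  have nbd : ¬ α.Rel b d := fun k => nad (e.trans hab k)
  have ne : ∀ {x y}, ¬ α.Rel x y → position x ≠ position y := fun {x y} k he =>
    k (position_injective he ▸ e.refl x)
  have h1 : ¬ (position a < position c ∧ position c < position b ∧ position b < position d) :=
    fun ⟨p, q, r⟩ => nac (h a b c d hab hcd p q r)
  have h2 : ¬ (position a < position d ∧ position d < position b ∧ position b < position c) :=
    fun ⟨p, q, r⟩ => nad (h a b d c hab (e.symm hcd) p q r)
  have h3 : ¬ (position b < position c ∧ position c < position a ∧ position a < position d) :=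
    fun ⟨p, q, r⟩ => nbc (h b a c d (e.symm hab) hcd p q r)
  have h4 : ¬ (position b < position d ∧ position d < position a ∧ position a < position c) :=
    fun ⟨p, q, r⟩ => nbd (h b a d c (e.symm hab) (e.symm hcd) p q r)
  have h5 : ¬ (position c < position a ∧ position a < position d ∧ position d < position b) :=
    fun ⟨p, q, r⟩ => nac (e.symm (h c d a b hcd hab p q r))
  have h6 : ¬ (position d < position a ∧ position a < position c ∧ position c < position b) :=
    fun ⟨p, q, r⟩ => nad (e.symm (h d c a b (e.symm hcd) hab p q r))
  have h7 : ¬ (position c < position b ∧ position b < position d ∧ position d < position a) :=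
    fun ⟨p, q, r⟩ => nbc (e.symm (h c d b a hcd (e.symm hab) p q r))
  have h8 : ¬ (position d < position b ∧ position b < position c ∧ position c < position a) :=
    fun ⟨p, q, r⟩ => nbd (e.symm (h d c b a (e.symm hcd) (e.symm hab) p q r))
  have m1 := ne nac
  have m2 := ne nad
  have m3 := ne nbc
  have m4 := ne nbd
  unfold precedes
  split_ifs <;> first | rfl | decide | (exfalso; omega)

/-- A version of `precedes` on three rows, used only to show that products of planar
partitions are planar. -/
def precedes3 : ThreeRows n → ThreeRows n → ZMod 2
  | Sum.inl k, Sum.inl i => if k < i then 1 else 0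
  | Sum.inl _, Sum.inr _ => 0
  | Sum.inr (Sum.inl k), Sum.inr (Sum.inl i) => if i < k then 1 else 0
  | Sum.inr (Sum.inl _), Sum.inl _ => 1
  | Sum.inr (Sum.inl _), Sum.inr (Sum.inr _) => 1
  | Sum.inr (Sum.inr k), Sum.inr (Sum.inr i) => if i < k then 1 else 0
  | Sum.inr (Sum.inr _), Sum.inl _ => 1
  | Sum.inr (Sum.inr _), Sum.inr (Sum.inl _) => 1

theorem position_inl (i : Fin n) : position (Sum.inl i) = (i : ℤ) + 1 := rfl

theorem position_inr (i : Fin n) : position (Sum.inr i) = -((i : ℤ) + 1) := rfl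

theorem precedes_inl_inl (z u : Fin n) :
    precedes (Sum.inl z) (Sum.inl u) = if z < u then 1 else 0 :=
  if_congr (by rw [position_inl, position_inl, Fin.lt_def]; omega) rfl rfl

theorem precedes_inl_inr (z u : Fin n) : precedes (Sum.inl z) (Sum.inr u) = 0 :=
  if_neg (by rw [position_inl, position_inr]; omega)

theorem precedes_inr_inl (z u : Fin n) : precedes (Sum.inr z) (Sum.inl u) = 1 :=
  if_pos (by rw [position_inl, position_inr]; omega)

theorem precedes_inr_inr (z u : Fin n) :
    precedes (Sum.inr z) (Sum.inr u) = if u < z then 1 else 0 :=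
  if_congr (by rw [position_inr, position_inr, Fin.lt_def]; omega) rfl rfl

theorem precedes3_upper (z u : Fin n ⊕ Fin n) :
    precedes3 (upperRows z) (upperRows u) = precedes z u := by
  rcases z with z | z <;> rcases u with u | u
  exacts [(precedes_inl_inl z u).symm, (precedes_inl_inr z u).symm,
    (precedes_inr_inl z u).symm, (precedes_inr_inr z u).symm]

theorem precedes3_outer (z u : Fin n ⊕ Fin n) :
    precedes3 (outerRows z) (outerRows u) = precedes z u := by
  rcases z with z | z <;> rcases u with u | u
  exacts [(precedes_inl_inl z u).symm, (precedes_inl_inr z u).symm,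
    (precedes_inr_inl z u).symm, (precedes_inr_inr z u).symm]

theorem precedes3_lower_inr (z : Fin n) (u : Fin n ⊕ Fin n) :
    precedes3 (lowerRows (Sum.inr z)) (lowerRows u) = precedes (Sum.inr z) u := by
  rcases u with u | u
  exacts [(precedes_inr_inl z u).symm, (precedes_inr_inr z u).symm]

theorem precedes3_lower_inl (z : Fin n) (u : Fin n ⊕ Fin n) (hz : Sum.inl z ≠ u) :
    precedes3 (lowerRows (Sum.inl z)) (lowerRows u) = 1 + precedes (Sum.inl z) u := by
  rcases u with u | u
  · have hne : z ≠ u := fun h => hz (congrArg Sum.inl h)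
    rw [precedes_inl_inl]
    change (if u < z then (1 : ZMod 2) else 0) = _
    rcases lt_or_gt_of_ne hne with h | h
    · rw [if_pos h, if_neg h.not_gt]
      decide
    · rw [if_pos h, if_neg h.not_gt]
      decide
  · rw [precedes_inl_inr]
    exact (add_zero _).symm

/-- Products of planar partitions are planar. -/
theorem IsPlanar.mul {α β : DiagramPartition n} (hα : α.IsPlanar) (hβ : β.IsPlanar) :
    (α * β).IsPlanar := by
  rw [isPlanar_iff]
  intro a b x y hab hxy h1 h2 h3
  by_contra hax
  rw [mul_rel] at hab hxy hax
  have eG : Equivalence (Relation.EqvGen (glueRel α β)) := Relation.EqvGen.is_equivalence _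
  let C : ThreeRows n → Prop := fun z => Relation.EqvGen (glueRel α β) (outerRows a) z
  have key : ∀ u v, Relation.EqvGen (glueRel α β) u v → C u →
      ∃ f g : ThreeRows n → ZMod 2,
        (∀ c d, α.Rel c d → ¬ C (upperRows c) → f (upperRows c) = f (upperRows d)) ∧
        (∀ c d, β.Rel c d → ¬ C (lowerRows c) → g (lowerRows c) = g (lowerRows d)) ∧
        (∀ k, ¬ C (Sum.inl k) →
          f (Sum.inl k) = precedes3 (Sum.inl k) u + precedes3 (Sum.inl k) v) ∧
        (∀ k, ¬ C (Sum.inr (Sum.inl k)) →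
          f (Sum.inr (Sum.inl k)) + g (Sum.inr (Sum.inl k)) =
            precedes3 (Sum.inr (Sum.inl k)) u + precedes3 (Sum.inr (Sum.inl k)) v) ∧
        (∀ k, ¬ C (Sum.inr (Sum.inr k)) →
          g (Sum.inr (Sum.inr k)) =
            precedes3 (Sum.inr (Sum.inr k)) u + precedes3 (Sum.inr (Sum.inr k)) v) := by
    intro u v huv
    induction huv with
    | rel u v h =>
      intro hu
      rcases h with ⟨p, q, h, rfl, rfl⟩ | ⟨p, q, h, rfl, rfl⟩
      · refine ⟨fun z => precedes3 z (upperRows p) + precedes3 z (upperRows q), fun _ => 0,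
          ?_, ?_, ?_, ?_, ?_⟩
        · intro c d hcd hc
          simp only [precedes3_upper]
          refine hα.precedes_add h hcd fun hpc => hc ?_
          exact eG.trans hu (Relation.EqvGen.rel _ _ (Or.inl ⟨_, _, hpc, rfl, rfl⟩))
        · intros; rfl
        · intros; rfl
        · intros; exact add_zero _
        · intro k _
          rcases p with p | p <;> rcases q with q | q <;> rfl
      · have hne : ∀ (r : Fin n ⊕ Fin n), C (lowerRows r) → ∀ k,
            ¬ C (Sum.inr (Sum.inl k)) → Sum.inl k ≠ r := by
          rintro r hr k hk rfl
          exact hk hr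
        have hv : C (lowerRows q) :=
          eG.trans hu (Relation.EqvGen.rel _ _ (Or.inr ⟨_, _, h, rfl, rfl⟩))
        have hlow : ∀ c, ¬ C (lowerRows c) →
            precedes3 (lowerRows c) (lowerRows p) + precedes3 (lowerRows c) (lowerRows q) =
              precedes c p + precedes c q := by
          rintro (c | c) hc
          · rw [precedes3_lower_inl _ _ (hne p hu c hc), precedes3_lower_inl _ _ (hne q hv c hc)]
            generalize precedes (Sum.inl c) p = s
            generalize precedes (Sum.inl c) q = t
            revert s t
            decide
          · rw [precedes3_lower_inr, precedes3_lower_inr]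
        refine ⟨fun _ => 0, fun z => precedes3 z (lowerRows p) + precedes3 z (lowerRows q),
          ?_, ?_, ?_, ?_, ?_⟩
        · intros; rfl
        · intro c d hcd hc
          have hd : ¬ C (lowerRows d) := fun hd => hc (eG.trans hd (eG.symm
            (Relation.EqvGen.rel _ _ (Or.inr ⟨_, _, hcd, rfl, rfl⟩))))
          simp only [hlow c hc, hlow d hd]
          refine hβ.precedes_add h hcd fun hpc => hc ?_
          exact eG.trans hu (Relation.EqvGen.rel _ _ (Or.inr ⟨_, _, hpc, rfl, rfl⟩))
        · intro k _
          rcases p with p | p <;> rcases q with q | q <;> rfl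
        · intros; exact zero_add _
        · intros; rfl
    | refl u =>
      intro _
      refine ⟨fun _ => 0, fun _ => 0, fun _ _ _ _ => rfl, fun _ _ _ _ => rfl, ?_, ?_, ?_⟩ <;>
        · intro k _
          simp [CharTwo.add_self_eq_zero]
    | symm u v huv ih =>
      intro hv
      obtain ⟨f, g, hf, hg, i1, i2, i3⟩ := ih (eG.trans hv (eG.symm huv))
      exact ⟨f, g, hf, hg, fun k hk => (i1 k hk).trans (add_comm _ _),
        fun k hk => (i2 k hk).trans (add_comm _ _), fun k hk => (i3 k hk).trans (add_comm _ _)⟩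
    | trans u v w huv _ ih1 ih2 =>
      intro hu
      obtain ⟨f, g, hf, hg, i1, i2, i3⟩ := ih1 hu
      obtain ⟨f', g', hf', hg', j1, j2, j3⟩ := ih2 (eG.trans hu huv)
      have z2 : ∀ s t r : ZMod 2, (s + t) + (t + r) = s + r := by decide
      refine ⟨f + f', g + g', ?_, ?_, ?_, ?_, ?_⟩
      · intro c d h hc
        simp only [Pi.add_apply, hf c d h hc, hf' c d h hc]
      · intro c d h hc
        simp only [Pi.add_apply, hg c d h hc, hg' c d h hc]
      · intro k hk
        rw [Pi.add_apply, i1 k hk, j1 k hk, z2]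
      · intro k hk
        rw [Pi.add_apply, Pi.add_apply, add_add_add_comm, i2 k hk, j2 k hk, z2]
      · intro k hk
        rw [Pi.add_apply, i3 k hk, j3 k hk, z2]
  obtain ⟨f, g, hf, hg, i1, i2, i3⟩ := key _ _ hab (eG.refl _)
  have hmid : ∀ k, ¬ C (Sum.inr (Sum.inl k)) →
      f (Sum.inr (Sum.inl k)) = g (Sum.inr (Sum.inl k)) := by
    intro k hk
    have z2 : ∀ s t : ZMod 2, s + t = 0 → s = t := by decide
    apply z2
    rw [i2 k hk]
    rcases a with a | a <;> rcases b with b | b <;> rfl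
  let F : ThreeRows n → ZMod 2 := Sum.elim (fun k => f (Sum.inl k)) (fun z => g (Sum.inr z))
  have hFu : ∀ c, ¬ C (upperRows c) → F (upperRows c) = f (upperRows c) := by
    rintro (c | c) hc
    · rfl
    · exact (hmid c hc).symm
  have hF : ∀ u v, Relation.EqvGen (glueRel α β) u v → ¬ C u → F u = F v := by
    intro u v huv
    induction huv with
    | rel u v h =>
      intro hu
      have hv : ¬ C v := fun hv => hu (eG.trans hv (eG.symm (Relation.EqvGen.rel _ _ h)))
      rcases h with ⟨p, q, h, rfl, rfl⟩ | ⟨p, q, h, rfl, rfl⟩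
      · rw [hFu _ hu, hFu _ hv, hf _ _ h hu]
      · exact hg _ _ h hu
    | refl u => exact fun _ => rfl
    | symm u v huv ih => exact fun hv => (ih fun hu => hv (eG.trans hu huv)).symm
    | trans u v w huv _ ih1 ih2 =>
      exact fun hu => (ih1 hu).trans (ih2 fun hv => hu (eG.trans hv (eG.symm huv)))
  have hFo : ∀ z, ¬ C (outerRows z) → F (outerRows z) = precedes z a + precedes z b := by
    rintro (z | z) hz
    · rw [← precedes3_outer, ← precedes3_outer]
      exact i1 z hz
    · rw [← precedes3_outer, ← precedes3_outer]
      exact i3 z hz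
  have hay : ¬ C (outerRows y) := fun hy => hax (eG.trans hy (eG.symm hxy))
  have hfin := hF _ _ hxy hax
  rw [hFo x hax, hFo y hay] at hfin
  unfold precedes at hfin
  rw [if_neg (by omega), if_pos h2, if_neg (by omega), if_neg (by omega)] at hfin
  exact absurd hfin (by decide)

theorem isPlanar_one : (1 : DiagramPartition n).IsPlanar := by
  rw [isPlanar_iff]
  intro a b x y hab hxy h1 h2 h3
  exfalso
  rw [one_rel] at hab hxy
  rcases a with a | a <;> rcases b with b | b <;> rcases x with x | x <;> rcases y with y | y <;>
    simp only [Sum.elim_inl, Sum.elim_inr, id] at hab hxy <;> subst hab <;> subst hxy <;>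
    simp only [position, Sum.elim_inl, Sum.elim_inr] at h1 h2 h3 <;> omega

open Classical in
/-- Products of partitions with blocks of size at most 2 have blocks of size at most 2. -/
theorem IsPartialBrauer.mul {α β : DiagramPartition n} (hα : α.IsPartialBrauer)
    (hβ : β.IsPartialBrauer) : (α * β).IsPartialBrauer := by
  rw [isPartialBrauer_iff] at *
  intro x y z hxy hxz
  by_contra! hne
  rw [mul_rel] at hxy hxz
  have ho : Function.Injective (outerRows (n := n)) :=
    Function.injective_id.sumMap Sum.inr_injective
  have hup : Function.Injective (upperRows (n := n)) :=
    Function.injective_id.sumMap Sum.inl_injective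
  have hlo : Function.Injective (lowerRows (n := n)) := Sum.inr_injective
  let G : SimpleGraph (ThreeRows n) := SimpleGraph.fromRel (glueRel α β)
  have hadj : ∀ u v, G.Adj u v → u ≠ v ∧ glueRel α β u v := by
    rintro u v ⟨hne, h | h⟩
    · exact ⟨hne, h⟩
    · refine ⟨hne, ?_⟩
      rcases h with ⟨a, b, h, h1, h2⟩ | ⟨a, b, h, h1, h2⟩
      · exact Or.inl ⟨b, a, α.rel_equiv.symm h, h2, h1⟩
      · exact Or.inr ⟨b, a, β.rel_equiv.symm h, h2, h1⟩
  have hreach : ∀ u v, Relation.EqvGen (glueRel α β) u v → G.Reachable u v := by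
    intro u v h
    induction h with
    | rel u v h =>
      by_cases huv : u = v
      · rw [huv]
      · exact SimpleGraph.Adj.reachable ⟨huv, Or.inl h⟩
    | refl u => exact SimpleGraph.Reachable.refl _
    | symm u v _ ih => exact ih.symm
    | trans u v w _ _ ih1 ih2 => exact ih1.trans ih2
  -- at most one neighbour through each of the two partitions
  let wU : ThreeRows n → ℕ := fun v => if v ∈ Set.range (upperRows (n := n)) then 1 else 0
  let wL : ThreeRows n → ℕ := fun v => if v ∈ Set.range (lowerRows (n := n)) then 1 else 0
  have hdeg : ∀ v, G.degree v ≤ wU v + wL v := by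
    intro v
    let NU : Finset (ThreeRows n) := Finset.univ.filter fun u => v ≠ u ∧
      ∃ a b, α.Rel a b ∧ upperRows a = v ∧ upperRows b = u
    let NL : Finset (ThreeRows n) := Finset.univ.filter fun u => v ≠ u ∧
      ∃ a b, β.Rel a b ∧ lowerRows a = v ∧ lowerRows b = u
    have hsub : G.neighborFinset v ⊆ NU ∪ NL := by
      intro u hu
      rw [SimpleGraph.mem_neighborFinset] at hu
      obtain ⟨h1, h2 | h2⟩ := hadj _ _ hu
      · exact Finset.mem_union_left _ (Finset.mem_filter.2 ⟨Finset.mem_univ _, h1, h2⟩)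
      · exact Finset.mem_union_right _ (Finset.mem_filter.2 ⟨Finset.mem_univ _, h1, h2⟩)
    have hU : NU.card ≤ wU v := by
      by_cases hv : v ∈ Set.range (upperRows (n := n))
      · simp only [wU, if_pos hv]
        rw [Finset.card_le_one]
        intro p hp q hq
        obtain ⟨-, h1, a, b, hab, rfl, rfl⟩ := Finset.mem_filter.1 hp
        obtain ⟨-, h2, c, d, hcd, h3, rfl⟩ := Finset.mem_filter.1 hq
        obtain rfl := hup h3
        rcases hα _ _ _ hab hcd with h | h | h
        · exact absurd (congrArg _ h) h1
        · exact absurd (congrArg _ h) h2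
        · exact congrArg _ h
      · simp only [wU, if_neg hv, Nat.le_zero, Finset.card_eq_zero]
        refine Finset.filter_eq_empty_iff.2 ?_
        rintro u - ⟨-, a, b, -, h, -⟩
        exact hv ⟨a, h⟩
    have hL : NL.card ≤ wL v := by
      by_cases hv : v ∈ Set.range (lowerRows (n := n))
      · simp only [wL, if_pos hv]
        rw [Finset.card_le_one]
        intro p hp q hq
        obtain ⟨-, h1, a, b, hab, rfl, rfl⟩ := Finset.mem_filter.1 hp
        obtain ⟨-, h2, c, d, hcd, h3, rfl⟩ := Finset.mem_filter.1 hq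
        obtain rfl := hlo h3
        rcases hβ _ _ _ hab hcd with h | h | h
        · exact absurd (congrArg _ h) h1
        · exact absurd (congrArg _ h) h2
        · exact congrArg _ h
      · simp only [wL, if_neg hv, Nat.le_zero, Finset.card_eq_zero]
        refine Finset.filter_eq_empty_iff.2 ?_
        rintro u - ⟨-, a, b, -, h, -⟩
        exact hv ⟨a, h⟩
    calc G.degree v = (G.neighborFinset v).card := rfl
      _ ≤ (NU ∪ NL).card := Finset.card_le_card hsub
      _ ≤ NU.card + NL.card := Finset.card_union_le _ _
      _ ≤ _ := add_le_add hU hL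
  let wO : ThreeRows n → ℕ := fun v => if v ∈ Set.range (outerRows (n := n)) then 1 else 0
  have hw : ∀ v, wU v + wL v + wO v = 2 := by
    rintro (v | v | v) <;> simp [wU, wL, wO, upperRows, lowerRows, outerRows]
  let C := G.connectedComponentMk (outerRows x)
  let H := C.toSimpleGraph
  have hconn : H.Connected := C.connected_toSimpleGraph
  have hE := hconn.card_vert_le_card_edgeSet_add_one
  have hsum := H.sum_degrees_eq_twice_card_edges
  have hHdeg : ∀ v, H.degree v ≤ G.degree v.1 := by
    intro v
    rw [← SimpleGraph.card_neighborFinset_eq_degree, ← SimpleGraph.card_neighborFinset_eq_degree]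
    refine Finset.card_le_card_of_injOn Subtype.val ?_ (Subtype.val_injective.injOn)
    intro u hu
    rw [Finset.mem_coe, SimpleGraph.mem_neighborFinset] at hu ⊢
    exact hu
  have hO : 3 ≤ ∑ v : C, wO v.1 := by
    have mem : ∀ t, Relation.EqvGen (glueRel α β) (outerRows x) (outerRows t) →
        outerRows t ∈ C.supp := fun t ht =>
      (SimpleGraph.ConnectedComponent.eq.2 (hreach _ _ ht)).symm
    let px : C := ⟨outerRows x, mem x (Relation.EqvGen.refl _)⟩
    let py : C := ⟨outerRows y, mem y hxy⟩
    let pz : C := ⟨outerRows z, mem z hxz⟩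
    have n1 : px ≠ py := fun h => hne.1 (ho (congrArg Subtype.val h))
    have n2 : px ≠ pz := fun h => hne.2.1 (ho (congrArg Subtype.val h))
    have n3 : py ≠ pz := fun h => hne.2.2 (ho (congrArg Subtype.val h))
    calc 3 = ∑ v ∈ ({px, py, pz} : Finset C), wO v.1 := by
          rw [Finset.sum_insert (by simp [n1, n2]), Finset.sum_insert (by simp [n3]),
            Finset.sum_singleton]
          have hp : ∀ t, wO (outerRows t) = 1 := fun t => if_pos ⟨t, rfl⟩
          simp only [px, py, pz, hp]
          norm_num
      _ ≤ ∑ v : C, wO v.1 := Finset.sum_le_sum_of_subset (Finset.subset_univ _)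
  have htot : ∑ v : C, (H.degree v + wO v.1) ≤ ∑ _v : C, 2 := by
    refine Finset.sum_le_sum fun v _ => ?_
    have := hHdeg v
    have := hdeg v.1
    have := hw v.1
    omega
  rw [Finset.sum_add_distrib, Finset.sum_const, Finset.card_univ, smul_eq_mul] at htot
  rw [Nat.card_eq_fintype_card, Nat.card_eq_fintype_card, ← SimpleGraph.edgeFinset_card] at hE
  omega

theorem isPartialBrauer_one : (1 : DiagramPartition n).IsPartialBrauer := by
  rw [isPartialBrauer_iff]
  intro a b c hab hac
  rw [one_rel] at hab hac
  rcases a with a | a <;> rcases b with b | b <;> rcases c with c | c <;>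
    simp only [Sum.elim_inl, Sum.elim_inr, id] at hab hac <;> subst hab <;> subst hac <;> simp

end DiagramPartition

/-- The Motzkin monoid of degree `n`: planar partitions with blocks of size at most 2. -/
def motzkinMonoid (n : ℕ) : Submonoid (DiagramPartition n) where
  carrier := {α | α.IsPartialBrauer ∧ α.IsPlanar}
  mul_mem' h₁ h₂ := ⟨h₁.1.mul h₂.1, h₁.2.mul h₂.2⟩
  one_mem' := ⟨DiagramPartition.isPartialBrauer_one, DiagramPartition.isPlanar_one⟩

namespace Motzkin

variable (n : ℕ)

/-- The elements of rank `k` of the Motzkin monoid. -/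
def rankSet (k : ℕ) : Set (motzkinMonoid n) := {α | α.1.rank = k}

variable {n}

/-- The elements of which `B` is a block. -/
def withBlock (B : Set (Fin n ⊕ Fin n)) : Set (motzkinMonoid n) := {α | B ∈ α.1.blocks}

/-- All elements of rank other than `n - 1`, together with the elements of rank `n - 1` with
a block `{i}`, `i ∈ A`, or a block `{i'}`, `i ∉ A`. -/
def rectangle (A : Set (Fin n)) : Set (motzkinMonoid n) :=
  (rankSet n (n - 1))ᶜ ∪
    ((⋃ i ∈ A, rankSet n (n - 1) ∩ withBlock {Sum.inl i}) ∪
      ⋃ i ∈ Aᶜ, rankSet n (n - 1) ∩ withBlock {Sum.inr i})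

/-- All elements except those of rank `n - 2` with block `{i, j}`. -/
def removeUpper (i j : Fin n) : Set (motzkinMonoid n) :=
  (rankSet n (n - 2) ∩ withBlock {Sum.inl i, Sum.inl j})ᶜ

/-- All elements except those of rank `n - 2` with block `{i', j'}`. -/
def removeLower (i j : Fin n) : Set (motzkinMonoid n) :=
  (rankSet n (n - 2) ∩ withBlock {Sum.inr i, Sum.inr j})ᶜ

end Motzkin

/-! ### Products of partitions -/

namespace DiagramPartition

variable {n : ℕ} {α β : DiagramPartition n}

/-! Rank cannot increase under multiplication, so what matters is how the elements of rank `n`, `n -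
1` and `n - 2` arise as products. Only the identity has rank `n`. Since strands do not cross, an
element of rank `n - 1` is determined by its upper singleton `i` and lower singleton `j`
(`Missing`); write it e_ij. Then e_ij e_jk = e_ik (`Missing.mul`), while e_ij e_kl has smaller rank
for `j ≠ k`. In rank `n - 2`, a hook is a block joining two points of the same row.

The identity, the e_ij, and the diagrams `hook` and `star hook` with one adjacent hook generate the
monoid (`mem_of_generators`). The proof is an induction on total horizontal length. A slanting
strand, or a hook with a gap, can be shortened by splitting off some e_ij with `|i - j| = 1`
(`exists_shift_mul`), and an adjacent hook splits off as a factor (`eq_hook_mul`).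

Let `U` be a subsemigroup contained in no listed set (`eq_top_of_not_subset`). It contains the
identity. The set `rectangle A` omits exactly the e_ij with `i ∉ A` and `j ∈ A`, so `U` meets every
such rectangle; read as a digraph with an edge from `i` to `j` for each e_ij in `U`, this is strong
connectedness, and transitivity puts all e_ij in `U`. Finally `U` contains an element `α` of rank `n
- 2` with block `{i, i+1}`. Multiplying `α` by the reversal of its strands, a hook-free element and
hence already in `U`, gives the adjacent hook (`hook_eq`). So `U` is everything, and every proper
subsemigroup lies in a listed set.

Conversely, the listed sets are proper, closed under products (`rectangle_mul_mem`,
`removeUpper_mul_mem`) and pairwise incomparable (`IsListed.eq_of_subset`), so they are precisely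
the maximal subsemigroups. Exchanging the rows, `star`, reduces most statements about lower points
to upper ones. The types follow because right multiplication preserves upper singletons and upper
hooks, and left multiplication the lower ones. -/

theorem rel_refl (α : DiagramPartition n) (u) : α.Rel u u := α.rel_equiv.refl u

theorem Rel.symm {u v} (h : α.Rel u v) : α.Rel v u := α.rel_equiv.symm h

theorem Rel.trans {u v w} (h : α.Rel u v) (h' : α.Rel v w) : α.Rel u w := α.rel_equiv.trans h h'

theorem rel_comm {u v} : α.Rel u v ↔ α.Rel v u := ⟨Rel.symm, Rel.symm⟩

/-- The partition obtained by exchanging the two rows. -/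
def star (α : DiagramPartition n) : DiagramPartition n := Setoid.comap Sum.swap α

theorem star_rel {u v} : α.star.Rel u v ↔ α.Rel u.swap v.swap := Iff.rfl

theorem star_star (α : DiagramPartition n) : α.star.star = α :=
  rel_ext fun x y => by rw [star_rel, star_rel, Sum.swap_swap, Sum.swap_swap]

/-- A product only relates points that are not separated by a set closed under both factors. -/
theorem mem_of_mul_rel (S : ThreeRows n → Prop)
    (hα : ∀ a b, α.Rel a b → S (upperRows a) → S (upperRows b))
    (hβ : ∀ a b, β.Rel a b → S (lowerRows a) → S (lowerRows b)) {u v}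
    (h : (α * β).Rel u v) (hu : S (outerRows u)) : S (outerRows v) := by
  rw [mul_rel] at h
  have key : ∀ x y, Relation.EqvGen (glueRel α β) x y → (S x ↔ S y) := by
    intro x y hxy
    induction hxy with
    | rel x y h =>
      rcases h with ⟨a, b, h, rfl, rfl⟩ | ⟨a, b, h, rfl, rfl⟩
      · exact ⟨hα _ _ h, hα _ _ h.symm⟩
      · exact ⟨hβ _ _ h, hβ _ _ h.symm⟩
    | refl => exact Iff.rfl
    | symm _ _ _ ih => exact ih.symm
    | trans _ _ _ _ _ ih1 ih2 => exact ih1.trans ih2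
  exact (key _ _ h).1 hu

theorem glue_upper {a b} (h : α.Rel a b) :
    Relation.EqvGen (glueRel α β) (upperRows a) (upperRows b) :=
  Relation.EqvGen.rel _ _ (Or.inl ⟨a, b, h, rfl, rfl⟩)

theorem glue_lower {a b} (h : β.Rel a b) :
    Relation.EqvGen (glueRel α β) (lowerRows a) (lowerRows b) :=
  Relation.EqvGen.rel _ _ (Or.inr ⟨a, b, h, rfl, rfl⟩)

theorem rel_mul_upper {x y : Fin n} (h : α.Rel (Sum.inl x) (Sum.inl y)) :
    (α * β).Rel (Sum.inl x) (Sum.inl y) := glue_upper h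

theorem rel_mul_lower {x y : Fin n} (h : β.Rel (Sum.inr x) (Sum.inr y)) :
    (α * β).Rel (Sum.inr x) (Sum.inr y) := glue_lower h

theorem rel_mul_through {x m y : Fin n} (h : α.Rel (Sum.inl x) (Sum.inr m))
    (h' : β.Rel (Sum.inl m) (Sum.inr y)) : (α * β).Rel (Sum.inl x) (Sum.inr y) :=
  (glue_upper h).trans _ _ _ (glue_lower h')

/-- Turning the three-row picture upside down exchanges the two gluing relations. One inclusion
suffices, because `star` is an involution. -/
theorem star_mul (α β : DiagramPartition n) : (α * β).star = β.star * α.star := by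
  have key : ∀ (α β : DiagramPartition n) (x y), (β.star * α.star).Rel x y →
      (α * β).star.Rel x y := by
    intro α β x y h
    -- The reversal of the three rows, fixing the middle one.
    let ρ : ThreeRows n → ThreeRows n :=
      Sum.elim (fun i => Sum.inr (Sum.inr i)) (Sum.elim (fun i => Sum.inr (Sum.inl i)) Sum.inl)
    have hρ : ∀ z : Fin n ⊕ Fin n, outerRows z.swap = ρ (outerRows z) := by rintro (z | z) <;> rfl
    have hu : ∀ z : Fin n ⊕ Fin n, ρ (upperRows z) = lowerRows z.swap := by rintro (z | z) <;> rfl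
    have hl : ∀ z : Fin n ⊕ Fin n, ρ (lowerRows z) = upperRows z.swap := by rintro (z | z) <;> rfl
    rw [star_rel, mul_rel, hρ, hρ]
    refine mem_of_mul_rel (fun w => Relation.EqvGen (glueRel α β) (ρ (outerRows x)) (ρ w))
      ?_ ?_ h (Relation.EqvGen.refl _)
    · intro a b hab ha
      refine ha.trans _ _ _ ?_
      rw [hu, hu]
      exact glue_lower hab
    · intro a b hab ha
      refine ha.trans _ _ _ ?_
      rw [hl, hl]
      exact glue_upper hab
  refine rel_ext fun x y => ⟨fun h => ?_, key α β x y⟩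
  have := key β.star α.star x.swap y.swap
  rw [star_star, star_star] at this
  have h2 := this h
  rwa [star_rel, Sum.swap_swap, Sum.swap_swap] at h2

/-- The block of `u` is `{u}`. -/
def Single (α : DiagramPartition n) (u : Fin n ⊕ Fin n) : Prop := ∀ v, α.Rel u v → v = u

theorem Single.mul_upper {x : Fin n} (h : α.Single (Sum.inl x)) :
    (α * β).Single (Sum.inl x) := by
  intro v hv
  have hS := mem_of_mul_rel (fun w => w = Sum.inl x) ?_ ?_ hv rfl
  · rcases v with v | v <;> simp_all [outerRows]
  · rintro (a | a) b hab ha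
    · obtain rfl : a = x := Sum.inl_injective ha
      rw [h b hab]
      rfl
    · cases ha
  · rintro a b - ha
    cases ha

theorem IsPartialBrauer.eq_of_rel (hα : α.IsPartialBrauer) {a b c} (hab : α.Rel a b)
    (hac : α.Rel a c) (h1 : b ≠ a) (h2 : c ≠ a) : b = c := by
  rcases (isPartialBrauer_iff α).1 hα a b c hab hac with h | h | h
  exacts [absurd h.symm h1, absurd h.symm h2, h]

/-- The strand from `x` stops at the middle point `k''`: the component of `x` in the glued diagram
is `{x, k''}`. -/
theorem single_mul_of_rel (hα : α.IsPartialBrauer) {x k : Fin n}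
    (h : α.Rel (Sum.inl x) (Sum.inr k)) (hk : β.Single (Sum.inl k)) :
    (α * β).Single (Sum.inl x) := by
  intro v hv
  have hS := mem_of_mul_rel (fun w => w = Sum.inl x ∨ w = Sum.inr (Sum.inl k)) ?_ ?_ hv (Or.inl rfl)
  · rcases v with v | v <;> simp_all [outerRows]
  · rintro a b hab ha
    have hxa : α.Rel (Sum.inl x) a ∧ (a = Sum.inl x ∨ a = Sum.inr k) := by
      rcases a with a | a <;> rcases ha with ha | ha <;> simp [upperRows] at ha <;> subst ha
      · exact ⟨α.rel_refl _, Or.inl rfl⟩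
      · exact ⟨h, Or.inr rfl⟩
    have hxb := hxa.1.trans hab
    by_cases hb : b = Sum.inl x
    · rw [hb]; exact Or.inl rfl
    · rw [hα.eq_of_rel hxb h hb (by simp)]
      exact Or.inr rfl
  · rintro a b hab ha
    have : a = Sum.inl k := by
      rcases ha with ha | ha
      · cases ha
      · exact Sum.inr_injective ha
    subst this
    rw [hk b hab]
    exact Or.inr rfl

/-- If the block of `x` in `α` has only upper points, it is already closed under gluing and cannot
reach the lower row. This is why rank does not increase. -/
theorem exists_rel_of_mul_rel {x y : Fin n} (h : (α * β).Rel (Sum.inl x) (Sum.inr y)) :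
    ∃ m, α.Rel (Sum.inl x) (Sum.inr m) := by
  by_contra! hm
  have hS := mem_of_mul_rel (fun w => ∃ x', w = Sum.inl x' ∧ α.Rel (Sum.inl x) (Sum.inl x')) ?_ ?_ h
    ⟨x, rfl, α.rel_refl _⟩
  · obtain ⟨x', h, -⟩ := hS
    cases h
  · rintro (a | a) b hab ⟨x', h1, h2⟩
    · obtain rfl : a = x' := Sum.inl_injective h1
      rcases b with b | b
      · exact ⟨b, rfl, h2.trans hab⟩
      · exact absurd (h2.trans hab) (hm b)
    · cases h1
  · rintro a b - ⟨x', h1, -⟩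
    cases h1

/-- Following an outer point of a product through its first factor `α` to a point of the second
factor: an upper point goes along its through-strand, a lower point stays where it is. -/
def Thru (α : DiagramPartition n) : Fin n ⊕ Fin n → Fin n ⊕ Fin n → Prop
  | Sum.inl x, Sum.inl m => α.Rel (Sum.inl x) (Sum.inr m)
  | Sum.inr y, Sum.inr z => y = z
  | _, _ => False

/-- The product when no two lower points of the first factor are related. -/
theorem mul_rel_of_lower_single (hα : ∀ i j, α.Rel (Sum.inr i) (Sum.inr j) → i = j) (u v) :
    (α * β).Rel u v ↔ (∃ x y, u = Sum.inl x ∧ v = Sum.inl y ∧ α.Rel u v) ∨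
      ∃ u' v', α.Thru u u' ∧ α.Thru v v' ∧ β.Rel u' v' := by
  constructor
  · intro h
    -- `T w z` attaches `w` to a point `z` of the second factor, along a strand of `α` or because
    -- `w` is `z` itself. As lower points of `α` are unrelated, `w` determines `z`.
    let T : ThreeRows n → Fin n ⊕ Fin n → Prop := fun w z =>
      (∃ x m, w = Sum.inl x ∧ z = Sum.inl m ∧ α.Rel (Sum.inl x) (Sum.inr m)) ∨ w = lowerRows z
    have hT : ∀ w z z', T w z → T w z' → z = z' := by
      rintro w z z' (⟨x, m, rfl, rfl, h⟩ | rfl) (⟨x', m', h1, rfl, h'⟩ | h1)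
      · cases h1
        rw [hα _ _ (h.symm.trans h')]
      · cases h1
      · cases h1
      · exact Sum.inr_injective h1
    have hS := mem_of_mul_rel (fun w => (∃ x y, u = Sum.inl x ∧ w = Sum.inl y ∧
      α.Rel (Sum.inl x) (Sum.inl y)) ∨ ∃ u' w', α.Thru u u' ∧ T w w' ∧ β.Rel u' w') ?_ ?_ h ?_
    · rcases hS with ⟨x, y, rfl, h1, h2⟩ | ⟨u', w', h1, h2, h3⟩
      · rcases v with v | v
        · obtain rfl : v = y := Sum.inl_injective h1
          exact Or.inl ⟨x, v, rfl, rfl, h2⟩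
        · cases h1
      · refine Or.inr ⟨u', w', h1, ?_, h3⟩
        rcases h2 with ⟨x, m, hx, rfl, h⟩ | hx
        · rcases v with v | v
          · obtain rfl : v = x := Sum.inl_injective hx
            exact h
          · cases hx
        · rcases v with v | v
          · cases hx
          · obtain rfl : Sum.inr v = w' := Sum.inr_injective hx
            rfl
    · rintro a b hab (⟨x, y, rfl, h1, h2⟩ | ⟨u', w', h1, h2, h3⟩)
      · rcases a with a | a
        · obtain rfl : a = y := Sum.inl_injective h1
          rcases b with b | b
          · exact Or.inl ⟨x, b, rfl, rfl, h2.trans hab⟩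
          · exact Or.inr ⟨Sum.inl b, Sum.inl b, h2.trans hab, Or.inr rfl, β.rel_refl _⟩
        · cases h1
      · rcases h2 with ⟨x, m, hx, rfl, h⟩ | hx
        · rcases a with a | a
          · obtain rfl : a = x := Sum.inl_injective hx
            refine Or.inr ⟨u', Sum.inl m, h1, ?_, h3⟩
            rcases b with b | b
            · exact Or.inl ⟨b, m, rfl, rfl, hab.symm.trans h⟩
            · rw [hα _ _ (h.symm.trans hab)]
              exact Or.inr rfl
          · cases hx
        · rcases a with a | a
          · cases hx
          · obtain rfl : Sum.inl a = w' := Sum.inr_injective hx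
            refine Or.inr ⟨u', Sum.inl a, h1, ?_, h3⟩
            rcases b with b | b
            · exact Or.inl ⟨b, a, rfl, rfl, hab.symm⟩
            · rw [hα _ _ hab]
              exact Or.inr rfl
    · rintro a b hab (⟨x, y, -, h1, -⟩ | ⟨u', w', h1, h2, h3⟩)
      · cases h1
      · refine Or.inr ⟨u', b, h1, Or.inr rfl, h3.trans ?_⟩
        rwa [hT _ _ _ h2 (Or.inr rfl)]
    · rcases u with x | y
      · exact Or.inl ⟨x, x, rfl, rfl, α.rel_refl _⟩
      · exact Or.inr ⟨Sum.inr y, Sum.inr y, rfl, Or.inr rfl, β.rel_refl _⟩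
  · have hthru : ∀ u u', α.Thru u u' →
        Relation.EqvGen (glueRel α β) (outerRows u) (lowerRows u') := by
      rintro (x | x) (m | m) h
      · exact glue_upper h
      · exact h.elim
      · exact h.elim
      · obtain rfl : x = m := h
        exact Relation.EqvGen.refl _
    rintro (⟨x, y, rfl, rfl, h⟩ | ⟨u', v', h1, h2, h3⟩)
    · exact rel_mul_upper h
    · exact (hthru _ _ h1).trans _ _ _ ((glue_lower h3).trans _ _ _ ((hthru _ _ h2).symm))

/-! ### The rank -/

/-- A transverse block of size at most two has exactly one upper point, so transverse blocks are
counted by their upper ends. -/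
theorem rank_eq_ncard (hα : α.IsPartialBrauer) :
    α.rank = {x : Fin n | ∃ y, α.Rel (Sum.inl x) (Sum.inr y)}.ncard := by
  symm
  refine Set.ncard_congr (fun x _ => {z | α.Rel z (Sum.inl x)}) ?_ ?_ ?_
  · rintro x ⟨y, h⟩
    exact ⟨⟨_, rfl⟩, ⟨x, α.rel_refl _⟩, ⟨y, h.symm⟩⟩
  · rintro x x' ⟨y, h⟩ - he
    have h1 : Sum.inl x ∈ {z | α.Rel z (Sum.inl x')} := he ▸ α.rel_refl _
    have h2 : α.Rel (Sum.inl x) (Sum.inl x') := h1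
    by_contra hne
    exact absurd (hα.eq_of_rel h h2 (by simp) (by simpa [eq_comm] using hne)) (by simp)
  · rintro B ⟨⟨z, rfl⟩, ⟨x, hx⟩, y, hy⟩
    have hx' : α.Rel (Sum.inl x) z := hx
    have hy' : α.Rel (Sum.inr y) z := hy
    refine ⟨x, ⟨y, hx'.trans hy'.symm⟩, ?_⟩
    ext w
    exact ⟨fun h => Rel.trans h hx', fun h => Rel.trans h hx'.symm⟩

theorem IsPartialBrauer.star (hα : α.IsPartialBrauer) : α.star.IsPartialBrauer := by
  rw [isPartialBrauer_iff] at *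
  intro a b c h1 h2
  rcases hα _ _ _ h1 h2 with h | h | h
  · exact Or.inl (Sum.swap_leftInverse.injective h)
  · exact Or.inr (Or.inl (Sum.swap_leftInverse.injective h))
  · exact Or.inr (Or.inr (Sum.swap_leftInverse.injective h))

theorem position_swap (u : Fin n ⊕ Fin n) : position u.swap = -position u := by
  rcases u with u | u <;> simp [position]

/-- Exchanging the rows negates positions, and a crossing read in the opposite order is again a
crossing. -/
theorem IsPlanar.star (hα : α.IsPlanar) : α.star.IsPlanar := by
  rw [isPlanar_iff] at *
  intro a b x y hab hxy h1 h2 h3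
  have := hα y.swap x.swap b.swap a.swap hxy.symm hab.symm
  simp only [position_swap] at this
  exact (hab.trans (Rel.symm (this (by omega) (by omega) (by omega)))).trans
    (Rel.symm hxy)

theorem rank_le_rank_star (hα : α.IsPartialBrauer) : α.rank ≤ α.star.rank := by
  rw [rank_eq_ncard hα, rank_eq_ncard hα.star]
  have h : ∀ x : Fin n, ∃ y : Fin n, (∃ y, α.Rel (Sum.inl x) (Sum.inr y)) →
      α.Rel (Sum.inl x) (Sum.inr y) := by
    intro x
    by_cases hx : ∃ y, α.Rel (Sum.inl x) (Sum.inr y)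
    · exact ⟨hx.choose, fun _ => hx.choose_spec⟩
    -- An arbitrary value: `f` is only used at upper ends of strands, which it sends to their lower
    -- ends.
    · exact ⟨x, fun h => absurd h hx⟩
  choose f hf using h
  refine Set.ncard_le_ncard_of_injOn f (fun x hx => ⟨x, (hf x hx).symm⟩) ?_ (Set.toFinite _)
  intro x hx x' hx' he
  have h1 := (hf x hx).symm
  have h2 := (hf x' hx').symm
  rw [← he] at h2
  exact Sum.inl_injective (hα.eq_of_rel h1 h2 (by simp) (by simp))

theorem rank_star (hα : α.IsPartialBrauer) : α.star.rank = α.rank := by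
  refine le_antisymm ?_ (rank_le_rank_star hα)
  have := rank_le_rank_star hα.star
  rwa [star_star] at this

theorem rank_mul_le_left (hα : α.IsPartialBrauer) (hβ : β.IsPartialBrauer) :
    (α * β).rank ≤ α.rank := by
  rw [rank_eq_ncard hα, rank_eq_ncard (hα.mul hβ)]
  exact Set.ncard_le_ncard (fun x ⟨y, h⟩ => exists_rel_of_mul_rel h) (Set.toFinite _)

theorem rank_mul_le_right (hα : α.IsPartialBrauer) (hβ : β.IsPartialBrauer) :
    (α * β).rank ≤ β.rank := by
  rw [← rank_star (hα.mul hβ), ← rank_star hβ, star_mul]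
  exact rank_mul_le_left hβ.star hα.star

theorem singleton_mem_blocks {u} : {u} ∈ α.blocks ↔ α.Single u := by
  constructor
  · rintro ⟨w, hw⟩ v hv
    have hu : α.Rel u w := show u ∈ {x | α.Rel x w} from hw ▸ rfl
    have : v ∈ ({u} : Set _) := by
      rw [hw]
      exact hv.symm.trans hu
    exact this
  · intro h
    refine ⟨u, ?_⟩
    ext v
    constructor
    · rintro rfl
      exact α.rel_refl _
    · exact fun hv => h v (Rel.symm hv)

theorem pair_mem_blocks (hα : α.IsPartialBrauer) {u v} (huv : u ≠ v) :
    {u, v} ∈ α.blocks ↔ α.Rel u v := by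
  constructor
  · rintro ⟨w, hw⟩
    have hu : α.Rel u w := show u ∈ {x | α.Rel x w} from hw ▸ Or.inl rfl
    have hv : α.Rel v w := show v ∈ {x | α.Rel x w} from hw ▸ Or.inr rfl
    exact hu.trans hv.symm
  · intro h
    refine ⟨u, ?_⟩
    ext z
    constructor
    · rintro (rfl | rfl)
      exacts [α.rel_refl _, h.symm]
    · intro hz
      by_cases hzu : z = u
      · exact Or.inl hzu
      · exact Or.inr (hα.eq_of_rel (Rel.symm hz) h hzu huv.symm)

end DiagramPartition

/-! ### The Motzkin monoid: involution, rank, partial order isomorphisms -/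

namespace Motzkin

open DiagramPartition

variable {n : ℕ} {α β : motzkinMonoid n}

theorem eq_of_rel {a b c} (hab : α.1.Rel a b) (hac : α.1.Rel a c) (h1 : b ≠ a) (h2 : c ≠ a) :
    b = c := α.2.1.eq_of_rel hab hac h1 h2

theorem ext_rel (h : ∀ u v, α.1.Rel u v ↔ β.1.Rel u v) : α = β := Subtype.ext (rel_ext h)

/-- The anti-automorphism exchanging the two rows. -/
def star (α : motzkinMonoid n) : motzkinMonoid n := ⟨α.1.star, α.2.1.star, α.2.2.star⟩

theorem star_star (α : motzkinMonoid n) : star (star α) = α := Subtype.ext α.1.star_star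

theorem star_mul (α β : motzkinMonoid n) : star (α * β) = star β * star α :=
  Subtype.ext (α.1.star_mul β.1)

theorem star_one : star (1 : motzkinMonoid n) = 1 := by
  rw [← mul_one (star 1), ← star_star (star 1 * 1), star_mul, star_star, mul_one, star_star]

theorem star_rel {u v} : (star α).1.Rel u v ↔ α.1.Rel u.swap v.swap := Iff.rfl

theorem rank_star (α : motzkinMonoid n) : (star α).1.rank = α.1.rank :=
  DiagramPartition.rank_star α.2.1

theorem rank_mul_le_left (α β : motzkinMonoid n) : (α * β).1.rank ≤ α.1.rank :=
  DiagramPartition.rank_mul_le_left α.2.1 β.2.1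

theorem rank_mul_le_right (α β : motzkinMonoid n) : (α * β).1.rank ≤ β.1.rank :=
  DiagramPartition.rank_mul_le_right α.2.1 β.2.1

theorem rank_eq (α : motzkinMonoid n) :
    α.1.rank = {x : Fin n | ∃ y, α.1.Rel (Sum.inl x) (Sum.inr y)}.ncard :=
  rank_eq_ncard α.2.1

theorem rank_add_ncard (α : motzkinMonoid n) :
    α.1.rank + {x : Fin n | ¬ ∃ y, α.1.Rel (Sum.inl x) (Sum.inr y)}.ncard = n := by
  rw [rank_eq]
  have := Set.ncard_add_ncard_compl {x : Fin n | ∃ y, α.1.Rel (Sum.inl x) (Sum.inr y)}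
  rwa [Nat.card_eq_fintype_card, Fintype.card_fin] at this

theorem rank_le (α : motzkinMonoid n) : α.1.rank ≤ n := by
  have := rank_add_ncard α
  omega

theorem single_star {u} : (star α).1.Single u ↔ α.1.Single u.swap := by
  constructor
  · intro h v hv
    have := h v.swap (by rw [star_rel, Sum.swap_swap]; exact hv)
    rw [← this, Sum.swap_swap]
  · intro h v hv
    have := h _ hv
    exact Sum.swap_leftInverse.injective this

theorem single_mul_lower {x : Fin n} (h : β.1.Single (Sum.inr x)) :
    (α * β).1.Single (Sum.inr x) := by
  have h1 : (star β).1.Single (Sum.inl x) := single_star.2 h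
  have h2 : (star β * star α).1.Single (Sum.inl x) := h1.mul_upper
  rw [← star_mul, single_star] at h2
  exact h2

theorem single_mul_upper {x : Fin n} (h : α.1.Single (Sum.inl x)) :
    (α * β).1.Single (Sum.inl x) := Single.mul_upper h

/-! ### Non-crossing strands and hook-free elements -/

/-- Through-strands do not cross. -/
theorem rel_mono {x y x' y' : Fin n} (h : α.1.Rel (Sum.inl x) (Sum.inr y))
    (h' : α.1.Rel (Sum.inl x') (Sum.inr y')) (hx : x < x') : y < y' := by
  by_contra! hy
  rcases hy.eq_or_lt with rfl | hy
  · have := eq_of_rel h.symm h'.symm (by simp) (by simp)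
    exact hx.ne (Sum.inl_injective this)
  · have := (isPlanar_iff α.1).1 α.2.2 (Sum.inr y) (Sum.inl x) (Sum.inr y') (Sum.inl x') h.symm
      h'.symm (by simp only [position_inr]; omega) (by simp only [position_inl, position_inr]; omega)
      (by simp only [position_inl]; omega)
    exact absurd (eq_of_rel this h.symm (by simpa using hy.ne) (by simp)) (by simp)

theorem rel_lt_iff {x y x' y' : Fin n} (h : α.1.Rel (Sum.inl x) (Sum.inr y))
    (h' : α.1.Rel (Sum.inl x') (Sum.inr y')) : y < y' ↔ x < x' := by
  refine ⟨fun hy => ?_, rel_mono h h'⟩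
  by_contra! hx
  rcases hx.eq_or_lt with rfl | hx
  · have := eq_of_rel h h' (by simp) (by simp)
    exact hy.ne (Sum.inr_injective this)
  · exact hy.not_gt (rel_mono h' h hx)

/-- No two points of the same row are related. -/
def HookFree (α : motzkinMonoid n) : Prop :=
  (∀ x y, α.1.Rel (Sum.inl x) (Sum.inl y) → x = y) ∧
    ∀ x y, α.1.Rel (Sum.inr x) (Sum.inr y) → x = y

theorem HookFree.star (h : HookFree α) : HookFree (star α) := ⟨h.2, h.1⟩

theorem eq_of_hookFree (hα : HookFree α) (hβ : HookFree β)
    (hu : ∀ x, (∃ y, α.1.Rel (Sum.inl x) (Sum.inr y)) ↔ ∃ y, β.1.Rel (Sum.inl x) (Sum.inr y))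
    (hl : ∀ y, (∃ x, α.1.Rel (Sum.inl x) (Sum.inr y)) ↔ ∃ x, β.1.Rel (Sum.inl x) (Sum.inr y)) :
    α = β := by
  -- If the strand at `x` ended further left in `α` than in `β`, its end `y` would in `β` belong to
  -- some `x' < x`. By induction `α` would also join `x'` to `y`, giving `y` two partners.
  have step : ∀ (α β : motzkinMonoid n) (x y z : Fin n),
      (∀ x, (∃ y, β.1.Rel (Sum.inl x) (Sum.inr y)) → ∃ y, α.1.Rel (Sum.inl x) (Sum.inr y)) →
      (∀ y, (∃ x, α.1.Rel (Sum.inl x) (Sum.inr y)) → ∃ x, β.1.Rel (Sum.inl x) (Sum.inr y)) →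
      (∀ x' < x, ∀ y z, α.1.Rel (Sum.inl x') (Sum.inr y) → β.1.Rel (Sum.inl x') (Sum.inr z) →
        y = z) →
      α.1.Rel (Sum.inl x) (Sum.inr y) → β.1.Rel (Sum.inl x) (Sum.inr z) → ¬ y < z := by
    intro α β x y z hu hl ih hy hz hyz
    obtain ⟨x', hx'⟩ := hl y ⟨x, hy⟩
    have hlt : x' < x := (rel_lt_iff hx' hz).1 hyz
    obtain ⟨y', hy'⟩ := hu x' ⟨y, hx'⟩
    obtain rfl := ih x' hlt y' y hy' hx'
    have := eq_of_rel hy.symm hy'.symm (by simp) (by simp)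
    exact hlt.ne' (Sum.inl_injective this)
  have key : ∀ x y z, α.1.Rel (Sum.inl x) (Sum.inr y) → β.1.Rel (Sum.inl x) (Sum.inr z) →
      y = z := by
    intro x
    induction x using WellFoundedLT.induction with
    | ind x ih =>
      intro y z hy hz
      refine le_antisymm (not_lt.1 ?_) (not_lt.1 ?_)
      · exact step β α x z y (fun x => (hu x).1) (fun x => (hl x).2)
          (fun x' h y z h1 h2 => (ih x' h z y h2 h1).symm) hz hy
      · exact step α β x y z (fun x => (hu x).2) (fun x => (hl x).1) ih hy hz
  have main : ∀ x y, α.1.Rel (Sum.inl x) (Sum.inr y) ↔ β.1.Rel (Sum.inl x) (Sum.inr y) := by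
    intro x y
    constructor
    · intro h
      obtain ⟨z, hz⟩ := (hu x).1 ⟨y, h⟩
      rwa [key x y z h hz]
    · intro h
      obtain ⟨z, hz⟩ := (hu x).2 ⟨y, h⟩
      rwa [← key x z y hz h]
  refine ext_rel ?_
  rintro (u | u) (v | v)
  · constructor
    · intro h; rw [hα.1 _ _ h]; exact rel_refl _ _
    · intro h; rw [hβ.1 _ _ h]; exact rel_refl _ _
  · exact main u v
  · rw [rel_comm, main, rel_comm]
  · constructor
    · intro h; rw [hα.2 _ _ h]; exact rel_refl _ _
    · intro h; rw [hβ.2 _ _ h]; exact rel_refl _ _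

theorem one_rel_through (x : Fin n) : (1 : motzkinMonoid n).1.Rel (Sum.inl x) (Sum.inr x) := rfl

theorem hookFree_one : HookFree (1 : motzkinMonoid n) := ⟨fun _ _ h => h, fun _ _ h => h⟩

theorem not_through_of_hook {x y z : Fin n} (h : α.1.Rel (Sum.inl x) (Sum.inl y)) (hxy : x ≠ y) :
    ¬ α.1.Rel (Sum.inl x) (Sum.inr z) := fun h' =>
  absurd (eq_of_rel h h' (by simpa using hxy.symm) (by simp)) (by simp)

theorem not_through_of_hook_lower {x y z : Fin n} (h : α.1.Rel (Sum.inr x) (Sum.inr y))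
    (hxy : x ≠ y) : ¬ α.1.Rel (Sum.inl z) (Sum.inr x) := fun h' =>
  absurd (eq_of_rel h h'.symm (by simpa using hxy.symm) (by simp)) (by simp)

/-- All `2n` points lie on strands, so there are no hooks and the ends are those of the identity. -/
theorem eq_one_of_rank (h : α.1.rank = n) : α = 1 := by
  have key : ∀ α : motzkinMonoid n, α.1.rank = n →
      ∀ x, ∃ y, α.1.Rel (Sum.inl x) (Sum.inr y) := by
    intro α h x
    have h1 := rank_add_ncard α
    rw [h] at h1
    have h2 := (Set.ncard_eq_zero (Set.toFinite _)).1 (Nat.add_eq_left.1 h1)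
    by_contra hx
    exact Set.notMem_empty x (h2 ▸ hx)
  have h1 := key α h
  have h2 := key (star α) ((rank_star α).trans h)
  have h3 : ∀ y, ∃ x, α.1.Rel (Sum.inl x) (Sum.inr y) := fun y =>
    (h2 y).imp fun x hx => Rel.symm hx
  refine eq_of_hookFree ⟨fun x y hxy => ?_, fun x y hxy => ?_⟩ hookFree_one
    (fun x => iff_of_true (h1 x) ⟨x, one_rel_through x⟩)
    (fun x => iff_of_true (h3 x) ⟨x, one_rel_through x⟩)
  · by_contra hne
    exact (not_through_of_hook hxy hne) (h1 x).choose_spec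
  · by_contra hne
    exact (not_through_of_hook_lower hxy hne) (h3 x).choose_spec

theorem rank_one : (1 : motzkinMonoid n).1.rank = n := by
  have h := rank_add_ncard (1 : motzkinMonoid n)
  rwa [(Set.ncard_eq_zero (Set.toFinite _)).2, add_zero] at h
  exact Set.eq_empty_of_forall_notMem fun x hx => hx ⟨x, one_rel_through x⟩

/-! ### Elements of rank `n - 1` -/

/-- `i` is the only upper point and `j` the only lower point not on a through-strand. -/
def Missing (α : motzkinMonoid n) (i j : Fin n) : Prop :=
  (∀ x, (∃ y, α.1.Rel (Sum.inl x) (Sum.inr y)) ↔ x ≠ i) ∧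
    ∀ y, (∃ x, α.1.Rel (Sum.inl x) (Sum.inr y)) ↔ y ≠ j

theorem Missing.star {i j : Fin n} (h : Missing α i j) : Missing (star α) j i :=
  ⟨fun x => (exists_congr fun _ => rel_comm).trans (h.2 x),
    fun x => (exists_congr fun _ => rel_comm).trans (h.1 x)⟩

theorem Missing.single {i j : Fin n} (h : Missing α i j) : α.1.Single (Sum.inl i) := by
  rintro (y | y) hy
  · by_contra hne
    have hne : i ≠ y := fun h => hne (h ▸ rfl)
    obtain ⟨z, hz⟩ := (h.1 y).2 hne.symm
    exact not_through_of_hook hy.symm hne.symm hz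
  · exact absurd rfl ((h.1 i).1 ⟨y, hy⟩)

theorem Missing.single_lower {i j : Fin n} (h : Missing α i j) : α.1.Single (Sum.inr j) :=
  single_star.1 h.star.single

theorem Missing.hookFree {i j : Fin n} (h : Missing α i j) : HookFree α := by
  have key : ∀ (α : motzkinMonoid n) (i j : Fin n), Missing α i j →
      ∀ x y, α.1.Rel (Sum.inl x) (Sum.inl y) → x = y := by
    intro α i j h x y hxy
    by_cases hx : x = i
    · subst hx
      exact (Sum.inl_injective (h.single _ hxy)).symm
    · obtain ⟨z, hz⟩ := (h.1 x).2 hx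
      by_contra hne
      exact not_through_of_hook hxy hne hz
  exact ⟨key α i j h, key (Motzkin.star α) j i h.star⟩

/-- This makes the pair `(i, j)` a coordinate system for the elements of rank `n - 1`. -/
theorem Missing.eq {i j : Fin n} (h : Missing α i j) (h' : Missing β i j) : α = β :=
  eq_of_hookFree h.hookFree h'.hookFree (fun x => (h.1 x).trans (h'.1 x).symm)
    (fun x => (h.2 x).trans (h'.2 x).symm)

theorem Missing.rank {i j : Fin n} (h : Missing α i j) : α.1.rank + 1 = n := by
  have h1 := rank_add_ncard α
  have h2 : {x : Fin n | ¬ ∃ y, α.1.Rel (Sum.inl x) (Sum.inr y)} = {i} := by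
    ext x
    simp only [Set.mem_ofPred_eq, Set.mem_singleton_iff, h.1 x, not_not]
  rwa [h2, Set.ncard_singleton] at h1

theorem exists_missing (h : α.1.rank + 1 = n) : ∃ i j, Missing α i j := by
  have key : ∀ α : motzkinMonoid n, α.1.rank + 1 = n →
      ∃ i, ∀ x, (∃ y, α.1.Rel (Sum.inl x) (Sum.inr y)) ↔ x ≠ i := by
    intro α h
    have h1 : {x : Fin n | ¬ ∃ y, α.1.Rel (Sum.inl x) (Sum.inr y)}.ncard = 1 := by
      have := rank_add_ncard α
      omega
    obtain ⟨i, hi⟩ := Set.ncard_eq_one.1 h1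
    refine ⟨i, fun x => ?_⟩
    have := Set.ext_iff.1 hi x
    simp only [Set.mem_ofPred_eq, Set.mem_singleton_iff] at this
    rw [ne_eq, ← this, not_not]
  obtain ⟨i, hi⟩ := key α h
  obtain ⟨j, hj⟩ := key (Motzkin.star α) (by rwa [rank_star])
  exact ⟨i, j, hi, fun y => (exists_congr fun _ => rel_comm).trans (hj y)⟩

theorem Missing.unique {i j k l : Fin n} (h : Missing α i j) (h' : Missing α k l) :
    i = k ∧ j = l := by
  constructor
  · by_contra hne
    exact (h.1 i).1 ((h'.1 i).2 hne) rfl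
  · by_contra hne
    exact (h.2 j).1 ((h'.2 j).2 hne) rfl

theorem Missing.single_iff {i j k : Fin n} (h : Missing α i j) :
    α.1.Single (Sum.inl k) ↔ k = i := by
  refine ⟨fun hk => ?_, fun hk => hk ▸ h.single⟩
  by_contra hne
  obtain ⟨y, hy⟩ := (h.1 k).2 hne
  cases hk _ hy

theorem Missing.single_lower_iff {i j k : Fin n} (h : Missing α i j) :
    α.1.Single (Sum.inr k) ↔ k = j :=
  single_star.symm.trans h.star.single_iff

/-- The middle points used by the strands of the two factors are the same, all except `j`, so every
strand continues. -/
theorem Missing.mul {i j k : Fin n} (h : Missing α i j) (h' : Missing β j k) :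
    Missing (α * β) i k := by
  have key : ∀ (α β : motzkinMonoid n) (i j k : Fin n), Missing α i j → Missing β j k →
      ∀ x, (∃ y, (α * β).1.Rel (Sum.inl x) (Sum.inr y)) ↔ x ≠ i := by
    intro α β i j k h h' x
    constructor
    · rintro ⟨y, hy⟩ rfl
      cases single_mul_upper h.single _ hy
    · intro hx
      obtain ⟨m, hm⟩ := (h.1 x).2 hx
      obtain ⟨y, hy⟩ := (h'.1 m).2 ((h.2 m).1 ⟨x, hm⟩)
      exact ⟨y, rel_mul_through hm hy⟩
  refine ⟨key α β i j k h h', fun y => ?_⟩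
  have := key _ _ _ _ _ h'.star h.star y
  rw [← star_mul] at this
  exact (exists_congr fun _ => rel_comm).trans this

end Motzkin

/-! ### Generators -/

namespace Motzkin

open DiagramPartition

variable {n : ℕ}

/-- Breaking pairs into singletons creates neither large blocks nor crossings. -/
theorem mem_of_rel_le {α : motzkinMonoid n} {γ : DiagramPartition n}
    (h : ∀ u v, γ.Rel u v → α.1.Rel u v) : γ ∈ motzkinMonoid n := by
  constructor
  · rw [isPartialBrauer_iff]
    intro a b c hab hac
    exact (isPartialBrauer_iff _).1 α.2.1 a b c (h _ _ hab) (h _ _ hac)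
  · rw [isPlanar_iff]
    intro a b x y hab hxy h1 h2 h3
    exfalso
    have hax := (isPlanar_iff _).1 α.2.2 a b x y (h _ _ hab) (h _ _ hxy) h1 h2 h3
    -- A crossing would put the three distinct points `a`, `x`, `b` in one block of `α`.
    rcases (isPartialBrauer_iff _).1 α.2.1 _ _ _ hax (h _ _ hab) with rfl | rfl | rfl <;> omega

/-- The partition in which the points outside `S`, and their partners, become singletons. -/
def isolate (γ : DiagramPartition n) (S : Set (Fin n ⊕ Fin n)) : DiagramPartition n where
  r u v := u = v ∨ (u ∈ S ∧ v ∈ S ∧ γ.Rel u v)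
  iseqv := by
    refine ⟨fun _ => Or.inl rfl, ?_, ?_⟩
    · rintro x y (rfl | ⟨h1, h2, h3⟩)
      exacts [Or.inl rfl, Or.inr ⟨h2, h1, h3.symm⟩]
    · rintro x y z (rfl | ⟨h1, h2, h3⟩) (rfl | ⟨h4, h5, h6⟩)
      exacts [Or.inl rfl, Or.inr ⟨h4, h5, h6⟩, Or.inr ⟨h1, h2, h3⟩, Or.inr ⟨h1, h5, h3.trans h6⟩]

theorem isolate_rel {γ : DiagramPartition n} {S u v} :
    (isolate γ S).Rel u v ↔ u = v ∨ (u ∈ S ∧ v ∈ S ∧ γ.Rel u v) := Iff.rfl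

/-- `isolate` on the Motzkin monoid. -/
def restrict (α : motzkinMonoid n) (S : Set (Fin n ⊕ Fin n)) : motzkinMonoid n :=
  ⟨isolate α.1 S, mem_of_rel_le (α := α) fun u v h => by
    rcases h with rfl | ⟨-, -, h⟩
    exacts [rel_refl _ _, h]⟩

theorem restrict_rel {α : motzkinMonoid n} {S u v} :
    (restrict α S).1.Rel u v ↔ u = v ∨ (u ∈ S ∧ v ∈ S ∧ α.1.Rel u v) := Iff.rfl

/-- The partition relating points with equal labels. -/
def labelled {X : Type*} (f : Fin n ⊕ Fin n → X) : DiagramPartition n := Setoid.ker f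

theorem labelled_rel {X : Type*} {f : Fin n ⊕ Fin n → X} {u v} :
    (labelled f).Rel u v ↔ f u = f v := Iff.rfl

/-! ### Shifts: elements of rank `n - 1` on or next to the diagonal -/

/-- The diagram of a shift: `i` and `j'` are singletons, `j` is joined to `i'`, and the other
points `k` to `k'`. -/
def shiftDiagram (i j : Fin n) : DiagramPartition n :=
  isolate (labelled (Sum.elim (Equiv.swap i j) id)) {Sum.inl i, Sum.inr j}ᶜ

theorem shiftDiagram_rel {i j : Fin n} {u v} : (shiftDiagram i j).Rel u v ↔
    u = v ∨ ((u ≠ Sum.inl i ∧ u ≠ Sum.inr j) ∧ (v ≠ Sum.inl i ∧ v ≠ Sum.inr j) ∧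
      Sum.elim (Equiv.swap i j) id u = Sum.elim (Equiv.swap i j) id v) := by
  have : ∀ u : Fin n ⊕ Fin n, u ∈ ({Sum.inl i, Sum.inr j}ᶜ : Set _) ↔
      u ≠ Sum.inl i ∧ u ≠ Sum.inr j := fun u => by simp
  rw [shiftDiagram, isolate_rel, this, this, labelled_rel]

theorem shiftDiagram_upper {i j x y : Fin n} :
    (shiftDiagram i j).Rel (Sum.inl x) (Sum.inl y) ↔ x = y := by
  rw [shiftDiagram_rel]
  simp only [Sum.inl.injEq, Sum.elim_inl, EmbeddingLike.apply_eq_iff_eq]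
  tauto

theorem shiftDiagram_lower {i j x y : Fin n} :
    (shiftDiagram i j).Rel (Sum.inr x) (Sum.inr y) ↔ x = y := by
  rw [shiftDiagram_rel]
  simp only [Sum.inr.injEq, Sum.elim_inr, id]
  tauto

theorem shiftDiagram_through {i j x y : Fin n} :
    (shiftDiagram i j).Rel (Sum.inl x) (Sum.inr y) ↔ x ≠ i ∧ y = Equiv.swap i j x := by
  rw [shiftDiagram_rel]
  simp only [ne_eq, Sum.inl.injEq, reduceCtorEq, not_false_eq_true, and_true, true_and,
    Sum.inr.injEq, Sum.elim_inl, Sum.elim_inr, id, false_or]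
  constructor
  · rintro ⟨h1, -, h2⟩
    exact ⟨h1, h2.symm⟩
  · rintro ⟨h1, rfl⟩
    refine ⟨h1, fun h => h1 ?_, rfl⟩
    rwa [Equiv.swap_apply_eq_iff, Equiv.swap_apply_right] at h

/-- Without hooks, only two through-strands can cross. -/
theorem planar_of_mono {γ : DiagramPartition n}
    (hu : ∀ x y, γ.Rel (Sum.inl x) (Sum.inl y) → x = y)
    (hl : ∀ x y, γ.Rel (Sum.inr x) (Sum.inr y) → x = y)
    (hm : ∀ x y x' y', γ.Rel (Sum.inl x) (Sum.inr y) → γ.Rel (Sum.inl x') (Sum.inr y') →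
      x < x' → y < y') : γ.IsPlanar := by
  rw [isPlanar_iff]
  intro a b x y hab hxy h1 h2 h3
  exfalso
  rcases a with a | a <;> rcases b with b | b <;> rcases x with x | x <;> rcases y with y | y <;>
    simp only [position_inl, position_inr] at h1 h2 h3 <;>
    first
    | omega
    | (have := hu _ _ hab; subst this; omega)
    | (have := hu _ _ hxy; subst this; omega)
    | (have := hl _ _ hab; subst this; omega)
    | (have := hm _ _ _ _ (Rel.symm hab) (Rel.symm hxy) (Fin.lt_def.2 (by omega))
       rw [Fin.lt_def] at this; omega)

theorem shiftDiagram_mem {i j : Fin n} (hij : (i : ℕ) ≤ j + 1) (hji : (j : ℕ) ≤ i + 1) :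
    shiftDiagram i j ∈ motzkinMonoid n := by
  constructor
  · rw [isPartialBrauer_iff]
    have key : ∀ {x y z}, (shiftDiagram i j).Rel (Sum.inl x) (Sum.inr z) →
        (shiftDiagram i j).Rel (Sum.inl y) (Sum.inr z) → x = y := by
      intro x y z h1 h2
      rw [shiftDiagram_through] at h1 h2
      exact (Equiv.swap i j).injective (h1.2.symm.trans h2.2)
    have key' : ∀ {x y z}, (shiftDiagram i j).Rel (Sum.inl z) (Sum.inr x) →
        (shiftDiagram i j).Rel (Sum.inl z) (Sum.inr y) → x = y := by
      intro x y z h1 h2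
      rw [shiftDiagram_through] at h1 h2
      exact h1.2.trans h2.2.symm
    rintro (a | a) (b | b) (c | c) hab hac
    · exact Or.inl (congrArg _ (shiftDiagram_upper.1 hab))
    · exact Or.inl (congrArg _ (shiftDiagram_upper.1 hab))
    · exact Or.inr (Or.inl (congrArg _ (shiftDiagram_upper.1 hac)))
    · exact Or.inr (Or.inr (congrArg _ (key' hab hac)))
    · exact Or.inr (Or.inr (congrArg _ (key hab.symm hac.symm)))
    · exact Or.inr (Or.inl (congrArg _ (shiftDiagram_lower.1 hac)))
    · exact Or.inl (congrArg _ (shiftDiagram_lower.1 hab))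
    · exact Or.inl (congrArg _ (shiftDiagram_lower.1 hab))
  · refine planar_of_mono (fun _ _ => shiftDiagram_upper.1) (fun _ _ => shiftDiagram_lower.1) ?_
    intro x y x' y' h h' hx
    rw [shiftDiagram_through] at h h'
    obtain ⟨h1, rfl⟩ := h
    obtain ⟨h2, rfl⟩ := h'
    rw [Equiv.swap_apply_def, Equiv.swap_apply_def, if_neg h1, if_neg h2]
    -- The strand from `j` to `i'` crosses no vertical strand, since no column lies strictly between
    -- `i` and `j`.
    split_ifs with h3 h4 h4 <;> omega

/-- The element with singletons `i` and `j'` that joins `j` to `i'` and the other points `k`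
to `k'`, for `i` and `j` at distance at most one. -/
def shift (i j : Fin n) (hij : (i : ℕ) ≤ j + 1) (hji : (j : ℕ) ≤ i + 1) : motzkinMonoid n :=
  ⟨shiftDiagram i j, shiftDiagram_mem hij hji⟩

theorem shift_missing {i j : Fin n} (hij : (i : ℕ) ≤ j + 1) (hji : (j : ℕ) ≤ i + 1) :
    Missing (shift i j hij hji) i j := by
  refine ⟨fun x => ⟨?_, fun h => ⟨_, shiftDiagram_through.2 ⟨h, rfl⟩⟩⟩, fun y => ⟨?_, fun h =>
    ⟨Equiv.swap i j y, shiftDiagram_through.2 ⟨fun h' => h ?_, by rw [Equiv.swap_apply_self]⟩⟩⟩⟩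
  · rintro ⟨y, hy⟩
    exact (shiftDiagram_through.1 hy).1
  · rintro ⟨x, hx⟩ rfl
    obtain ⟨h1, h2⟩ := shiftDiagram_through.1 hx
    rw [eq_comm, Equiv.swap_apply_eq_iff, Equiv.swap_apply_right] at h2
    exact h1 h2
  · rwa [Equiv.swap_apply_eq_iff, Equiv.swap_apply_left] at h'

theorem swap_inl (i j x : Fin n) :
    Equiv.swap (Sum.inl i : Fin n ⊕ Fin n) (Sum.inl j) (Sum.inl x) =
      Sum.inl (Equiv.swap i j x) := by
  rw [Equiv.swap_apply_def, Equiv.swap_apply_def]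
  simp only [Sum.inl.injEq]
  split_ifs <;> rfl

theorem swap_inr (i j x : Fin n) :
    Equiv.swap (Sum.inl i : Fin n ⊕ Fin n) (Sum.inl j) (Sum.inr x) = Sum.inr x :=
  Equiv.swap_apply_of_ne_of_ne (by simp) (by simp)

/-- Multiplying by a shift on the left relabels the upper points. -/
theorem shift_mul_rel {i j : Fin n} (hij : (i : ℕ) ≤ j + 1) (hji : (j : ℕ) ≤ i + 1)
    (β : motzkinMonoid n) (u v) : (shift i j hij hji * β).1.Rel u v ↔ u = v ∨
      (u ≠ Sum.inl i ∧ v ≠ Sum.inl i ∧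
        β.1.Rel (Equiv.swap (Sum.inl i) (Sum.inl j) u) (Equiv.swap (Sum.inl i) (Sum.inl j) v)) := by
  have hthru : ∀ u u', (shiftDiagram i j).Thru u u' ↔
      u ≠ Sum.inl i ∧ u' = Equiv.swap (Sum.inl i) (Sum.inl j) u := by
    rintro (x | x) (m | m)
    · simp [Thru, swap_inl, shiftDiagram_through]
    · simp [Thru, swap_inl]
    · simp [Thru, swap_inr]
    · simp [Thru, swap_inr, eq_comm]
  refine (mul_rel_of_lower_single (fun _ _ => shiftDiagram_lower.1) u v).trans ?_
  simp only [hthru]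
  constructor
  · rintro (⟨x, y, rfl, rfl, h⟩ | ⟨_, _, ⟨h1, rfl⟩, ⟨h2, rfl⟩, h⟩)
    · exact Or.inl (congrArg _ (shiftDiagram_upper.1 h))
    · exact Or.inr ⟨h1, h2, h⟩
  · rintro (rfl | ⟨h1, h2, h⟩)
    · rcases u with x | x
      · exact Or.inl ⟨x, x, rfl, rfl, rel_refl _ _⟩
      · exact Or.inr ⟨_, _, ⟨by simp, rfl⟩, ⟨by simp, rfl⟩, rel_refl _ _⟩
    · exact Or.inr ⟨_, _, ⟨h1, rfl⟩, ⟨h2, rfl⟩, h⟩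

/-! ### Adjacent hooks -/

/-- The diagram with blocks `{i, j}`, `{i'}`, `{j'}` and `{k, k'}` for the other points `k`. -/
def hookDiagram (i j : Fin n) : DiagramPartition n :=
  labelled (X := Fin n ⊕ Fin n)
    (Sum.elim (fun x => if x = i ∨ x = j then Sum.inl i else Sum.inl x)
      (fun x => if x = i ∨ x = j then Sum.inr x else Sum.inl x))

theorem hookDiagram_upper {i j x y : Fin n} : (hookDiagram i j).Rel (Sum.inl x) (Sum.inl y) ↔
    x = y ∨ ((x = i ∨ x = j) ∧ (y = i ∨ y = j)) := by
  simp only [hookDiagram, labelled_rel, Sum.elim_inl]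
  grind

theorem hookDiagram_lower {i j x y : Fin n} :
    (hookDiagram i j).Rel (Sum.inr x) (Sum.inr y) ↔ x = y := by
  simp only [hookDiagram, labelled_rel, Sum.elim_inr]
  grind

theorem hookDiagram_through {i j x y : Fin n} :
    (hookDiagram i j).Rel (Sum.inl x) (Sum.inr y) ↔ x = y ∧ x ≠ i ∧ x ≠ j := by
  simp only [hookDiagram, labelled_rel, Sum.elim_inl, Sum.elim_inr]
  grind

theorem hookDiagram_mem {i j : Fin n} (hij : (j : ℕ) = i + 1) :
    hookDiagram i j ∈ motzkinMonoid n := by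
  have through' : ∀ {x y}, (hookDiagram i j).Rel (Sum.inr y) (Sum.inl x) ↔
      x = y ∧ x ≠ i ∧ x ≠ j := rel_comm.trans hookDiagram_through
  constructor
  · rw [isPartialBrauer_iff]
    rintro (a | a) (b | b) (c | c) hab hac <;>
      simp only [hookDiagram_upper, hookDiagram_lower, hookDiagram_through, through'] at hab hac <;>
      simp only [Sum.inl.injEq, Sum.inr.injEq, reduceCtorEq, false_or, or_false] <;> grind
  · rw [isPlanar_iff]
    intro a b x y hab hxy h1 h2 h3
    exfalso
    rcases a with a | a <;> rcases b with b | b <;> rcases x with x | x <;> rcases y with y | y <;>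
      simp only [position_inl, position_inr] at h1 h2 h3 <;>
      simp only [hookDiagram_upper, hookDiagram_lower, hookDiagram_through, through'] at hab hxy <;>
      omega

/-- The element with blocks `{i, j}`, `{i'}`, `{j'}` and `{k, k'}` for the other points `k`,
for `j = i + 1`. -/
def hook (i j : Fin n) (hij : (j : ℕ) = i + 1) : motzkinMonoid n :=
  ⟨hookDiagram i j, hookDiagram_mem hij⟩

/-- Away from `i` and `j` the hook acts as the identity; the blocks of `β` at these two upper points
are cut off and `i`, `j` are joined instead. -/
theorem hook_mul_rel {i j : Fin n} (hij : (j : ℕ) = i + 1) (β : motzkinMonoid n) (u v) :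
    (hook i j hij * β).1.Rel u v ↔ u = v ∨
      ((u = Sum.inl i ∨ u = Sum.inl j) ∧ (v = Sum.inl i ∨ v = Sum.inl j)) ∨
      ((u ≠ Sum.inl i ∧ u ≠ Sum.inl j) ∧ (v ≠ Sum.inl i ∧ v ≠ Sum.inl j) ∧ β.1.Rel u v) := by
  have hthru : ∀ u u', (hookDiagram i j).Thru u u' ↔
      (u ≠ Sum.inl i ∧ u ≠ Sum.inl j) ∧ u' = u := by
    rintro (x | x) (m | m)
    · simp [Thru, hookDiagram_through, eq_comm, and_comm]
    · simp [Thru]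
    · simp [Thru]
    · simp [Thru, eq_comm]
  refine (mul_rel_of_lower_single (fun _ _ => hookDiagram_lower.1) u v).trans ?_
  simp only [hthru]
  constructor
  · rintro (⟨x, y, rfl, rfl, h⟩ | ⟨_, _, ⟨h1, rfl⟩, ⟨h2, rfl⟩, h⟩)
    · rcases hookDiagram_upper.1 h with h | ⟨h1, h2⟩
      · exact Or.inl (congrArg _ h)
      · exact Or.inr (Or.inl (by simpa using And.intro h1 h2))
    · exact Or.inr (Or.inr ⟨h1, h2, h⟩)
  · rintro (rfl | ⟨h1, h2⟩ | ⟨h1, h2, h⟩)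
    · rcases u with x | x
      · exact Or.inl ⟨x, x, rfl, rfl, rel_refl _ _⟩
      · exact Or.inr ⟨_, _, ⟨by simp, rfl⟩, ⟨by simp, rfl⟩, rel_refl _ _⟩
    · rcases u with x | x <;> rcases v with y | y
      · exact Or.inl ⟨x, y, rfl, rfl, hookDiagram_upper.2 (Or.inr (by
          simpa using And.intro h1 h2))⟩
      all_goals simp at h1 h2
    · exact Or.inr ⟨_, _, ⟨h1, rfl⟩, ⟨h2, rfl⟩, h⟩

end Motzkin

/-! ### Generation by elements of large rank -/

namespace Motzkin

open DiagramPartition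

variable {n : ℕ} {α β : motzkinMonoid n}

/-- The horizontal distance of two points. -/
def gap (u v : Fin n ⊕ Fin n) : ℕ :=
  (Sum.elim Fin.val Fin.val u - Sum.elim Fin.val Fin.val v) +
    (Sum.elim Fin.val Fin.val v - Sum.elim Fin.val Fin.val u)

open Classical in
/-- The contribution of a pair of points to the length. -/
noncomputable def weight (α : motzkinMonoid n) (u v : Fin n ⊕ Fin n) : ℕ :=
  if α.1.Rel u v then gap u v else 0

theorem weight_of_rel {u v} (h : α.1.Rel u v) : weight α u v = gap u v := if_pos h

theorem weight_of_not_rel {u v} (h : ¬ α.1.Rel u v) : weight α u v = 0 := if_neg h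

/-- The total horizontal length of the blocks, each counted twice. -/
noncomputable def length (α : motzkinMonoid n) : ℕ := ∑ u, ∑ v, weight α u v

theorem length_star (α : motzkinMonoid n) : length (star α) = length α := by
  have h : ∀ u v, weight (star α) u v = weight α u.swap v.swap := by
    intro u v
    have : gap u v = gap u.swap v.swap := by rcases u with u | u <;> rcases v with v | v <;> rfl
    unfold weight
    rw [this]
    rfl
  unfold length
  simp only [h]
  rw [← Equiv.sum_comp (Equiv.sumComm (Fin n) (Fin n)) (fun u => ∑ v, weight α u v)]
  refine Finset.sum_congr rfl fun u _ => ?_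
  exact Equiv.sum_comp (Equiv.sumComm (Fin n) (Fin n)) (fun v => weight α u.swap v)

theorem length_lt (σ : Equiv.Perm (Fin n ⊕ Fin n))
    (h : ∀ u v, weight α u v ≤ weight β (σ u) (σ v))
    (h' : ∃ u v, weight α u v < weight β (σ u) (σ v)) : length α < length β := by
  have e : length β = ∑ u, ∑ v, weight β (σ u) (σ v) := by
    unfold length
    rw [← Equiv.sum_comp σ]
    exact Finset.sum_congr rfl fun u _ => (Equiv.sum_comp σ _).symm
  rw [e]
  obtain ⟨u, v, huv⟩ := h'
  refine Finset.sum_lt_sum (fun u _ => Finset.sum_le_sum fun v _ => h u v)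
    ⟨u, Finset.mem_univ _, ?_⟩
  exact Finset.sum_lt_sum (fun v _ => h u v) ⟨v, Finset.mem_univ _, huv⟩

/-- An upper singleton next to a point whose partner lies on the other side of the singleton can
be exchanged with this point. -/
theorem exists_shift_mul {i j : Fin n} (hij : (j : ℕ) = i + 1) (hi : α.1.Single (Sum.inl i))
    {w} (hw : α.1.Rel (Sum.inl j) w) (hne : w ≠ Sum.inl j)
    (hwi : Sum.elim Fin.val Fin.val w ≤ (i : ℕ)) :
    ∃ α', α = shift i j (by omega) (by omega) * α' ∧ length α' < length α ∧
      ∀ u v, α'.1.Rel u v ↔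
        α.1.Rel (Equiv.swap (Sum.inl i) (Sum.inl j) u) (Equiv.swap (Sum.inl i) (Sum.inl j) v) := by
  set σ : Equiv.Perm (Fin n ⊕ Fin n) := Equiv.swap (Sum.inl i) (Sum.inl j) with hσ
  have hσi : σ (Sum.inl i) = Sum.inl j := Equiv.swap_apply_left _ _
  have hσj : σ (Sum.inl j) = Sum.inl i := Equiv.swap_apply_right _ _
  have hσσ : ∀ u, σ (σ u) = u := Equiv.swap_apply_self _ _
  -- The required `α'` is the product of the opposite shift with `α`. The only upper point which
  -- that shift cuts off is the singleton `i` of `α`, so no information is lost and the effect is a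
  -- pure relabelling.
  have hrel : ∀ u v, (shift j i (by omega) (by omega) * α).1.Rel u v ↔ α.1.Rel (σ u) (σ v) := by
    intro u v
    rw [shift_mul_rel, Equiv.swap_comm, ← hσ]
    constructor
    · rintro (rfl | ⟨-, -, h⟩)
      exacts [rel_refl _ _, h]
    · intro h
      by_cases hu : u = Sum.inl j
      · subst hu
        rw [hσj] at h
        have := hi _ h
        rw [← hσj] at this
        exact Or.inl (σ.injective this).symm
      · by_cases hv : v = Sum.inl j
        · subst hv
          rw [hσj] at h
          have := hi _ h.symm
          rw [← hσj] at this
          exact Or.inl (σ.injective this)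
        · exact Or.inr ⟨hu, hv, h⟩
  have hfix : ∀ u, u ≠ Sum.inl i → u ≠ Sum.inl j → σ u = u := fun u h1 h2 =>
    Equiv.swap_apply_of_ne_of_ne h1 h2
  have hwi' : w ≠ Sum.inl i := by
    rintro rfl
    have := hi _ hw.symm
    exact hne this.symm
  -- As `w` is in column `i` or to its left, moving its partner from column `j` to column `i`
  -- shortens the block.
  have hgap : gap (Sum.inl i) w < gap (Sum.inl j) w := by
    simp only [gap, Sum.elim_inl]
    omega
  have hgap' : ∀ u v : Fin n ⊕ Fin n, gap u v = gap v u := fun u v => add_comm _ _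
  refine ⟨shift j i (by omega) (by omega) * α, ext_rel fun u v => ?_, length_lt σ ?_ ?_, hrel⟩
  · rw [shift_mul_rel, ← hσ, hrel, hσσ, hσσ]
    constructor
    · intro h
      by_cases hu : u = Sum.inl i
      · subst hu
        exact Or.inl (hi _ h).symm
      · by_cases hv : v = Sum.inl i
        · subst hv
          exact Or.inl (hi _ h.symm)
        · exact Or.inr ⟨hu, hv, h⟩
    · rintro (rfl | ⟨-, -, h⟩)
      exacts [rel_refl _ _, h]
  -- Apart from trivial pairs, the only related pair that `σ` moves is `{j, w}`.
  · have key : ∀ p q, α.1.Rel p q → gap (σ p) (σ q) ≤ gap p q := by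
      intro p q h
      by_cases hpq : p = q
      · subst hpq
        simp [gap]
      by_cases hp : p = Sum.inl i
      · subst hp
        exact absurd (hi _ h).symm hpq
      by_cases hq : q = Sum.inl i
      · subst hq
        exact absurd (hi _ h.symm) hpq
      by_cases hpj : p = Sum.inl j
      · subst hpj
        obtain rfl := eq_of_rel h hw (Ne.symm hpq) hne
        rw [hσj, hfix _ hwi' hne]
        exact hgap.le
      by_cases hqj : q = Sum.inl j
      · subst hqj
        obtain rfl := eq_of_rel h.symm hw hpq hne
        rw [hσj, hfix _ hwi' hne, hgap', hgap' p]
        exact hgap.le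
      rw [hfix _ hp hpj, hfix _ hq hqj]
    intro u v
    by_cases h : α.1.Rel (σ u) (σ v)
    · rw [weight_of_rel h, weight_of_rel ((hrel u v).2 h)]
      simpa only [hσσ] using key _ _ h
    · rw [weight_of_not_rel (mt (hrel u v).1 h)]
      exact Nat.zero_le _
  · refine ⟨Sum.inl i, w, ?_⟩
    have hw' : α.1.Rel (σ (Sum.inl i)) (σ w) := by rwa [hσi, hfix _ hwi' hne]
    rwa [weight_of_rel ((hrel _ _).2 hw'), weight_of_rel hw', hσi, hfix _ hwi' hne]

/-! ### Generation of the hook-free elements -/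

/-- The image of a subsemigroup under the exchange of the rows. -/
def starSubsemigroup (U : Subsemigroup (motzkinMonoid n)) : Subsemigroup (motzkinMonoid n) where
  carrier := {α | star α ∈ U}
  mul_mem' {a b} ha hb := by
    change star (a * b) ∈ U
    rw [star_mul]
    exact U.mul_mem hb ha

theorem mem_starSubsemigroup {U : Subsemigroup (motzkinMonoid n)} :
    α ∈ starSubsemigroup U ↔ star α ∈ U := Iff.rfl

theorem star_mem_starSubsemigroup {U : Subsemigroup (motzkinMonoid n)} :
    star α ∈ starSubsemigroup U ↔ α ∈ U := by rw [mem_starSubsemigroup, star_star]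

/-- Each factor `shift a a` deletes the strand from `a` to `a'`. -/
theorem exists_partial_identity {U : Subsemigroup (motzkinMonoid n)} (h1 : 1 ∈ U)
    (hU : ∀ α : motzkinMonoid n, α.1.rank + 1 = n → α ∈ U) (s : Finset (Fin n)) :
    ∃ β ∈ U, ∀ u v, β.1.Rel u v ↔
      u = v ∨ (Sum.elim id id u = Sum.elim id id v ∧ Sum.elim id id u ∉ s) := by
  induction s using Finset.induction_on with
  | empty =>
    refine ⟨1, h1, fun u v => ?_⟩
    change (1 : DiagramPartition n).Rel u v ↔ _
    rw [one_rel]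
    constructor
    · exact fun h => Or.inr ⟨h, Finset.notMem_empty _⟩
    · rintro (rfl | ⟨h, -⟩)
      exacts [rfl, h]
  | insert a s ha ih =>
    obtain ⟨β, hβ, h⟩ := ih
    refine ⟨shift a a (by omega) (by omega) * β,
      U.mul_mem (hU _ (shift_missing (by omega) (by omega)).rank) hβ, fun u v => ?_⟩
    rw [shift_mul_rel, Equiv.swap_self, Equiv.refl_apply, Equiv.refl_apply, h, Finset.mem_insert]
    rcases u with u | u <;> rcases v with v | v <;>
      simp only [ne_eq, Sum.inl.injEq, Sum.inr.injEq, Sum.elim_inl, Sum.elim_inr, id,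
        reduceCtorEq] <;> grind

/-- Induction on length: a slanting strand has, possibly after moving to another strand, a free
column beside it into which it can be shifted. If no strand slants, the element is a partial
identity. -/
theorem mem_of_hookFree {U : Subsemigroup (motzkinMonoid n)} (h1 : 1 ∈ U)
    (hU : ∀ α : motzkinMonoid n, α.1.rank + 1 = n → α ∈ U) (hα : HookFree α) : α ∈ U := by
  induction hm : length α using Nat.strong_induction_on generalizing α U with
  | _ m ih =>
    subst hm
    -- Stated for all `U` and `γ` so that strands slanting the other way are covered by `star`.
    have step : ∀ {U : Subsemigroup (motzkinMonoid n)} {γ : motzkinMonoid n}, 1 ∈ U →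
        (∀ α : motzkinMonoid n, α.1.rank + 1 = n → α ∈ U) → HookFree γ →
        length γ = length α → ∀ x y : Fin n, γ.1.Rel (Sum.inl x) (Sum.inr y) → y < x → γ ∈ U := by
      intro U γ h1 hU hγ hl x y h hyx
      induction x using WellFoundedLT.induction generalizing y with
      | ind x ihx =>
        let i : Fin n := ⟨x - 1, by omega⟩
        have hix : (x : ℕ) = i + 1 := by
          change (x : ℕ) = x - 1 + 1
          omega
        by_cases hi : ∃ z, γ.1.Rel (Sum.inl i) (Sum.inr z)
        · obtain ⟨z, hz⟩ := hi
          -- If column `x - 1` carries a strand, that strand ends at `z < y ≤ x - 1`, so it slants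
          -- in the same direction and starts further left.
          have hlt : i < x := by omega
          have := rel_mono hz h hlt
          exact ihx i hlt z hz (by omega)
        · have hs : γ.1.Single (Sum.inl i) := by
            rintro (v | v) hv
            · rw [hγ.1 _ _ hv]
            · exact absurd ⟨v, hv⟩ hi
          obtain ⟨γ', h2, h3, h4⟩ := exists_shift_mul hix hs h (by simp)
            (by simp only [Sum.elim_inr]; omega)
          rw [h2]
          refine U.mul_mem (hU _ (shift_missing _ _).rank) (ih _ (hl ▸ h3) h1 hU ?_ rfl)
          constructor
          · intro a b hab
            rw [h4, swap_inl, swap_inl] at hab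
            exact (Equiv.swap i x).injective (hγ.1 _ _ hab)
          · intro a b hab
            rw [h4, swap_inr, swap_inr] at hab
            exact hγ.2 _ _ hab
    by_cases hx : ∃ x y : Fin n, α.1.Rel (Sum.inl x) (Sum.inr y) ∧ y ≠ x
    · obtain ⟨x, y, h, hne⟩ := hx
      rcases lt_or_gt_of_ne hne with hlt | hlt
      · exact step h1 hU hα rfl x y h hlt
      · rw [← star_mem_starSubsemigroup]
        refine step (star_mem_starSubsemigroup.1 ?_) (fun β hβ => hU _ (by rwa [rank_star])) hα.star
          (length_star α) y x (Rel.symm h) hlt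
        rwa [star_one, mem_starSubsemigroup, mem_starSubsemigroup, star_star]
    · push Not at hx
      classical
      obtain ⟨β, hβ, h⟩ := exists_partial_identity h1 hU
        (Finset.univ.filter fun x => ¬ α.1.Rel (Sum.inl x) (Sum.inr x))
      have : α = β := by
        refine ext_rel ?_
        have hthru : ∀ u v : Fin n, α.1.Rel (Sum.inl u) (Sum.inr v) ↔
            u = v ∧ α.1.Rel (Sum.inl u) (Sum.inr u) := by
          intro u v
          constructor
          · intro h
            obtain rfl := hx _ _ h
            exact ⟨rfl, h⟩
          · rintro ⟨rfl, h⟩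
            exact h
        rintro (u | u) (v | v)
        · rw [h]
          refine ⟨fun h => Or.inl (congrArg _ (hα.1 _ _ h)), ?_⟩
          rintro (h | ⟨h, -⟩)
          · rw [h]; exact rel_refl _ _
          · obtain rfl : u = v := h
            exact rel_refl _ _
        · rw [h, hthru]
          simp
        · rw [h, rel_comm, hthru]
          simp only [reduceCtorEq, Sum.elim_inl, Sum.elim_inr, id, Finset.mem_filter,
            Finset.mem_univ, true_and, not_not, false_or]
          constructor <;> rintro ⟨rfl, h⟩ <;> exact ⟨rfl, h⟩
        · rw [h]
          refine ⟨fun h => Or.inl (congrArg _ (hα.2 _ _ h)), ?_⟩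
          rintro (h | ⟨h, -⟩)
          · rw [h]; exact rel_refl _ _
          · obtain rfl : u = v := h
            exact rel_refl _ _
      rwa [this]

/-! ### Removing hooks and generating the whole monoid -/

/-- A product decomposition that removes an adjacent upper hook. -/
theorem eq_hook_mul {i j : Fin n} (hij : (j : ℕ) = i + 1)
    (h : α.1.Rel (Sum.inl i) (Sum.inl j)) :
    α = hook i j hij * restrict α {Sum.inl i, Sum.inl j}ᶜ := by
  have hne : (Sum.inl i : Fin n ⊕ Fin n) ≠ Sum.inl j := by
    intro h
    have := Sum.inl_injective h
    subst this
    omega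
  refine ext_rel fun u v => ?_
  rw [hook_mul_rel, restrict_rel]
  simp only [Set.mem_compl_iff, Set.mem_insert_iff, Set.mem_singleton_iff, not_or, ← ne_eq]
  constructor
  · intro huv
    by_cases he : u = v
    · exact Or.inl he
    by_cases hu : u = Sum.inl i ∨ u = Sum.inl j
    · refine Or.inr (Or.inl ⟨hu, ?_⟩)
      rcases hu with rfl | rfl
      · exact Or.inr (eq_of_rel huv h (Ne.symm he) hne.symm)
      · exact Or.inl (eq_of_rel huv h.symm (Ne.symm he) hne)
    by_cases hv : v = Sum.inl i ∨ v = Sum.inl j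
    · refine absurd ?_ hu
      rcases hv with rfl | rfl
      · exact Or.inr (eq_of_rel huv.symm h he hne.symm)
      · exact Or.inl (eq_of_rel huv.symm h.symm he hne)
    · rw [not_or] at hu hv
      exact Or.inr (Or.inr ⟨hu, hv, Or.inr ⟨hu, hv, huv⟩⟩)
  · rintro (rfl | ⟨rfl | rfl, rfl | rfl⟩ | ⟨-, -, rfl | ⟨-, -, h⟩⟩)
    exacts [rel_refl _ _, rel_refl _ _, h, h.symm, rel_refl _ _, rel_refl _ _, h]

theorem length_restrict_lt {u v : Fin n ⊕ Fin n} (h : α.1.Rel u v) (huv : gap u v ≠ 0)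
    {S : Set (Fin n ⊕ Fin n)} (hu : u ∉ S) : length (restrict α S) < length α := by
  have hne : u ≠ v := by
    rintro rfl
    simp [gap] at huv
  refine length_lt 1 (fun p q => ?_) ⟨u, v, ?_⟩
  · unfold weight
    split_ifs with h1 h2 h2
    · exact le_rfl
    · refine absurd ?_ h2
      rcases restrict_rel.1 h1 with rfl | ⟨-, -, h⟩
      exacts [rel_refl _ _, h]
    · exact Nat.zero_le _
    · exact le_rfl
  · unfold weight
    rw [Equiv.Perm.one_apply, Equiv.Perm.one_apply, if_pos h, if_neg]
    · exact Nat.pos_of_ne_zero huv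
    · rw [restrict_rel]
      rintro (h | ⟨h, -⟩)
      exacts [hne h, hu h]

/-- An inner point of a shortest upper hook is a singleton. -/
theorem single_of_shortest_hook {x y i : Fin n} (h : α.1.Rel (Sum.inl x) (Sum.inl y))
    (hxi : x < i) (hiy : i < y)
    (hmin : ∀ x' y' : Fin n, x' < y' → (y' : ℕ) - x' < y - x →
      ¬ α.1.Rel (Sum.inl x') (Sum.inl y')) : α.1.Single (Sum.inl i) := by
  intro v hv
  have hp := (isPlanar_iff α.1).1 α.2.2
  have hix : ¬ α.1.Rel (Sum.inl x) (Sum.inl i) := hmin x i hxi (by omega)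
  rcases v with z | z
  · by_contra hne
    have hne : z ≠ i := fun h => hne (congrArg _ h)
    -- A partner outside the hook would cross it, and a partner inside would form a shorter hook.
    rcases lt_trichotomy z x with hz | rfl | hz
    · have := hp (Sum.inl z) (Sum.inl i) (Sum.inl x) (Sum.inl y) hv.symm h
        (by simp only [position_inl]; omega) (by simp only [position_inl]; omega)
        (by simp only [position_inl]; omega)
      exact hix (this.symm.trans hv.symm)
    · exact hix hv.symm
    · rcases lt_trichotomy z y with hz' | rfl | hz'
      · rcases lt_or_gt_of_ne hne with h' | h'
        · exact hmin z i h' (by omega) hv.symm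
        · exact hmin i z h' (by omega) hv
      · exact hix (h.trans hv.symm)
      · exact hix (hp (Sum.inl x) (Sum.inl y) (Sum.inl i) (Sum.inl z) h hv
          (by simp only [position_inl]; omega) (by simp only [position_inl]; omega)
          (by simp only [position_inl]; omega))
  · have := hp (Sum.inr z) (Sum.inl i) (Sum.inl x) (Sum.inl y) hv.symm h
      (by simp only [position_inl, position_inr]; omega) (by simp only [position_inl]; omega)
      (by simp only [position_inl]; omega)
    exact absurd (this.symm.trans hv.symm) hix

/-- Induction on length. A shortest upper hook is either adjacent, and splits off, or has a
singleton next to its right end and can be shortened by a shift. Lower hooks are handled by `star`.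
-/
theorem mem_of_generators {U : Subsemigroup (motzkinMonoid n)} (h1 : 1 ∈ U)
    (hU : ∀ α : motzkinMonoid n, α.1.rank + 1 = n → α ∈ U)
    (hhook : ∀ i j hij, hook (n := n) i j hij ∈ U)
    (hhook' : ∀ i j hij, star (hook (n := n) i j hij) ∈ U) (α : motzkinMonoid n) : α ∈ U := by
  induction hm : length α using Nat.strong_induction_on generalizing α U with
  | _ m ih =>
    subst hm
    have step : ∀ {U : Subsemigroup (motzkinMonoid n)} {γ : motzkinMonoid n}, 1 ∈ U →
        (∀ α : motzkinMonoid n, α.1.rank + 1 = n → α ∈ U) →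
        (∀ i j hij, hook (n := n) i j hij ∈ U) → (∀ i j hij, star (hook (n := n) i j hij) ∈ U) →
        length γ = length α →
        (∃ x y : Fin n, x ≠ y ∧ γ.1.Rel (Sum.inl x) (Sum.inl y)) → γ ∈ U := by
      intro U γ h1 hU hh hh' hl hex
      have hex' : ∃ d, ∃ x y : Fin n, x < y ∧ (y : ℕ) - x = d ∧
          γ.1.Rel (Sum.inl x) (Sum.inl y) := by
        obtain ⟨x, y, hne, h⟩ := hex
        rcases lt_or_gt_of_ne hne with hlt | hlt
        exacts [⟨_, x, y, hlt, rfl, h⟩, ⟨_, y, x, hlt, rfl, h.symm⟩]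
      classical
      obtain ⟨x, y, hxy, hd, h⟩ := Nat.find_spec hex'
      have hmin : ∀ x' y' : Fin n, x' < y' → (y' : ℕ) - x' < y - x →
          ¬ γ.1.Rel (Sum.inl x') (Sum.inl y') := by
        intro x' y' h1 h2 h3
        exact Nat.find_min hex' (hd ▸ h2) ⟨x', y', h1, rfl, h3⟩
      by_cases hadj : (y : ℕ) = x + 1
      · rw [eq_hook_mul hadj h]
        refine U.mul_mem (hh _ _ _) (ih _ (hl ▸ ?_) h1 hU hh hh' _ rfl)
        refine length_restrict_lt h ?_ (by simp)
        simp only [gap, Sum.elim_inl]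
        omega
      -- As the hook is not adjacent, this point lies strictly inside it and is therefore a
      -- singleton.
      · let i : Fin n := ⟨y - 1, by omega⟩
        have hiy : (y : ℕ) = i + 1 := by
          change (y : ℕ) = y - 1 + 1
          omega
        have hs := single_of_shortest_hook (i := i) h (by omega) (by omega) hmin
        obtain ⟨γ', h2, h3, -⟩ := exists_shift_mul hiy hs h.symm (by simpa using hxy.ne)
          (by simp only [Sum.elim_inl]; omega)
        rw [h2]
        exact U.mul_mem (hU _ (shift_missing _ _).rank) (ih _ (hl ▸ h3) h1 hU hh hh' _ rfl)
    by_cases hα : HookFree α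
    · exact mem_of_hookFree h1 hU hα
    · rw [HookFree, not_and_or] at hα
      push Not at hα
      rcases hα with ⟨x, y, h, hne⟩ | ⟨x, y, h, hne⟩
      · exact step h1 hU hhook hhook' rfl ⟨x, y, hne, h⟩
      · rw [← star_mem_starSubsemigroup]
        refine step ?_ (fun β hβ => hU _ (by rwa [rank_star])) hhook' (fun i j hij => ?_)
          (length_star α) ⟨x, y, hne, h⟩
        · rwa [mem_starSubsemigroup, star_one]
        · rw [star_mem_starSubsemigroup]
          exact hhook i j hij

end Motzkin

/-! ### Maximal subsemigroups -/

namespace Motzkin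

open DiagramPartition

variable {n : ℕ} {α β : motzkinMonoid n}

/-- Multiply shifts that move the free column one step at a time from `i` to `j`. -/
theorem exists_of_missing (i j : Fin n) : ∃ α : motzkinMonoid n, Missing α i j := by
  have key : ∀ d : ℕ, ∀ i j : Fin n, (j : ℕ) = i + d → ∃ α : motzkinMonoid n, Missing α i j := by
    intro d
    induction d with
    | zero =>
      intro i j h
      exact ⟨_, shift_missing (by omega) (by omega)⟩
    | succ d ih =>
      intro i j h
      obtain ⟨α, hα⟩ := ih i ⟨i + d, by omega⟩ rfl
      exact ⟨_, hα.mul (shift_missing (j := j) (by simp only; omega) (by simp only; omega))⟩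
  rcases le_total i j with h | h
  · exact key (j - i) i j (by omega)
  · obtain ⟨α, hα⟩ := key (i - j) j i (by omega)
    exact ⟨star α, hα.star⟩

theorem rank_add_two_le {i j : Fin n} (h : α.1.Rel (Sum.inl i) (Sum.inl j)) (hij : i ≠ j) :
    α.1.rank + 2 ≤ n := by
  have h1 := rank_add_ncard α
  have h2 : ({i, j} : Set (Fin n)).ncard ≤
      {x : Fin n | ¬ ∃ y, α.1.Rel (Sum.inl x) (Sum.inr y)}.ncard := by
    refine Set.ncard_le_ncard ?_ (Set.toFinite _)
    rintro x (rfl | rfl) ⟨y, hy⟩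
    exacts [not_through_of_hook h hij hy, not_through_of_hook h.symm hij.symm hy]
  rw [Set.ncard_pair hij] at h2
  omega

/-- In rank `n - 2` exactly two upper points are off the strands, and the hook uses both. -/
theorem through_iff {i j : Fin n} (hr : α.1.rank + 2 = n)
    (h : α.1.Rel (Sum.inl i) (Sum.inl j)) (hij : i ≠ j) (x : Fin n) :
    (∃ y, α.1.Rel (Sum.inl x) (Sum.inr y)) ↔ x ≠ i ∧ x ≠ j := by
  have h1 := rank_add_ncard α
  have h2 : ({i, j} : Set (Fin n)) = {x : Fin n | ¬ ∃ y, α.1.Rel (Sum.inl x) (Sum.inr y)} := by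
    refine Set.eq_of_subset_of_ncard_le ?_ (by rw [Set.ncard_pair hij]; omega) (Set.toFinite _)
    rintro x (rfl | rfl) ⟨y, hy⟩
    exacts [not_through_of_hook h hij hy, not_through_of_hook h.symm hij.symm hy]
  have h3 := Set.ext_iff.1 h2 x
  simp only [Set.mem_insert_iff, Set.mem_singleton_iff, Set.mem_ofPred_eq] at h3
  rw [← not_iff_not, ← h3, ← not_or, not_not]

theorem fin_ne {i j : Fin n} (hij : (j : ℕ) = i + 1) : i ≠ j := by
  rintro rfl
  omega

theorem hook_rel {i j : Fin n} (hij : (j : ℕ) = i + 1) :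
    (hook i j hij).1.Rel (Sum.inl i) (Sum.inl j) :=
  hookDiagram_upper.2 (Or.inr ⟨Or.inl rfl, Or.inr rfl⟩)

theorem rank_hook {i j : Fin n} (hij : (j : ℕ) = i + 1) : (hook i j hij).1.rank + 2 = n := by
  have h1 := rank_add_ncard (hook i j hij)
  have h2 : {x : Fin n | ¬ ∃ y, (hook i j hij).1.Rel (Sum.inl x) (Sum.inr y)} = {i, j} := by
    ext x
    have : (∃ y, (hook i j hij).1.Rel (Sum.inl x) (Sum.inr y)) ↔ x ≠ i ∧ x ≠ j :=
      ⟨fun ⟨y, h⟩ => (hookDiagram_through.1 h).2,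
        fun h => ⟨x, hookDiagram_through.2 ⟨rfl, h⟩⟩⟩
    simp only [Set.mem_ofPred_eq, this, Set.mem_insert_iff, Set.mem_singleton_iff]
    tauto
  rwa [h2, Set.ncard_pair (fin_ne hij)] at h1

/-! #### Membership -/

/-- An element of rank `n - 1` has one upper and one lower singleton, so in these coordinates the
omitted elements form the rectangle `Aᶜ × A`. -/
theorem notMem_rectangle {A : Set (Fin n)} (hn : 2 ≤ n) :
    α ∉ rectangle A ↔ ∃ i j, Missing α i j ∧ i ∉ A ∧ j ∈ A := by
  have hrank : α ∈ rankSet n (n - 1) ↔ α.1.rank + 1 = n := by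
    change α.1.rank = n - 1 ↔ _
    omega
  have hmem : α ∈ rectangle A ↔ α.1.rank + 1 ≠ n ∨ (α.1.rank + 1 = n ∧
      ((∃ i ∈ A, α.1.Single (Sum.inl i)) ∨ ∃ i, i ∉ A ∧ α.1.Single (Sum.inr i))) := by
    have hw : ∀ u, α ∈ withBlock {u} ↔ α.1.Single u := fun u => singleton_mem_blocks
    simp only [rectangle, Set.mem_union, Set.mem_compl_iff, Set.mem_iUnion, Set.mem_inter_iff,
      hrank, hw, exists_prop, and_left_comm (b := α.1.rank + 1 = n), exists_and_left, and_or_left,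
      ne_eq]
  rw [hmem]
  constructor
  · intro h
    have hr : α.1.rank + 1 = n := by tauto
    obtain ⟨i, j, hm⟩ := exists_missing hr
    refine ⟨i, j, hm, fun hi => h (Or.inr ⟨hr, Or.inl ⟨i, hi, hm.single⟩⟩), ?_⟩
    by_contra hj
    exact h (Or.inr ⟨hr, Or.inr ⟨j, hj, hm.single_lower⟩⟩)
  · rintro ⟨i, j, hm, hi, hj⟩ (h | ⟨-, ⟨k, hk, hs⟩ | ⟨k, hk, hs⟩⟩)
    · exact h hm.rank
    · exact hi (hm.single_iff.1 hs ▸ hk)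
    · exact hk (hm.single_lower_iff.1 hs ▸ hj)

theorem mem_rectangle_of_missing {A : Set (Fin n)} (hn : 2 ≤ n) {i j : Fin n}
    (h : Missing α i j) : α ∈ rectangle A ↔ i ∈ A ∨ j ∉ A := by
  rw [← not_iff_not, notMem_rectangle hn]
  constructor
  · rintro ⟨k, l, h', hk, hl⟩ h0
    obtain ⟨rfl, rfl⟩ := h.unique h'
    tauto
  · intro h0
    exact ⟨i, j, h, by tauto, by tauto⟩

theorem notMem_removeUpper (hn : 2 ≤ n) {i j : Fin n} (hij : (j : ℕ) = i + 1) :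
    α ∉ removeUpper i j ↔ α.1.rank + 2 = n ∧ α.1.Rel (Sum.inl i) (Sum.inl j) := by
  have hne : (Sum.inl i : Fin n ⊕ Fin n) ≠ Sum.inl j := by simpa using fin_ne hij
  rw [removeUpper, Set.notMem_compl_iff]
  change (α.1.rank = n - 2 ∧ {Sum.inl i, Sum.inl j} ∈ α.1.blocks) ↔ _
  rw [pair_mem_blocks α.2.1 hne]
  refine and_congr_left fun _ => ?_
  omega

theorem mem_removeLower (hn : 2 ≤ n) {i j : Fin n} (hij : (j : ℕ) = i + 1) :
    α ∈ removeLower i j ↔ star α ∈ removeUpper i j := by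
  have hne : (Sum.inr i : Fin n ⊕ Fin n) ≠ Sum.inr j := by simpa using fin_ne hij
  rw [← not_iff_not, notMem_removeUpper hn hij, removeLower, Set.notMem_compl_iff, rank_star,
    star_rel]
  change (α.1.rank = n - 2 ∧ {Sum.inr i, Sum.inr j} ∈ α.1.blocks) ↔ _
  rw [pair_mem_blocks α.2.1 hne]
  refine and_congr_left fun _ => ?_
  omega

theorem notMem_removeLower (hn : 2 ≤ n) {i j : Fin n} (hij : (j : ℕ) = i + 1) :
    α ∉ removeLower i j ↔ α.1.rank + 2 = n ∧ α.1.Rel (Sum.inr i) (Sum.inr j) := by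
  rw [mem_removeLower hn hij, notMem_removeUpper hn hij, rank_star]
  rfl

/-! #### Closure under products -/

theorem mul_ne_one (hα : α ≠ 1) : α * β ≠ 1 := by
  intro h
  have h1 := rank_mul_le_left α β
  rw [h, rank_one] at h1
  exact hα (eq_one_of_rank (le_antisymm (rank_le _) h1))

/-- If a product is an omitted e_il, neither factor is the identity, so the factors are e_ij and
e_kl. Being kept, they have `j ∉ A` and `k ∈ A`; but then `j ≠ k` and the rank of the product drops.
-/
theorem rectangle_mul_mem (hn : 2 ≤ n) {A : Set (Fin n)} (hα : α ∈ rectangle A)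
    (hβ : β ∈ rectangle A) : α * β ∈ rectangle A := by
  by_contra hαβ
  obtain ⟨i, l, hm, hi, hl⟩ := (notMem_rectangle hn).1 hαβ
  have r1 := rank_mul_le_left α β
  have r2 := rank_mul_le_right α β
  have r3 := rank_le α
  have r4 := rank_le β
  have r5 := hm.rank
  have ha : α.1.rank ≠ n := fun h => by
    rw [eq_one_of_rank h, one_mul] at hαβ
    exact hαβ hβ
  have hb : β.1.rank ≠ n := fun h => by
    rw [eq_one_of_rank h, mul_one] at hαβ
    exact hαβ hα
  obtain ⟨i', j, hm1⟩ := exists_missing (show α.1.rank + 1 = n by omega)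
  obtain ⟨k, l', hm2⟩ := exists_missing (show β.1.rank + 1 = n by omega)
  obtain rfl : i' = i := hm.single_iff.1 (single_mul_upper hm1.single)
  obtain rfl : l' = l := hm.single_lower_iff.1 (single_mul_lower hm2.single_lower)
  have hj : j ∉ A := ((mem_rectangle_of_missing hn hm1).1 hα).resolve_left hi
  have hk : k ∈ A := ((mem_rectangle_of_missing hn hm2).1 hβ).resolve_right (not_not.2 hl)
  -- Hence `k'` ends a strand of `α`, which dies at the singleton `k` of `β` and produces a second
  -- upper singleton of the product.
  have hkj : k ≠ j := fun h => hj (h ▸ hk)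
  obtain ⟨x, hx⟩ := (hm1.2 k).2 hkj
  have hxs : (α * β).1.Single (Sum.inl x) := single_mul_of_rel α.2.1 hx hm2.single
  exact (hm1.1 x).1 ⟨k, hx⟩ (hm.single_iff.1 hxs)

/-- If the block `{i, j}` of an omitted product is not inherited from `α`, then strands of `α` start
at `i` and `j`, and also at all other points by rank. So `α` is the identity and the product is `β`.
-/
theorem removeUpper_mul_mem (hn : 2 ≤ n) {i j : Fin n} (hij : (j : ℕ) = i + 1)
    (hα : α ∈ removeUpper i j) (hβ : β ∈ removeUpper i j) : α * β ∈ removeUpper i j := by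
  by_contra hαβ
  obtain ⟨hr, hrel⟩ := (notMem_removeUpper hn hij).1 hαβ
  have r1 := rank_mul_le_left α β
  have hne := fin_ne hij
  by_cases h : α.1.Rel (Sum.inl i) (Sum.inl j)
  · have := rank_add_two_le h hne
    exact (notMem_removeUpper hn hij).2 ⟨by omega, h⟩ hα
  have key : ∀ a b : Fin n, a ≠ b → (α * β).1.Rel (Sum.inl a) (Sum.inl b) →
      ¬ α.1.Rel (Sum.inl a) (Sum.inl b) → ∃ y, α.1.Rel (Sum.inl a) (Sum.inr y) := by
    intro a b hab hrel h
    have hns : ¬ α.1.Single (Sum.inl a) := fun hs =>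
      hab (Sum.inl_injective (single_mul_upper hs _ hrel)).symm
    rw [Single] at hns
    push Not at hns
    obtain ⟨v | v, hv, hva⟩ := hns
    -- An upper partner of `a` in `α` remains its partner in the product, so it would have to be
    -- `b`.
    · have hv' : (α * β).1.Rel (Sum.inl a) (Sum.inl v) := rel_mul_upper hv
      have := eq_of_rel hrel hv' (by simpa using hab.symm) hva
      exact absurd (this ▸ hv) h
    · exact ⟨v, hv⟩
  have hall : ∀ x, ∃ y, α.1.Rel (Sum.inl x) (Sum.inr y) := by
    intro x
    by_cases hxi : x = i
    · subst hxi
      exact key _ _ hne hrel h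
    by_cases hxj : x = j
    · subst hxj
      exact key _ _ hne.symm hrel.symm fun h' => h h'.symm
    obtain ⟨y, hy⟩ := (through_iff hr hrel hne x).2 ⟨hxi, hxj⟩
    exact exists_rel_of_mul_rel hy
  have hone : α = 1 := by
    refine eq_one_of_rank ?_
    have h1 := rank_add_ncard α
    rwa [(Set.ncard_eq_zero (Set.toFinite _)).2, add_zero] at h1
    exact Set.eq_empty_of_forall_notMem fun x hx => hx (hall x)
  rw [hone, one_mul] at hαβ
  exact hαβ hβ

theorem removeLower_mul_mem (hn : 2 ≤ n) {i j : Fin n} (hij : (j : ℕ) = i + 1)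
    (hα : α ∈ removeLower i j) (hβ : β ∈ removeLower i j) : α * β ∈ removeLower i j := by
  rw [mem_removeLower hn hij] at *
  rw [star_mul]
  exact removeUpper_mul_mem hn hij hβ hα

/-! #### The classification -/

/-- The list of maximal subsemigroups of the Motzkin monoid. -/
def IsListed (T : Set (motzkinMonoid n)) : Prop :=
  T = {1}ᶜ ∨
    (∃ A : Set (Fin n), A.Nonempty ∧ A ≠ Set.univ ∧ T = rectangle A) ∨
    (∃ i j : Fin n, (j : ℕ) = i + 1 ∧ T = removeUpper i j) ∨
    (∃ i j : Fin n, (j : ℕ) = i + 1 ∧ T = removeLower i j)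

theorem IsListed.exists_subsemigroup (hn : 2 ≤ n) {T : Set (motzkinMonoid n)} (h : IsListed T) :
    ∃ M : Subsemigroup (motzkinMonoid n), (M : Set (motzkinMonoid n)) = T := by
  rcases h with rfl | ⟨A, -, -, rfl⟩ | ⟨i, j, hij, rfl⟩ | ⟨i, j, hij, rfl⟩
  · exact ⟨⟨{1}ᶜ, fun ha _ => mul_ne_one ha⟩, rfl⟩
  · exact ⟨⟨_, rectangle_mul_mem hn⟩, rfl⟩
  · exact ⟨⟨_, removeUpper_mul_mem hn hij⟩, rfl⟩
  · exact ⟨⟨_, removeLower_mul_mem hn hij⟩, rfl⟩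

/-! ### The listed sets are proper and pairwise incomparable -/

theorem hook_notMem_removeUpper (hn : 2 ≤ n) {i j : Fin n} (hij : (j : ℕ) = i + 1) :
    hook i j hij ∉ removeUpper i j := (notMem_removeUpper hn hij).2 ⟨rank_hook hij, hook_rel hij⟩

theorem star_hook_notMem_removeLower (hn : 2 ≤ n) {i j : Fin n} (hij : (j : ℕ) = i + 1) :
    star (hook i j hij) ∉ removeLower i j := by
  rw [mem_removeLower hn hij, star_star]
  exact hook_notMem_removeUpper hn hij

theorem exists_pair {A : Set (Fin n)} (hA : A.Nonempty) (hA' : A ≠ Set.univ) :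
    ∃ i j, i ∉ A ∧ j ∈ A := by
  obtain ⟨i, hi⟩ := (Set.ne_univ_iff_exists_notMem _).1 hA'
  exact ⟨i, hA.choose, hi, hA.choose_spec⟩

theorem IsListed.ne_univ (hn : 2 ≤ n) {T : Set (motzkinMonoid n)} (h : IsListed T) :
    T ≠ Set.univ := by
  rw [Set.ne_univ_iff_exists_notMem]
  rcases h with rfl | ⟨A, hA, hA', rfl⟩ | ⟨i, j, hij, rfl⟩ | ⟨i, j, hij, rfl⟩
  · exact ⟨1, fun h => h rfl⟩
  · obtain ⟨i, j, hi, hj⟩ := exists_pair hA hA'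
    obtain ⟨α, hα⟩ := exists_of_missing i j
    exact ⟨α, (notMem_rectangle hn).2 ⟨i, j, hα, hi, hj⟩⟩
  · exact ⟨_, hook_notMem_removeUpper hn hij⟩
  · exact ⟨_, star_hook_notMem_removeLower hn hij⟩

/-- Passing to omitted elements gives `Bᶜ × B ⊆ Aᶜ × A`. As both factors on the left are non-empty,
`Bᶜ ⊆ Aᶜ` and `B ⊆ A`. -/
theorem rectangle_injOn (hn : 2 ≤ n) {A B : Set (Fin n)} (hB : B.Nonempty) (hB' : B ≠ Set.univ)
    (h : rectangle A ⊆ rectangle B) : A = B := by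
  obtain ⟨i, j, hi, hj⟩ := exists_pair hB hB'
  have key : ∀ i j, i ∉ B → j ∈ B → i ∉ A ∧ j ∈ A := by
    intro i j hi hj
    obtain ⟨α, hα⟩ := exists_of_missing i j
    have h1 := mt (@h α) ((notMem_rectangle hn).2 ⟨i, j, hα, hi, hj⟩)
    obtain ⟨i', j', hα', hi', hj'⟩ := (notMem_rectangle hn).1 h1
    obtain ⟨rfl, rfl⟩ := hα.unique hα'
    exact ⟨hi', hj'⟩
  ext x
  constructor
  · intro hx
    by_contra hxB
    exact (key x j hxB hj).1 hx
  · exact fun hx => (key i x hi hx).2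

theorem removeUpper_injOn (hn : 2 ≤ n) {i j k l : Fin n} (hij : (j : ℕ) = i + 1)
    (hkl : (l : ℕ) = k + 1) (h : removeUpper i j ⊆ removeUpper k l) : i = k ∧ j = l := by
  have h1 := (notMem_removeUpper hn hij).1 (mt (@h _) (hook_notMem_removeUpper hn hkl))
  rcases hookDiagram_upper.1 h1.2 with h | ⟨h2, h3⟩
  · exact absurd h (fin_ne hij)
  · omega

theorem removeLower_injOn (hn : 2 ≤ n) {i j k l : Fin n} (hij : (j : ℕ) = i + 1)
    (hkl : (l : ℕ) = k + 1) (h : removeLower i j ⊆ removeLower k l) : i = k ∧ j = l := by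
  refine removeUpper_injOn hn hij hkl fun α hα => ?_
  rw [← star_star α, ← mem_removeLower hn hkl]
  refine h ?_
  rwa [mem_removeLower hn hij, star_star]

theorem not_removeLower_subset_removeUpper (hn : 2 ≤ n) {i j k l : Fin n}
    (hij : (j : ℕ) = i + 1) (hkl : (l : ℕ) = k + 1) : ¬ removeLower i j ⊆ removeUpper k l := by
  intro h
  have h1 := (notMem_removeLower hn hij).1 (mt (@h _) (hook_notMem_removeUpper hn hkl))
  exact fin_ne hij (hookDiagram_lower.1 h1.2)

theorem not_removeUpper_subset_removeLower (hn : 2 ≤ n) {i j k l : Fin n}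
    (hij : (j : ℕ) = i + 1) (hkl : (l : ℕ) = k + 1) : ¬ removeUpper i j ⊆ removeLower k l := by
  intro h
  have h1 := (notMem_removeUpper hn hij).1 (mt (@h _) (star_hook_notMem_removeLower hn hkl))
  exact fin_ne hij (hookDiagram_lower.1 h1.2)

theorem rank_of_notMem_rectangle (hn : 2 ≤ n) {A : Set (Fin n)} (h : α ∉ rectangle A) :
    α.1.rank + 1 = n := by
  obtain ⟨i, j, hα, -, -⟩ := (notMem_rectangle hn).1 h
  exact hα.rank

/-- The omitted elements have rank `n`, `n - 1` or `n - 2` according to the kind of set, so an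
element omitted by both sets rules out most mixed pairs. Upper and lower removals are told apart by
the adjacent hooks. -/
theorem IsListed.eq_of_subset (hn : 2 ≤ n) {T T' : Set (motzkinMonoid n)} (h : IsListed T)
    (h' : IsListed T') (hTT : T ⊆ T') : T = T' := by
  have r1 := rank_one (n := n)
  obtain ⟨γ, hγ'⟩ := (Set.ne_univ_iff_exists_notMem _).1 (h'.ne_univ hn)
  have hγ : γ ∉ T := mt (@hTT γ) hγ'
  have e0 : γ ∉ ({1}ᶜ : Set (motzkinMonoid n)) → γ.1.rank = n := by
    intro h
    rw [Set.notMem_compl_iff, Set.mem_singleton_iff] at h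
    rwa [h]
  have e1 : ∀ A, γ ∉ rectangle A → γ.1.rank + 1 = n := fun A => rank_of_notMem_rectangle hn
  have e2 : ∀ i j : Fin n, (j : ℕ) = i + 1 → γ ∉ removeUpper i j → γ.1.rank + 2 = n :=
    fun i j hij h => ((notMem_removeUpper hn hij).1 h).1
  have e3 : ∀ i j : Fin n, (j : ℕ) = i + 1 → γ ∉ removeLower i j → γ.1.rank + 2 = n :=
    fun i j hij h => ((notMem_removeLower hn hij).1 h).1
  rcases h with rfl | ⟨A, -, -, rfl⟩ | ⟨i, j, hij, rfl⟩ | ⟨i, j, hij, rfl⟩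
  · have := e0 hγ
    rcases h' with rfl | ⟨B, -, -, rfl⟩ | ⟨k, l, hkl, rfl⟩ | ⟨k, l, hkl, rfl⟩
    · rfl
    · have := e1 _ hγ'; omega
    · have := e2 _ _ hkl hγ'; omega
    · have := e3 _ _ hkl hγ'; omega
  · have := e1 _ hγ
    rcases h' with rfl | ⟨B, hB, hB', rfl⟩ | ⟨k, l, hkl, rfl⟩ | ⟨k, l, hkl, rfl⟩
    · have := e0 hγ'; omega
    · rw [rectangle_injOn hn hB hB' hTT]
    · have := e2 _ _ hkl hγ'; omega
    · have := e3 _ _ hkl hγ'; omega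
  · have := e2 _ _ hij hγ
    rcases h' with rfl | ⟨B, -, -, rfl⟩ | ⟨k, l, hkl, rfl⟩ | ⟨k, l, hkl, rfl⟩
    · have := e0 hγ'; omega
    · have := e1 _ hγ'; omega
    · obtain ⟨rfl, rfl⟩ := removeUpper_injOn hn hij hkl hTT
      rfl
    · exact absurd hTT (not_removeUpper_subset_removeLower hn hij hkl)
  · have := e3 _ _ hij hγ
    rcases h' with rfl | ⟨B, -, -, rfl⟩ | ⟨k, l, hkl, rfl⟩ | ⟨k, l, hkl, rfl⟩
    · have := e0 hγ'; omega
    · have := e1 _ hγ'; omega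
    · exact absurd hTT (not_removeLower_subset_removeUpper hn hij hkl)
    · obtain ⟨rfl, rfl⟩ := removeLower_injOn hn hij hkl hTT
      rfl

/-! ### Recovering adjacent hooks from elements of rank `n - 2` -/

/-- The through-strands of an element. -/
def strands (α : motzkinMonoid n) : motzkinMonoid n :=
  restrict α {u | ∃ x y, (u = Sum.inl x ∨ u = Sum.inr y) ∧ α.1.Rel (Sum.inl x) (Sum.inr y)}

theorem strands_through {x y : Fin n} :
    (strands α).1.Rel (Sum.inl x) (Sum.inr y) ↔ α.1.Rel (Sum.inl x) (Sum.inr y) := by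
  rw [strands, restrict_rel]
  constructor
  · rintro (h | ⟨-, -, h⟩)
    · cases h
    · exact h
  · intro h
    exact Or.inr ⟨⟨x, y, Or.inl rfl, h⟩, ⟨x, y, Or.inr rfl, h⟩, h⟩

theorem hookFree_strands (α : motzkinMonoid n) : HookFree (strands α) := by
  constructor
  · rintro x y (h | ⟨⟨a, b, h1 | h1, h2⟩, -, h⟩)
    · exact Sum.inl_injective h
    · obtain rfl := Sum.inl_injective h1
      by_contra hne
      exact not_through_of_hook h hne h2
    · cases h1
  · rintro x y (h | ⟨⟨a, b, h1 | h1, h2⟩, -, h⟩)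
    · exact Sum.inr_injective h
    · cases h1
    · obtain rfl := Sum.inr_injective h1
      by_contra hne
      exact not_through_of_hook_lower h hne h2

/-- Following the strands of `α` and then retracing them returns to the same column, for every
column except `i` and `j`. The upper hook of `α` appears at the bottom, and lower hooks of `α`
vanish because the first factor has only singletons opposite them. -/
theorem star_hook_eq {i j : Fin n} (hij : (j : ℕ) = i + 1) (hr : α.1.rank + 2 = n)
    (h : α.1.Rel (Sum.inl i) (Sum.inl j)) : star (hook i j hij) = strands α * star α := by
  have hne := fin_ne hij
  have ht := through_iff hr h hne
  refine ext_rel fun u v => ?_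
  refine Iff.trans ?_ (mul_rel_of_lower_single (hookFree_strands α).2 u v).symm
  rw [star_rel]
  have hlow : ∀ x y : Fin n, α.1.Rel (Sum.inl x) (Sum.inl y) ↔
      x = y ∨ ((x = i ∨ x = j) ∧ (y = i ∨ y = j)) := by
    intro x y
    constructor
    · intro hxy
      by_cases he : x = y
      · exact Or.inl he
      · have h1 : ¬ (x ≠ i ∧ x ≠ j) := fun h' => by
          obtain ⟨z, hz⟩ := (ht x).2 h'
          exact not_through_of_hook hxy he hz
        have h2 : ¬ (y ≠ i ∧ y ≠ j) := fun h' => by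
          obtain ⟨z, hz⟩ := (ht y).2 h'
          exact not_through_of_hook hxy.symm (Ne.symm he) hz
        tauto
    · rintro (rfl | ⟨rfl | rfl, rfl | rfl⟩)
      exacts [rel_refl _ _, rel_refl _ _, h, h.symm, rel_refl _ _]
  have hcross : ∀ x y : Fin n, (∃ m, α.1.Rel (Sum.inl x) (Sum.inr m) ∧
      α.1.Rel (Sum.inr m) (Sum.inl y)) ↔ x = y ∧ x ≠ i ∧ x ≠ j := by
    intro x y
    constructor
    · rintro ⟨m, h1, h2⟩
      obtain rfl : x = y := Sum.inl_injective (eq_of_rel h1.symm h2 (by simp) (by simp))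
      exact ⟨rfl, (ht x).1 ⟨m, h1⟩⟩
    · rintro ⟨rfl, h'⟩
      obtain ⟨m, hm⟩ := (ht x).2 h'
      exact ⟨m, hm, hm.symm⟩
  rcases u with x | x <;> rcases v with y | y
  · refine hookDiagram_lower.trans ?_
    constructor
    · rintro rfl
      exact Or.inl ⟨x, x, rfl, rfl, rel_refl _ _⟩
    · rintro (⟨_, _, -, -, h'⟩ | ⟨m | m, k | k, h1, h2, h3⟩)
      · exact (hookFree_strands α).1 _ _ h'
      · have h1 := strands_through.1 h1
        have h2 := strands_through.1 h2
        by_contra hxy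
        have h3 : α.1.Rel (Sum.inr m) (Sum.inr k) := h3
        have := eq_of_rel h1.symm (h3.trans h2.symm) (by simp) (by simp)
        exact hxy (Sum.inl_injective this)
      · exact h2.elim
      · exact h1.elim
      · exact h1.elim
  · refine rel_comm.trans (hookDiagram_through.trans ?_)
    rw [eq_comm, and_congr_right (b := y ≠ i ∧ y ≠ j) (c := x ≠ i ∧ x ≠ j) (by rintro rfl; rfl),
      ← hcross]
    constructor
    · rintro ⟨m, h1, h2⟩
      exact Or.inr ⟨Sum.inl m, Sum.inr y, strands_through.2 h1, rfl, h2⟩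
    · rintro (⟨_, _, -, h', -⟩ | ⟨m | m, k | k, h1, h2, h3⟩)
      · cases h'
      · exact h2.elim
      · obtain rfl : y = k := h2
        exact ⟨m, strands_through.1 h1, h3⟩
      · exact h1.elim
      · exact h1.elim
  · refine hookDiagram_through.trans ?_
    rw [eq_comm, and_congr_right (b := x ≠ i ∧ x ≠ j) (c := y ≠ i ∧ y ≠ j) (by rintro rfl; rfl),
      ← hcross]
    constructor
    · rintro ⟨m, h1, h2⟩
      exact Or.inr ⟨Sum.inr x, Sum.inl m, rfl, strands_through.2 h1, h2.symm⟩
    · rintro (⟨_, _, h', -, -⟩ | ⟨m | m, k | k, h1, h2, h3⟩)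
      · cases h'
      · exact h1.elim
      · exact h1.elim
      · obtain rfl : x = m := h1
        exact ⟨k, strands_through.1 h2, Rel.symm h3⟩
      · exact h2.elim
  · refine hookDiagram_upper.trans ((hlow x y).symm.trans ?_)
    constructor
    · intro h'
      exact Or.inr ⟨Sum.inr x, Sum.inr y, rfl, rfl, h'⟩
    · rintro (⟨_, _, h', -, -⟩ | ⟨m | m, k | k, h1, h2, h3⟩)
      · cases h'
      · exact h1.elim
      · exact h1.elim
      · exact h2.elim
      · obtain rfl : x = m := h1
        obtain rfl : y = k := h2
        exact h3

theorem hook_eq {i j : Fin n} (hij : (j : ℕ) = i + 1) (hr : α.1.rank + 2 = n)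
    (h : α.1.Rel (Sum.inl i) (Sum.inl j)) : hook i j hij = α * star (strands α) := by
  rw [← star_star (hook i j hij), star_hook_eq hij hr h, star_mul, star_star]

/-- Any element omitted by `removeUpper i j` yields the hook on right multiplication by a hook-free
element. -/
theorem hook_mem_of_not_subset (hn : 2 ≤ n) {U : Subsemigroup (motzkinMonoid n)} (h1 : 1 ∈ U)
    (hU : ∀ α : motzkinMonoid n, α.1.rank + 1 = n → α ∈ U) {i j : Fin n} (hij : (j : ℕ) = i + 1)
    (h : ¬ (U : Set (motzkinMonoid n)) ⊆ removeUpper i j) : hook i j hij ∈ U := by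
  obtain ⟨α, hα, hα'⟩ := Set.not_subset.1 h
  obtain ⟨hr, hrel⟩ := (notMem_removeUpper hn hij).1 hα'
  rw [hook_eq hij hr hrel]
  exact U.mul_mem hα (mem_of_hookFree h1 hU (hookFree_strands α).star)

/-! ### Every proper subsemigroup lies in a listed set -/

/-- A subsemigroup contained in none of the listed sets is the whole monoid. -/
theorem eq_top_of_not_subset (hn : 2 ≤ n) {U : Subsemigroup (motzkinMonoid n)}
    (h : ∀ T : Set (motzkinMonoid n), IsListed T → ¬ (U : Set (motzkinMonoid n)) ⊆ T) :
    U = ⊤ := by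
  have h1 : 1 ∈ U := by
    obtain ⟨α, hα, hα'⟩ := Set.not_subset.1 (h _ (Or.inl rfl))
    rw [Set.notMem_compl_iff, Set.mem_singleton_iff] at hα'
    rwa [← hα']
  have hne : ∀ i j : Fin n, i ≠ j → ∃ α ∈ U, Missing α i j := by
    intro i
    by_contra! hcon
    obtain ⟨j₀, hj₀, hj₀'⟩ := hcon
    -- The vertices not reached from `i`. It contains `j₀` but not `i`, so `U` has some e_kl leading
    -- into `A` from outside; then `l` is reached from `i` directly or through `k`, a contradiction.
    let A : Set (Fin n) := {j | j ≠ i ∧ ∀ α ∈ U, ¬ Missing α i j}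
    have hiA : i ∉ A := fun hi => hi.1 rfl
    obtain ⟨α, hα, hα'⟩ := Set.not_subset.1 (h _ (Or.inr (Or.inl ⟨A, ⟨j₀, hj₀.symm, hj₀'⟩,
      fun hA => hiA (hA ▸ Set.mem_univ _), rfl⟩)))
    obtain ⟨k, l, hm, hk, hl⟩ := (notMem_rectangle hn).1 hα'
    by_cases hki : k = i
    · subst hki
      exact hl.2 α hα hm
    · have : ∃ β ∈ U, Missing β i k := by
        by_contra! hno
        exact hk ⟨hki, hno⟩
      obtain ⟨β, hβ, hm'⟩ := this
      exact hl.2 _ (U.mul_mem hβ hα) (hm'.mul hm)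
  have hU : ∀ α : motzkinMonoid n, α.1.rank + 1 = n → α ∈ U := by
    intro α hα
    obtain ⟨i, j, hm⟩ := exists_missing hα
    have : ∃ β ∈ U, Missing β i j := by
      -- Diagonal elements come from going to another column and back, which needs `n ≥ 2`.
      by_cases hij : i = j
      · subst hij
        obtain ⟨k, hk⟩ : ∃ k : Fin n, i ≠ k := by
          have : Nontrivial (Fin n) := Fin.nontrivial_iff_two_le.2 hn
          exact (exists_ne i).imp fun _ => Ne.symm
        obtain ⟨β, hβ, h1⟩ := hne i k hk
        obtain ⟨γ, hγ, h2⟩ := hne k i hk.symm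
        exact ⟨_, U.mul_mem hβ hγ, h1.mul h2⟩
      · exact hne i j hij
    obtain ⟨β, hβ, hm'⟩ := this
    rwa [hm.eq hm']
  rw [Subsemigroup.eq_top_iff']
  refine mem_of_generators h1 hU ?_ ?_
  · intro i j hij
    exact hook_mem_of_not_subset hn h1 hU hij (h _ (Or.inr (Or.inr (Or.inl ⟨i, j, hij, rfl⟩))))
  · intro i j hij
    rw [← mem_starSubsemigroup]
    refine hook_mem_of_not_subset hn ?_ (fun β hβ =>
      mem_starSubsemigroup.2 (hU _ (by rwa [rank_star]))) hij fun hsub => ?_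
    · rwa [mem_starSubsemigroup, star_one]
    · refine h _ (Or.inr (Or.inr (Or.inr ⟨i, j, hij, rfl⟩))) fun α hα => ?_
      rw [mem_removeLower hn hij]
      exact hsub (star_mem_starSubsemigroup.2 hα)

/-- A family of pairwise incomparable proper subsemigroups that covers every proper subsemigroup is
the family of maximal ones. -/
theorem isMaximalSubsemigroup_iff (hn : 2 ≤ n) (T : Set (motzkinMonoid n)) :
    IsMaximalSubsemigroup T ↔ IsListed T := by
  have hcover : ∀ U : Subsemigroup (motzkinMonoid n), U ≠ ⊤ →
      ∃ T, IsListed T ∧ (U : Set (motzkinMonoid n)) ⊆ T := by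
    intro U hU
    by_contra! hcon
    exact hU (eq_top_of_not_subset hn hcon)
  constructor
  · rintro ⟨M, rfl, hM⟩
    obtain ⟨T, hT, hMT⟩ := hcover M hM.1
    obtain ⟨N, rfl⟩ := hT.exists_subsemigroup hn
    have hMN : M ≤ N := hMT
    rcases hMN.eq_or_lt with rfl | hlt
    · exact hT
    · exact absurd (congrArg SetLike.coe (hM.2 N hlt)) (hT.ne_univ hn)
  · intro hT
    obtain ⟨M, rfl⟩ := hT.exists_subsemigroup hn
    refine ⟨M, rfl, fun h => hT.ne_univ hn (h ▸ rfl), fun U hU => ?_⟩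
    by_contra hne
    obtain ⟨T', hT', hUT⟩ := hcover U hne
    have hMU : (M : Set (motzkinMonoid n)) ⊆ U := hU.le
    have := hT.eq_of_subset hn hT' (hMU.trans hUT)
    have hUM : U ≤ M := by
      intro x hx
      have := hUT hx
      rwa [← ‹(M : Set (motzkinMonoid n)) = T'›] at this
    exact hU.not_ge hUM

end Motzkin

/-! ### Green's classes -/

section Green

variable {S : Type*} [Monoid S]

theorem mem_principalIdeal {x y : S} : y ∈ principalIdeal x ↔ ∃ s t, y = s * x * t := by
  constructor
  · rintro (h | ⟨s, h⟩ | ⟨s, h⟩ | ⟨s, t, h⟩)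
    exacts [⟨1, 1, by simpa using h⟩, ⟨s, 1, by simpa using h⟩, ⟨1, s, by simpa using h⟩, ⟨s, t, h⟩]
  · exact fun h => Or.inr (Or.inr (Or.inr h))

theorem mem_principalRightIdeal {x y : S} : y ∈ principalRightIdeal x ↔ ∃ s, y = x * s := by
  constructor
  · rintro (h | h)
    exacts [⟨1, by simpa using h⟩, h]
  · exact fun h => Or.inr h

theorem mem_principalLeftIdeal {x y : S} : y ∈ principalLeftIdeal x ↔ ∃ s, y = s * x := by
  constructor
  · rintro (h | h)
    exacts [⟨1, by simpa using h⟩, h]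
  · exact fun h => Or.inr h

theorem principalIdeal_eq {x y s t s' t' : S} (h : x = s * y * t) (h' : y = s' * x * t') :
    principalIdeal x = principalIdeal y := by
  have key : ∀ {x y s t : S}, x = s * y * t → principalIdeal x ⊆ principalIdeal y := by
    intro x y s t h z hz
    obtain ⟨a, b, rfl⟩ := mem_principalIdeal.1 hz
    exact mem_principalIdeal.2 ⟨a * s, t * b, by rw [h]; simp only [mul_assoc]⟩
  exact (key h).antisymm (key h')

theorem exists_of_principalIdeal_eq {x y : S} (h : principalIdeal x = principalIdeal y) :
    ∃ s t, x = s * y * t := mem_principalIdeal.1 (h ▸ Or.inl rfl)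

theorem exists_of_principalRightIdeal_eq {x y : S}
    (h : principalRightIdeal x = principalRightIdeal y) : ∃ s, x = y * s :=
  mem_principalRightIdeal.1 (h ▸ Or.inl rfl)

theorem exists_of_principalLeftIdeal_eq {x y : S}
    (h : principalLeftIdeal x = principalLeftIdeal y) : ∃ s, x = s * y :=
  mem_principalLeftIdeal.1 (h ▸ Or.inl rfl)

theorem rClass_subset {J : Set S} (hJ : IsJClass J) {y : S} (hy : y ∈ J) :
    {z | principalRightIdeal z = principalRightIdeal y} ⊆ J := by
  obtain ⟨x, rfl⟩ := hJ
  intro z hz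
  obtain ⟨s, h⟩ := exists_of_principalRightIdeal_eq hz
  obtain ⟨t, h'⟩ := exists_of_principalRightIdeal_eq (Eq.symm hz)
  exact (principalIdeal_eq (s := 1) (s' := 1) (by rwa [one_mul]) (by rwa [one_mul])).trans hy

theorem lClass_subset {J : Set S} (hJ : IsJClass J) {y : S} (hy : y ∈ J) :
    {z | principalLeftIdeal z = principalLeftIdeal y} ⊆ J := by
  obtain ⟨x, rfl⟩ := hJ
  intro z hz
  obtain ⟨s, h⟩ := exists_of_principalLeftIdeal_eq hz
  obtain ⟨t, h'⟩ := exists_of_principalLeftIdeal_eq (Eq.symm hz)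
  exact (principalIdeal_eq (t := 1) (t' := 1) (by rwa [mul_one]) (by rwa [mul_one])).trans hy

/-- A subset of a `𝒥`-class that is closed under the `ℛ`-relation is a union of `ℛ`-classes. -/
theorem sUnion_rClasses {J : Set S} (hJ : IsJClass J) (V : Set S)
    (hV : ∀ y z s t, y ∈ J → z ∈ J → y ∈ V → z = y * s → y = z * t → z ∈ V) :
    ⋃₀ {R | (IsRClass R ∧ R ⊆ J) ∧ R ⊆ V} = J ∩ V := by
  ext y
  constructor
  · rintro ⟨R, ⟨⟨-, h1⟩, h2⟩, hy⟩
    exact ⟨h1 hy, h2 hy⟩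
  · rintro ⟨hy, hyV⟩
    refine ⟨{z | principalRightIdeal z = principalRightIdeal y},
      ⟨⟨⟨y, rfl⟩, rClass_subset hJ hy⟩, fun z hz => ?_⟩, rfl⟩
    obtain ⟨s, h⟩ := exists_of_principalRightIdeal_eq hz
    obtain ⟨t, h'⟩ := exists_of_principalRightIdeal_eq (Eq.symm hz)
    exact hV y z s t hy (rClass_subset hJ hy hz) hyV h h'

/-- A subset of a `𝒥`-class that is closed under the `ℒ`-relation is a union of `ℒ`-classes. -/
theorem sUnion_lClasses {J : Set S} (hJ : IsJClass J) (V : Set S)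
    (hV : ∀ y z s t, y ∈ J → z ∈ J → y ∈ V → z = s * y → y = t * z → z ∈ V) :
    ⋃₀ {L | (IsLClass L ∧ L ⊆ J) ∧ L ⊆ V} = J ∩ V := by
  ext y
  constructor
  · rintro ⟨R, ⟨⟨-, h1⟩, h2⟩, hy⟩
    exact ⟨h1 hy, h2 hy⟩
  · rintro ⟨hy, hyV⟩
    refine ⟨{z | principalLeftIdeal z = principalLeftIdeal y},
      ⟨⟨⟨y, rfl⟩, lClass_subset hJ hy⟩, fun z hz => ?_⟩, rfl⟩
    obtain ⟨s, h⟩ := exists_of_principalLeftIdeal_eq hz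
    obtain ⟨t, h'⟩ := exists_of_principalLeftIdeal_eq (Eq.symm hz)
    exact hV y z s t hy (lClass_subset hJ hy hz) hyV h h'

end Green

/-! ### Types of the listed subsemigroups -/

namespace Motzkin

open DiagramPartition

variable {n : ℕ} {α β : motzkinMonoid n}

theorem rank_eq_of_principalIdeal_eq (h : principalIdeal α = principalIdeal β) :
    α.1.rank = β.1.rank := by
  have key : ∀ {α β : motzkinMonoid n}, principalIdeal α = principalIdeal β →
      α.1.rank ≤ β.1.rank := by
    intro α β h
    obtain ⟨s, t, rfl⟩ := exists_of_principalIdeal_eq h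
    exact (rank_mul_le_left _ _).trans (rank_mul_le_right _ _)
  exact (key h).antisymm (key h.symm)

theorem isRemoveJType : IsRemoveJType ({1}ᶜ : Set (motzkinMonoid n)) := by
  refine ⟨{y | principalIdeal y = principalIdeal 1},
    ⟨⟨1, rfl⟩, ⟨1, rfl, 1, by rw [one_mul, one_mul]⟩, ?_⟩, ?_⟩
  · intro y hy
    rw [compl_compl, Set.mem_singleton_iff] at hy
    rw [hy]
    rfl
  · refine Set.eq_empty_of_forall_notMem ?_
    rintro y ⟨h1, h2⟩
    exact h1 (eq_one_of_rank ((rank_eq_of_principalIdeal_eq h2).trans rank_one))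

/-- The elements of rank `n - 1` form one regular `𝒥`-class, by the rule e_ij e_jk = e_ik. Upper
singletons are constant on `ℛ`-classes and lower ones on `ℒ`-classes, so the conditions `i ∈ A` and
`j ∉ A` each cut out a union of classes. -/
theorem isRectangleType (hn : 2 ≤ n) {A : Set (Fin n)} (hA : A.Nonempty) (hA' : A ≠ Set.univ) :
    IsRectangleType (rectangle A) := by
  obtain ⟨k, l, hk, hl⟩ := exists_pair hA hA'
  choose e he using fun i j : Fin n => exists_of_missing i j
  have hee : ∀ i j k, e i j * e j k = e i k := fun i j k => ((he i j).mul (he j k)).eq (he i k)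
  let J : Set (motzkinMonoid n) := {y | principalIdeal y = principalIdeal (e k k)}
  have hJ : IsJClass J := ⟨_, rfl⟩
  have hJr : ∀ y, y ∈ J ↔ y.1.rank + 1 = n := by
    intro y
    constructor
    · intro hy
      rw [rank_eq_of_principalIdeal_eq hy]
      exact (he k k).rank
    · intro hy
      obtain ⟨i, j, hm⟩ := exists_missing hy
      obtain rfl := hm.eq (he i j)
      exact principalIdeal_eq (s := e i k) (t := e k j) (s' := e k i) (t' := e j k)
        (by rw [hee, hee]) (by rw [hee, hee])
  have hJe : ∀ i j, e i j ∈ J := fun i j => (hJr _).2 (he i j).rank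
  let V : Set (motzkinMonoid n) := {α | ∃ i ∈ A, α.1.Single (Sum.inl i)}
  let W : Set (motzkinMonoid n) := {α | ∃ i, i ∉ A ∧ α.1.Single (Sum.inr i)}
  have hV := sUnion_rClasses hJ V (by
    rintro y z s t - - ⟨i, hi, hs⟩ rfl -
    exact ⟨i, hi, single_mul_upper hs⟩)
  have hW := sUnion_lClasses hJ W (by
    rintro y z s t - - ⟨i, hi, hs⟩ rfl -
    exact ⟨i, hi, single_mul_lower hs⟩)
  refine ⟨J, ⟨hJ, ⟨e k k, rfl, e k k, by rw [hee, hee]⟩, fun y hy =>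
    (hJr y).2 (rank_of_notMem_rectangle hn hy)⟩,
    {L | (IsLClass L ∧ L ⊆ J) ∧ L ⊆ W}, {R | (IsRClass R ∧ R ⊆ J) ∧ R ⊆ V}, ?_, ?_, ?_, ?_, ?_⟩
  · have : e k k ∈ ⋃₀ {L | (IsLClass L ∧ L ⊆ J) ∧ L ⊆ W} :=
      hW ▸ ⟨hJe _ _, k, hk, (he k k).single_lower⟩
    obtain ⟨L, hL, -⟩ := this
    exact ⟨L, hL⟩
  · refine ⟨fun L hL => hL.1, fun hsub => ?_⟩
    -- The `ℒ`-class of e_ll, with `l ∈ A`, is left out.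
    obtain ⟨i, hi, hs⟩ := (hsub ⟨⟨e l l, rfl⟩, lClass_subset hJ (hJe l l)⟩).2 rfl
    exact hi ((he l l).single_lower_iff.1 hs ▸ hl)
  · have : e l l ∈ ⋃₀ {R | (IsRClass R ∧ R ⊆ J) ∧ R ⊆ V} :=
      hV ▸ ⟨hJe _ _, l, hl, (he l l).single⟩
    obtain ⟨R, hR, -⟩ := this
    exact ⟨R, hR⟩
  · refine ⟨fun R hR => hR.1, fun hsub => ?_⟩
    obtain ⟨i, hi, hs⟩ := (hsub ⟨⟨e k k, rfl⟩, rClass_subset hJ (hJe k k)⟩).2 rfl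
    exact hk ((he k k).single_iff.1 hs ▸ hi)
  · rw [hV, hW]
    ext y
    by_cases hy : y ∈ J
    · obtain ⟨i, j, hm⟩ := exists_missing ((hJr y).1 hy)
      have h1 : y ∈ V ↔ i ∈ A :=
        ⟨fun ⟨x, hx, hs⟩ => hm.single_iff.1 hs ▸ hx, fun h => ⟨i, h, hm.single⟩⟩
      have h2 : y ∈ W ↔ j ∉ A :=
        ⟨fun ⟨x, hx, hs⟩ => hm.single_lower_iff.1 hs ▸ hx, fun h => ⟨j, h, hm.single_lower⟩⟩
      simp only [Set.mem_inter_iff, Set.mem_union, hy, true_and, and_true, h1, h2,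
        mem_rectangle_of_missing hn hm, or_comm]
    · simp only [Set.mem_inter_iff, Set.mem_union, hy, false_and, and_false, or_self]

/-- The partial identity omitting `i` and `j`. -/
def omitPair (i j : Fin n) : motzkinMonoid n :=
  shift i i (by omega) (by omega) * (shift j j (by omega) (by omega))

theorem omitPair_mul_rel {i j : Fin n} {u v} : (omitPair i j * β).1.Rel u v ↔ u = v ∨
    (u ≠ Sum.inl i ∧ v ≠ Sum.inl i ∧ u ≠ Sum.inl j ∧ v ≠ Sum.inl j ∧ β.1.Rel u v) := by
  rw [omitPair, mul_assoc, shift_mul_rel, Equiv.swap_self, Equiv.refl_apply, Equiv.refl_apply,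
    shift_mul_rel, Equiv.swap_self, Equiv.refl_apply, Equiv.refl_apply]
  tauto

/-- Together with `hook_mul_omitPair` this makes the two diagrams `ℒ`-related: they differ only in
the upper hook. So removing the hooks on `i`, `j` does not empty the `𝒥`-class. -/
theorem omitPair_mul_hook {i j : Fin n} (hij : (j : ℕ) = i + 1) :
    omitPair i j * hook i j hij = omitPair i j := by
  refine ext_rel fun u v => ?_
  -- The factor `1` brings both diagrams into the form covered by the product formulas.
  rw [← mul_one (hook i j hij), ← mul_one (omitPair i j), mul_assoc, one_mul, omitPair_mul_rel,
    hook_mul_rel, omitPair_mul_rel]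
  tauto

theorem hook_mul_omitPair {i j : Fin n} (hij : (j : ℕ) = i + 1) :
    hook i j hij * omitPair i j = hook i j hij := by
  refine ext_rel fun u v => ?_
  rw [← mul_one (omitPair i j), hook_mul_rel, omitPair_mul_rel, ← mul_one (hook i j hij),
    hook_mul_rel]
  tauto

theorem hook_mul_hook {i j : Fin n} (hij : (j : ℕ) = i + 1) :
    hook i j hij * hook i j hij = hook i j hij := by
  nth_rewrite 1 [← hook_mul_omitPair hij]
  rw [mul_assoc, omitPair_mul_hook, hook_mul_omitPair]

theorem omitPair_mem_removeUpper (hn : 2 ≤ n) {i j : Fin n} (hij : (j : ℕ) = i + 1) :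
    omitPair i j ∈ removeUpper i j := by
  by_contra h
  have h1 := ((notMem_removeUpper hn hij).1 h).2
  rw [← mul_one (omitPair i j), omitPair_mul_rel] at h1
  rcases h1 with h1 | h1
  · exact fin_ne hij (Sum.inl_injective h1)
  · exact h1.1 rfl

/-- The removed elements are all `ℛ`-related to the hook, by `eq_hook_mul` and `hook_eq`. An upper
hook survives right multiplication, so what remains in the `𝒥`-class is closed under `ℛ`. -/
theorem isRemoveRType (hn : 2 ≤ n) {i j : Fin n} (hij : (j : ℕ) = i + 1) :
    IsRemoveRType (removeUpper i j) := by
  let J : Set (motzkinMonoid n) := {y | principalIdeal y = principalIdeal (hook i j hij)}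
  have hJ : IsJClass J := ⟨_, rfl⟩
  refine ⟨J, ⟨hJ, ⟨hook i j hij, rfl, 1, ?_⟩, fun y hy => ?_⟩, ⟨omitPair i j,
    omitPair_mem_removeUpper hn hij, ?_⟩, _, ?_, (Set.inter_comm _ _).trans
      (sUnion_rClasses hJ (removeUpper i j) ?_).symm⟩
  · rw [mul_one, hook_mul_hook]
  · obtain ⟨hr, hrel⟩ := (notMem_removeUpper hn hij).1 hy
    exact principalIdeal_eq (s := 1) (s' := 1)
      (by rw [one_mul]; exact eq_hook_mul hij hrel)
      (by rw [one_mul]; exact hook_eq hij hr hrel)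
  · exact principalIdeal_eq (t := 1) (s' := hook i j hij) (t' := 1)
      (by rw [mul_one, omitPair_mul_hook]) (by rw [mul_one, hook_mul_omitPair])
  · exact fun R hR => hR.1
  · intro y z s t hy hz hyT hzy hyz
    by_contra hzT
    obtain ⟨hr, hrel⟩ := (notMem_removeUpper hn hij).1 hzT
    refine (notMem_removeUpper hn hij).2 ⟨?_, ?_⟩ hyT
    · rw [rank_eq_of_principalIdeal_eq hy, rank_hook]
    · rw [hyz]
      exact rel_mul_upper hrel

theorem isRemoveLType (hn : 2 ≤ n) {i j : Fin n} (hij : (j : ℕ) = i + 1) :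
    IsRemoveLType (removeLower i j) := by
  let J : Set (motzkinMonoid n) := {y | principalIdeal y = principalIdeal (star (hook i j hij))}
  have hJ : IsJClass J := ⟨_, rfl⟩
  refine ⟨J, ⟨hJ, ⟨star (hook i j hij), rfl, 1, ?_⟩, fun y hy => ?_⟩, ⟨star (omitPair i j),
    ?_, ?_⟩, _, ?_, (Set.inter_comm _ _).trans
      (sUnion_lClasses hJ (removeLower i j) ?_).symm⟩
  · rw [mul_one, ← star_mul, hook_mul_hook]
  · obtain ⟨hr, hrel⟩ := (notMem_removeUpper hn hij).1 (mt (mem_removeLower hn hij).2 hy)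
    refine principalIdeal_eq (s := star (restrict (star y) {Sum.inl i, Sum.inl j}ᶜ)) (t := 1)
      (s' := strands (star y)) (t' := 1) ?_ ?_
    · rw [mul_one, ← star_mul, ← eq_hook_mul hij hrel, star_star]
    · rw [mul_one, star_hook_eq hij hr hrel, star_star]
  · rw [mem_removeLower hn hij, star_star]
    exact omitPair_mem_removeUpper hn hij
  · exact principalIdeal_eq (s := 1) (s' := 1) (t' := star (hook i j hij))
      (by rw [one_mul, ← star_mul, omitPair_mul_hook])
      (by rw [one_mul, ← star_mul, hook_mul_omitPair])
  · exact fun R hR => hR.1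
  · intro y z s t hy hz hyT hzy hyz
    by_contra hzT
    obtain ⟨hr, hrel⟩ := (notMem_removeLower hn hij).1 hzT
    refine (notMem_removeLower hn hij).2 ⟨?_, ?_⟩ hyT
    · rw [rank_eq_of_principalIdeal_eq hy, rank_star, rank_hook]
    · rw [hyz]
      exact rel_mul_lower hrel

/-! ### Counting -/

theorem ncard_nonempty_proper (hn : 2 ≤ n) :
    {A : Set (Fin n) | A.Nonempty ∧ A ≠ Set.univ}.ncard = 2 ^ n - 2 := by
  have h1 : {A : Set (Fin n) | A.Nonempty ∧ A ≠ Set.univ} = {∅, Set.univ}ᶜ := by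
    ext A
    simp only [Set.mem_ofPred_eq, Set.mem_compl_iff, Set.mem_insert_iff, Set.mem_singleton_iff,
      not_or, Set.nonempty_iff_ne_empty, ne_eq]
  have hne : (∅ : Set (Fin n)) ≠ Set.univ := by
    intro h
    exact Set.notMem_empty (⟨0, by omega⟩ : Fin n) (h ▸ Set.mem_univ _)
  have h2 := Set.ncard_add_ncard_compl ({∅, Set.univ} : Set (Set (Fin n)))
  rw [Set.ncard_pair hne, Nat.card_eq_fintype_card, Fintype.card_set, Fintype.card_fin] at h2
  rw [h1]
  omega

theorem setOf_rectangle : {T : Set (motzkinMonoid n) | ∃ A : Set (Fin n),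
    A.Nonempty ∧ A ≠ Set.univ ∧ T = rectangle A} =
      rectangle '' {A : Set (Fin n) | A.Nonempty ∧ A ≠ Set.univ} := by
  ext T
  constructor
  · rintro ⟨A, h1, h2, rfl⟩
    exact ⟨A, ⟨h1, h2⟩, rfl⟩
  · rintro ⟨A, ⟨h1, h2⟩, rfl⟩
    exact ⟨A, h1, h2, rfl⟩

theorem ncard_rectangle (hn : 2 ≤ n) : {T : Set (motzkinMonoid n) | ∃ A : Set (Fin n),
    A.Nonempty ∧ A ≠ Set.univ ∧ T = rectangle A}.ncard = 2 ^ n - 2 := by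
  rw [setOf_rectangle, Set.InjOn.ncard_image, ncard_nonempty_proper hn]
  exact fun A _ B hB h => rectangle_injOn hn hB.1 hB.2 h.le

theorem setOf_consecutive {X : Type*} (f : Fin n → Fin n → X) :
    {T | ∃ i j : Fin n, (j : ℕ) = i + 1 ∧ T = f i j} =
      Set.range fun i : Fin (n - 1) => f ⟨i, by omega⟩ ⟨i + 1, by omega⟩ := by
  ext T
  constructor
  · rintro ⟨i, j, hij, rfl⟩
    exact ⟨⟨i, by omega⟩, congrArg (f i) (Fin.ext hij.symm)⟩
  · rintro ⟨i, rfl⟩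
    exact ⟨_, _, rfl, rfl⟩

theorem ncard_consecutive {X : Type*} (f : Fin n → Fin n → X)
    (hf : ∀ i j k l : Fin n, (j : ℕ) = i + 1 → (l : ℕ) = k + 1 → f i j = f k l → i = k) :
    {T | ∃ i j : Fin n, (j : ℕ) = i + 1 ∧ T = f i j}.ncard = n - 1 := by
  rw [setOf_consecutive, ← Set.image_univ, Set.ncard_image_of_injective, Set.ncard_univ,
    Nat.card_eq_fintype_card, Fintype.card_fin]
  intro a b hab
  exact Fin.ext (Fin.mk.inj_iff.1 (hf _ _ _ _ rfl rfl hab))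

theorem ncard_maximal (hn : 2 ≤ n) :
    {T : Set (motzkinMonoid n) | IsMaximalSubsemigroup T}.ncard = 2 ^ n + 2 * n - 3 := by
  have hset : {T : Set (motzkinMonoid n) | IsMaximalSubsemigroup T} = {{1}ᶜ} ∪
      ({T | ∃ A : Set (Fin n), A.Nonempty ∧ A ≠ Set.univ ∧ T = rectangle A} ∪
      ({T | ∃ i j : Fin n, (j : ℕ) = i + 1 ∧ T = removeUpper i j} ∪
      {T | ∃ i j : Fin n, (j : ℕ) = i + 1 ∧ T = removeLower i j})) := by
    ext T
    exact isMaximalSubsemigroup_iff hn T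
  have f2 : {T : Set (motzkinMonoid n) | ∃ A : Set (Fin n),
      A.Nonempty ∧ A ≠ Set.univ ∧ T = rectangle A}.Finite := by
    rw [setOf_rectangle]
    exact (Set.toFinite _).image _
  have f3 : {T | ∃ i j : Fin n, (j : ℕ) = i + 1 ∧ T = removeUpper i j}.Finite := by
    rw [setOf_consecutive]
    exact Set.finite_range _
  have f4 : {T | ∃ i j : Fin n, (j : ℕ) = i + 1 ∧ T = removeLower i j}.Finite := by
    rw [setOf_consecutive]
    exact Set.finite_range _
  have hrect : ∀ A : Set (Fin n), A.Nonempty → A ≠ Set.univ →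
      ∃ α : motzkinMonoid n, α ∉ rectangle A ∧ α.1.rank + 1 = n := by
    intro A hA hA'
    obtain ⟨α, hα⟩ := (Set.ne_univ_iff_exists_notMem _).1
      (IsListed.ne_univ hn (Or.inr (Or.inl ⟨A, hA, hA', rfl⟩)))
    exact ⟨α, hα, rank_of_notMem_rectangle hn hα⟩
  have hr1 := rank_one (n := n)
  rw [hset, Set.ncard_union_eq ?_ (Set.finite_singleton _) (f2.union (f3.union f4)),
    Set.ncard_union_eq ?_ f2 (f3.union f4), Set.ncard_union_eq ?_ f3 f4, Set.ncard_singleton,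
    ncard_rectangle hn,
    ncard_consecutive _ fun i j k l hij hkl h => (removeUpper_injOn hn hij hkl h.le).1,
    ncard_consecutive _ fun i j k l hij hkl h => (removeLower_injOn hn hij hkl h.le).1]
  -- The count is `1 + (2 ^ n - 2) + (n - 1) + (n - 1)`; the bound keeps the truncated subtractions
  -- exact.
  · have : 2 ^ 2 ≤ 2 ^ n := Nat.pow_le_pow_right (by norm_num) hn
    omega
  · rw [Set.disjoint_left]
    rintro T ⟨i, j, hij, rfl⟩ ⟨k, l, hkl, h⟩
    exact not_removeUpper_subset_removeLower hn hij hkl h.le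
  · rw [Set.disjoint_left]
    rintro T ⟨A, hA, hA', rfl⟩ hT
    obtain ⟨α, hα, hr⟩ := hrect A hA hA'
    rcases hT with ⟨i, j, hij, h⟩ | ⟨i, j, hij, h⟩
    · rw [h, notMem_removeUpper hn hij] at hα
      omega
    · rw [h, notMem_removeLower hn hij] at hα
      omega
  · rw [Set.disjoint_left]
    rintro T hT hT'
    have h1 : (1 : motzkinMonoid n) ∉ T := by
      rw [Set.mem_singleton_iff.1 hT, Set.notMem_compl_iff]
      rfl
    rcases hT' with ⟨A, hA, hA', rfl⟩ | ⟨i, j, hij, rfl⟩ | ⟨i, j, hij, rfl⟩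
    · have := rank_of_notMem_rectangle hn h1
      omega
    · rw [notMem_removeUpper hn hij] at h1
      omega
    · rw [notMem_removeLower hn hij] at h1
      omega

/-! ### Degree one -/

theorem motzkinMonoid_one : motzkinMonoid 1 = ⊤ := by
  refine (Submonoid.eq_top_iff' _).2 fun α => ⟨?_, ?_⟩
  · rw [isPartialBrauer_iff]
    rintro (a | a) (b | b) (c | c) - - <;>
      simp only [Subsingleton.elim a b, Subsingleton.elim b c, true_or, or_true]
  · rw [isPlanar_iff]
    rintro (a | a) (b | b) (x | x) (y | y) - - h1 h2 h3 <;>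
      simp only [position_inl, position_inr] at h1 h2 h3 <;> omega

/-- The element of degree one without a transverse block. -/
def zero : motzkinMonoid 1 := restrict 1 ∅

theorem zero_ne_one : zero ≠ 1 := by
  intro h
  have h1 : zero.1.Rel (Sum.inl 0) (Sum.inr 0) := h ▸ one_rel_through 0
  rcases restrict_rel.1 h1 with h | ⟨h, -⟩
  · cases h
  · exact h

theorem eq_one_or_zero (α : motzkinMonoid 1) : α = 1 ∨ α = zero := by
  have hz : ∀ u v, zero.1.Rel u v ↔ u = v := fun u v => by simp [zero, restrict_rel]
  by_cases h : α.1.Rel (Sum.inl 0) (Sum.inr 0)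
  · left
    have h1 : ∀ u v, (1 : motzkinMonoid 1).1.Rel u v := fun u v => Subsingleton.elim (α := Fin 1) _ _
    refine ext_rel fun u v => iff_of_true ?_ (h1 u v)
    rcases u with u | u <;> rcases v with v | v <;> rw [Fin.fin_one_eq_zero u, Fin.fin_one_eq_zero v]
    exacts [rel_refl _ _, h, h.symm, rel_refl _ _]
  · right
    refine ext_rel fun u v => ?_
    rw [hz]
    constructor
    · intro h'
      rcases u with u | u <;> rcases v with v | v <;>
        rw [Fin.fin_one_eq_zero u, Fin.fin_one_eq_zero v] at h' ⊢
      exacts [absurd h' h, absurd h'.symm h]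
    · rintro rfl
      exact rel_refl _ _

theorem zero_mul_zero : zero * zero = zero :=
  (eq_one_or_zero _).resolve_left (mul_ne_one zero_ne_one)

theorem mul_comm_one (α β : motzkinMonoid 1) : α * β = β * α := by
  rcases eq_one_or_zero α with rfl | rfl <;> rcases eq_one_or_zero β with rfl | rfl <;> simp

theorem mul_self_one (α : motzkinMonoid 1) : α * α = α := by
  rcases eq_one_or_zero α with rfl | rfl
  exacts [one_mul _, zero_mul_zero]

theorem card_one : Nat.card (motzkinMonoid 1) = 2 := by
  refine Nat.card_eq_two_iff.2 ⟨1, zero, zero_ne_one.symm, ?_⟩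
  exact Set.eq_univ_of_forall fun α => eq_one_or_zero α

theorem exists_ne_one (α : motzkinMonoid 1) : ∃ β, β ≠ α ∧ ∀ γ, γ = α ∨ γ = β := by
  rcases eq_one_or_zero α with rfl | rfl
  · exact ⟨zero, zero_ne_one, eq_one_or_zero⟩
  · exact ⟨1, zero_ne_one.symm, fun γ => (eq_one_or_zero γ).symm⟩

/-- Both of the two elements are idempotent, so singletons are subsemigroups, and nothing lies
strictly between a singleton and the whole monoid. -/
theorem isMaximalSubsemigroup_one_iff (T : Set (motzkinMonoid 1)) :
    IsMaximalSubsemigroup T ↔ ∃ α, T = {α} := by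
  let s : motzkinMonoid 1 → Subsemigroup (motzkinMonoid 1) := fun α =>
    ⟨{α}, by rintro _ _ rfl rfl; exact mul_self_one _⟩
  have hs : ∀ α, (s α : Set (motzkinMonoid 1)) = {α} := fun _ => rfl
  have hs' : ∀ α β, β ∈ s α ↔ β = α := fun _ _ => Iff.rfl
  constructor
  · rintro ⟨M, rfl, hM⟩
    obtain ⟨x, hx⟩ : ∃ x, x ∉ M := by
      by_contra! h
      exact hM.1 ((Subsemigroup.eq_top_iff' _).2 h)
    obtain ⟨y, hyx, hy⟩ := exists_ne_one x
    -- This also covers the empty subsemigroup, which is then not maximal.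
    have hMy : M ≤ s y := by
      intro z hz
      rcases hy z with rfl | rfl
      exacts [absurd hz hx, rfl]
    refine ⟨y, ?_⟩
    rcases hMy.eq_or_lt with h | h
    · rw [h, hs]
    · have h1 : x ∈ s y := by
        rw [hM.2 _ h]
        exact Subsemigroup.mem_top _
      exact absurd ((hs' _ _).1 h1).symm hyx
  · rintro ⟨α, rfl⟩
    obtain ⟨β, hne, hβ⟩ := exists_ne_one α
    refine ⟨s α, rfl, fun h => ?_, fun U hU => ?_⟩
    · exact hne ((hs' _ _).1 (h ▸ Subsemigroup.mem_top β))
    · obtain ⟨z, hz, hz'⟩ := SetLike.exists_of_lt hU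
      have hzβ : z = β := (hβ z).resolve_left hz'
      refine (Subsemigroup.eq_top_iff' _).2 fun γ => ?_
      rcases hβ γ with rfl | rfl
      · exact hU.le rfl
      · rwa [← hzβ]

end Motzkin

theorem mainTheorem4 :
    (∀ n : ℕ, 2 ≤ n →
      -- the maximal subsemigroups
      (∀ T : Set (motzkinMonoid n), IsMaximalSubsemigroup T ↔
        T = {1}ᶜ ∨
        (∃ A : Set (Fin n), A.Nonempty ∧ A ≠ Set.univ ∧ T = Motzkin.rectangle A) ∨
        (∃ i j : Fin n, (j : ℕ) = i + 1 ∧ T = Motzkin.removeUpper i j) ∨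
        (∃ i j : Fin n, (j : ℕ) = i + 1 ∧ T = Motzkin.removeLower i j)) ∧
      -- their types
      IsRemoveJType ({1}ᶜ : Set (motzkinMonoid n)) ∧
      (∀ A : Set (Fin n), A.Nonempty → A ≠ Set.univ → IsRectangleType (Motzkin.rectangle A)) ∧
      (∀ i j : Fin n, (j : ℕ) = i + 1 → IsRemoveRType (Motzkin.removeUpper i j)) ∧
      (∀ i j : Fin n, (j : ℕ) = i + 1 → IsRemoveLType (Motzkin.removeLower i j)) ∧
      -- their number
      {T : Set (motzkinMonoid n) | ∃ A : Set (Fin n),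
        A.Nonempty ∧ A ≠ Set.univ ∧ T = Motzkin.rectangle A}.ncard = 2 ^ n - 2 ∧
      {T : Set (motzkinMonoid n) | IsMaximalSubsemigroup T}.ncard = 2 ^ n + 2 * n - 3) ∧
    -- degree one
    motzkinMonoid 1 = ⊤ ∧
    (∀ α β : motzkinMonoid 1, α * β = β * α) ∧
    (∀ α : motzkinMonoid 1, α * α = α) ∧
    Nat.card (motzkinMonoid 1) = 2 ∧
    (∀ T : Set (motzkinMonoid 1), IsMaximalSubsemigroup T ↔ ∃ α, T = {α}) :=
  ⟨fun _ hn => ⟨Motzkin.isMaximalSubsemigroup_iff hn, Motzkin.isRemoveJType,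
      fun _ hA hA' => Motzkin.isRectangleType hn hA hA',
      fun _ _ hij => Motzkin.isRemoveRType hn hij, fun _ _ hij => Motzkin.isRemoveLType hn hij,
      Motzkin.ncard_rectangle hn, Motzkin.ncard_maximal hn⟩,
    Motzkin.motzkinMonoid_one, Motzkin.mul_comm_one, Motzkin.mul_self_one, Motzkin.card_one,
    Motzkin.isMaximalSubsemigroup_one_iff⟩
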